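/- A \emph{constraint language} is a finite set $\Gamma$ of relations $R\subseteq\{0,1\}^r$ (of various arities $r$). An \emph{instance} of CSP over $\Gamma$ consists of a finite set $V$ of variables and a set $C$ of constraints $R(v_1,\dots,v_r)$ with $R\in\Gamma$ of arity $r$ and $v_1,\dots,v_r\in V$ (not necessarily distinct). An assignment $\sigma\colon V\to\{0,1\}$ \emph{satisfies} the instance if $(\sigma(v_1),\dots,\sigma(v_r))\in R$ for every constraint $R(v_1,\dots,v_r)\in C$; $Z(I)$ denotes the number of satisfying assignments of $I$. The degree of a variable is the number of times it appears among the constraints, counted with multiplicity inside each scope, and the degree of an instance is the maximum degree of its variables. $\#\mathrm{CSP}(\Gamma)$ is the problem of computing $Z(I)$ for an instance $I$ over $\Gamma$, and $\#\mathrm{CSP}_d(\Gamma)$ is its restriction to instances of degree at most $d$. Instances are given as words that list the variables and then the constraints. Let $\Gamma_{\mathrm{pin}}=\{R_{\mathrm{zero}},R_{\mathrm{one}}\}$ with $R_{\mathrm{zero}}=\{0\}$ and $R_{\mathrm{one}}=\{1\}$. The language $\Gamma$ \emph{$d$-simulates equality} if for every $k\ge 2$ there are $\ell\ge k$, $m\ge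 1$ and an instance $I$ over $\Gamma\cup\Gamma_{\mathrm{pin}}$ with variables $x_1,\dots,x_\ell$, of degree at most $d$ and with each of $x_1,\dots,x_k$ of degree at most $d-1$, that has exactly $m$ satisfying assignments with $\sigma(x_1)=\dots=\sigma(x_k)=0$, exactly $m$ with $\sigma(x_1)=\dots=\sigma(x_k)=1$, and no other satisfying assignments. A \emph{randomized approximation scheme} (RAS) for a counting problem $f$ produces, on input of an instance $x$ of $f$ and an error bound $\varepsilon\in(0,1)$, a random natural number $Y$ with $\Pr\bigl(e^{-\varepsilon}f(x)\le Y\le e^{\varepsilon}f(x)\bigr)\ge\frac34$. An \emph{approximation-preserving reduction} from $f$ to $g$, whose existence is written $f\le_{\mathrm{AP}}g$, is a probabilistic oracle Turing machine $M$ that takes inputs $(x,\varepsilon)$ as above and satisfies: (i) every oracle call of $M$ is of the form $(w,\delta)$, where $w$ is an instance of $g$ and $0<\delta<1$ with $\delta^{-1}\le\mathrm{poly}(|x|,\varepsilon^{-1})$; (ii) $M$ is a RAS for $f$ whenever the oracle is a RAS for $g$; (iii) the run-time of $M$ is polynomial in $|x|$ and $\varepsilon^{-1}$. (Error bounds given to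 machines and oracles are reciprocals $1/N$ of integers $N\ge2$, with $N$ written in unary; numerical answers are written in binary; an oracle call takes one step and its answers are independent samples.) \textbf{Proposition.} Let $\Gamma$ be a constraint language and $d$ a natural number. If $\Gamma$ $d$-simulates equality, then $$\#\mathrm{CSP}(\Gamma)\le_{\mathrm{AP}}\#\mathrm{CSP}_d(\Gamma\cup\Gamma_{\mathrm{pin}}).$$ -/

import Mathlib

open scoped ENNReal

noncomputable section

namespace BoolCSP

/-! ### Probabilistic oracle Turing machines -/

/-- The stacks through which a probabilistic oracle machine communicates. -/
inductive Port
  | input | inputErr | query | queryErr | answer | output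
deriving DecidableEq

/-- Alphabets of the communication stacks. Instances of the problem to be solved are words over `A`,
instances of the oracle problem are words over `B`. Error bounds are reciprocals `1 / N` of natural
numbers, with `N` written in unary; the oracle's answer and the output are numbers in binary. -/
abbrev Port.Alphabet (A B : Type) : Port → Type
  | .input => A
  | .inputErr => Unit
  | .query => B
  | .queryErr => Unit
  | .answer => Bool
  | .output => Bool

/-- One instruction: a deterministic statement of Mathlib's multi-stack Turing machine model, a fair
coin toss that selects the next label, or an oracle call after which the machine continues at the
given label. -/
inductive Instr {K : Type} (S : K → Type) (Λ σ : Type)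
  | run : Turing.TM2.Stmt S Λ σ → Instr S Λ σ
  | toss : Λ → Λ → Instr S Λ σ
  | ask : Λ → Instr S Λ σ

/-- A probabilistic oracle Turing machine (with finitely many work stacks, in addition to the
communication stacks, finite alphabets, finitely many labels and finitely many internal states). -/
structure OracleMachine (A B : Type) where
  /-- index type of the work stacks -/
  W : Type
  [decW : DecidableEq W]
  [finW : Finite W]
  /-- alphabets of the work stacks -/
  Work : W → Type
  [finWork : ∀ w, Finite (Work w)]
  /-- labels of the program -/
  Λ : Type
  [finΛ : Finite Λ]
  /-- internal states -/
  σ : Type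
  [finσ : Finite σ]
  start : Λ
  init : σ
  prog : Λ → Instr (Sum.elim (Port.Alphabet A B) Work) Λ σ

namespace OracleMachine

variable {A B : Type} (M : OracleMachine A B)

instance : DecidableEq M.W := M.decW

/-- Index type of all stacks. -/
abbrev K : Type := Port ⊕ M.W

/-- Alphabets of all stacks. -/
abbrev Alphabet : M.K → Type := Sum.elim (Port.Alphabet A B) M.Work

/-- Configurations: the current label (`none` once halted), the internal state and the stacks. -/
abbrev Cfg : Type := Turing.TM2.Cfg M.Alphabet M.Λ M.σ

/-- Initial configuration on input `(x, 1 / N)`. -/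
def initCfg (x : List A) (N : ℕ) : M.Cfg where
  l := some M.start
  var := M.init
  stk k := match k with
    | .inl .input => x
    | .inl .inputErr => List.replicate N ()
    | .inl .query => []
    | .inl .queryErr => []
    | .inl .answer => []
    | .inl .output => []
    | .inr _ => []

/-- The word on the query stack. -/
def queryWord (c : M.Cfg) : List B := c.stk (.inl .query)

/-- The number `N` such that `1 / N` is the error bound on the query stack. -/
def queryErr (c : M.Cfg) : ℕ := (c.stk (.inl .queryErr)).length

/-- The number on the output stack, written in binary with the least significant bit on top. -/
def outputValue (c : M.Cfg) : ℕ :=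
  List.foldr Nat.bit 0 (c.stk (.inl .output) : List Bool)

/-- The next instruction of the machine is an oracle call. -/
def IsAsking (c : M.Cfg) : Prop := ∃ q q' : M.Λ, c.l = some q ∧ M.prog q = .ask q'

/-- The configuration in which the oracle call is answered by `Y`: the query is removed and the
binary digits of `Y` (least significant bit on top) replace the content of the answer stack. -/
def answerCfg (q : M.Λ) (c : M.Cfg) (Y : ℕ) : M.Cfg where
  l := some q
  var := c.var
  stk k := match k with
    | .inl .query => []
    | .inl .queryErr => []
    | .inl .answer => Nat.bits Y
    | k => c.stk k

/-- The distribution of the next configuration. The oracle call `(w, 1 / N)` is answered by a fresh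
sample from `O w N`. -/
def step (O : List B → ℕ → PMF ℕ) (c : M.Cfg) : PMF M.Cfg :=
  match c.l with
  | none => PMF.pure c
  | some q =>
    match M.prog q with
    | .run s => PMF.pure (Turing.TM2.stepAux s c.var c.stk)
    | .toss q₀ q₁ => (PMF.uniformOfFintype Bool).map fun b =>
        { c with l := some (cond b q₁ q₀) }
    | .ask q' => (O (M.queryWord c) (M.queryErr c)).map (M.answerCfg q' c)

/-- The distribution of the configuration after `t` steps on input `(x, 1 / N)`. -/
def run (O : List B → ℕ → PMF ℕ) (x : List A) (N : ℕ) : ℕ → PMF M.Cfg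
  | 0 => PMF.pure (M.initCfg x N)
  | t + 1 => (run O x N t).bind (M.step O)

end OracleMachine

/-! ### Counting problems and approximation-preserving reductions -/

/-- A counting problem: a natural number is attached to every instance, and instances are encoded
as words over the alphabet `A`. -/
structure CountingProblem (A : Type) where
  Inst : Type
  encode : Inst → List A
  encode_injective : Function.Injective encode
  value : Inst → ℕ

/-- The natural numbers `Y` with `e^{-ε} ≤ Y / v ≤ e^ε`, where `ε = 1 / N` (and `Y = 0` if
`v = 0`). -/
def goodApprox (v N : ℕ) : Set ℕ :=
  {Y | Real.exp (-(1 / (N : ℝ))) * v ≤ Y ∧ (Y : ℝ) ≤ Real.exp (1 / (N : ℝ)) * v}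

/-- The random numbers `O w N` form a randomized approximation scheme for `g`. As `1 / N` ranges over
error bounds in `(0, 1)`, only `N ≥ 2` matters. -/
def IsRAS {B : Type} (g : CountingProblem B) (O : List B → ℕ → PMF ℕ) : Prop :=
  ∀ (I : g.Inst) (N : ℕ), 2 ≤ N →
    3 / 4 ≤ (O (g.encode I) N).toOuterMeasure (goodApprox (g.value I) N)

/-- `M` is an approximation-preserving reduction from `f` to `g`; the polynomial `p`, evaluated at
`|x| + ε⁻¹`, bounds both the reciprocals of the error bounds in oracle calls and the run-time. -/
structure IsAPReduction {A B : Type} (M : OracleMachine A B) (f : CountingProblem A)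
    (g : CountingProblem B) (p : Polynomial ℕ) : Prop where
  /-- Every oracle call that may occur consists of an instance of `g` and an error bound `δ` with
  `0 < δ < 1` and `δ⁻¹ ≤ poly(|x|, ε⁻¹)`. -/
  calls : ∀ (O : List B → ℕ → PMF ℕ) (I : f.Inst) (N : ℕ), 2 ≤ N →
    ∀ t, ∀ c ∈ (M.run O (f.encode I) N t).support, M.IsAsking c →
      (∃ J : g.Inst, M.queryWord c = g.encode J) ∧ 2 ≤ M.queryErr c ∧
        M.queryErr c ≤ p.eval ((f.encode I).length + N)
  /-- Every computation halts after polynomially many steps. -/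
  time : ∀ (O : List B → ℕ → PMF ℕ) (I : f.Inst) (N : ℕ), 2 ≤ N →
    ∀ c ∈ (M.run O (f.encode I) N (p.eval ((f.encode I).length + N))).support, c.l = none
  /-- If the oracle is a randomized approximation scheme for `g`, then `M` is one for `f`. -/
  approx : ∀ (O : List B → ℕ → PMF ℕ), IsRAS g O → ∀ (I : f.Inst) (N : ℕ), 2 ≤ N →
    3 / 4 ≤ ((M.run O (f.encode I) N (p.eval ((f.encode I).length + N))).map
      M.outputValue).toOuterMeasure (goodApprox (f.value I) N)

/-- `f ≤_AP g`, for counting problems over finite alphabets. -/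
def APReducible {A B : Type} [Finite A] [Finite B] (f : CountingProblem A)
    (g : CountingProblem B) : Prop :=
  ∃ (M : OracleMachine A B) (p : Polynomial ℕ), IsAPReduction M f g p

/-! ### Boolean constraint satisfaction problems -/

/-- A Boolean relation, given by its arity and its set of tuples. -/
abbrev BoolRel : Type := Σ r : ℕ, Finset (Fin r → Bool)

/-- A constraint language is a finite set of Boolean relations. -/
abbrev ConstraintLanguage : Type := Finset BoolRel

def Rzero : BoolRel := ⟨1, {fun _ => false}⟩

def Rone : BoolRel := ⟨1, {fun _ => true}⟩

def pinLanguage : ConstraintLanguage := {Rzero, Rone}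

/-- A constraint `R(v₁, …, v_r)` over the variables `Fin n`: a relation in `Γ` and a scope. -/
abbrev Constraint (Γ : ConstraintLanguage) (n : ℕ) : Type :=
  Σ R : {R : BoolRel // R ∈ Γ}, (Fin R.1.1 → Fin n)

/-- An instance: a finite set of variables and a set of constraints, listed without repetition. -/
structure CSPInstance (Γ : ConstraintLanguage) where
  numVars : ℕ
  constraints : List (Constraint Γ numVars)
  nodup : constraints.Nodup

namespace CSPInstance

variable {Γ : ConstraintLanguage} (I : CSPInstance Γ)

def Satisfies (s : Fin I.numVars → Bool) : Prop :=
  ∀ c ∈ I.constraints, (fun i => s (c.2 i)) ∈ c.1.1.2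

/-- The number `Z(I)` of satisfying assignments. -/
def Z : ℕ := Set.ncard {s : Fin I.numVars → Bool | I.Satisfies s}

/-- The number of times the variable `v` appears among the constraints. -/
def varDegree (v : Fin I.numVars) : ℕ :=
  (I.constraints.map fun c => (Finset.univ.filter fun i => c.2 i = v).card).sum

def degree : ℕ := Finset.univ.sup I.varDegree

end CSPInstance

/-- Input symbols: the tick `inl true`, the end mark `inl false`, and one symbol for the name of each
relation in `Γ`. -/
abbrev Sym (Γ : ConstraintLanguage) : Type := Bool ⊕ {R : BoolRel // R ∈ Γ}

/-- Unary code of a natural number. -/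
def encodeNum (Γ : ConstraintLanguage) (n : ℕ) : List (Sym Γ) :=
  List.replicate n (.inl true) ++ [.inl false]

/-- Code of a constraint: the name of its relation followed by the variables of its scope. -/
def encodeConstraint {Γ : ConstraintLanguage} {n : ℕ} (c : Constraint Γ n) : List (Sym Γ) :=
  .inr c.1 :: (List.ofFn c.2).flatMap fun v => encodeNum Γ v

/-- Code of an instance: the number of variables, followed by the list of constraints. -/
def CSPInstance.encode {Γ : ConstraintLanguage} (I : CSPInstance Γ) : List (Sym Γ) :=
  encodeNum Γ I.numVars ++ I.constraints.flatMap encodeConstraint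

theorem encodeNum_append_inj {Γ : ConstraintLanguage} :
    ∀ {a b : ℕ} {l l' : List (Sym Γ)}, encodeNum Γ a ++ l = encodeNum Γ b ++ l' →
      a = b ∧ l = l' := by
  intro a
  induction a with
  | zero =>
    intro b l l' h
    cases b with
    | zero => simpa [encodeNum] using h
    | succ b => simp [encodeNum, List.replicate_succ] at h
  | succ a ih =>
    intro b l l' h
    cases b with
    | zero => simp [encodeNum, List.replicate_succ] at h
    | succ b =>
      have h' : encodeNum Γ a ++ l = encodeNum Γ b ++ l' := by
        simpa [encodeNum, List.replicate_succ] using h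
      obtain ⟨h1, h2⟩ := ih h'
      exact ⟨by rw [h1], h2⟩

theorem encodeScope_append_inj {Γ : ConstraintLanguage} {n : ℕ} :
    ∀ {u v : List (Fin n)} {l l' : List (Sym Γ)}, u.length = v.length →
      (u.flatMap fun x => encodeNum Γ x) ++ l = (v.flatMap fun x => encodeNum Γ x) ++ l' →
      u = v ∧ l = l' := by
  intro u
  induction u with
  | nil =>
    intro v l l' hl h
    cases v with
    | nil => simpa using h
    | cons => simp at hl
  | cons x u ih =>
    intro v l l' hl h
    cases v with
    | nil => simp at hl
    | cons y v =>
      change (encodeNum Γ x ++ u.flatMap fun x => encodeNum Γ x) ++ l =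
        (encodeNum Γ y ++ v.flatMap fun x => encodeNum Γ x) ++ l' at h
      rw [List.append_assoc, List.append_assoc] at h
      obtain ⟨h1, h2⟩ := encodeNum_append_inj h
      obtain ⟨h3, h4⟩ := ih (by simpa using hl) h2
      exact ⟨by rw [Fin.ext h1, h3], h4⟩

theorem encodeConstraint_append_inj {Γ : ConstraintLanguage} {n : ℕ} {c c' : Constraint Γ n}
    {l l' : List (Sym Γ)} (h : encodeConstraint c ++ l = encodeConstraint c' ++ l') :
    c = c' ∧ l = l' := by
  obtain ⟨R, u⟩ := c
  obtain ⟨R', u'⟩ := c'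
  simp only [encodeConstraint, List.cons_append, List.cons.injEq, Sum.inr.injEq] at h
  obtain ⟨rfl, h⟩ := h
  obtain ⟨h1, h2⟩ := encodeScope_append_inj (by simp) h
  exact ⟨by rw [List.ofFn_injective h1], h2⟩

theorem encodeConstraints_inj {Γ : ConstraintLanguage} {n : ℕ} :
    ∀ {C C' : List (Constraint Γ n)},
      C.flatMap encodeConstraint = C'.flatMap encodeConstraint → C = C' := by
  intro C
  induction C with
  | nil =>
    intro C' h
    cases C' with
    | nil => rfl
    | cons c C' => simp [encodeConstraint] at h
  | cons c C ih =>
    intro C' h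
    cases C' with
    | nil => simp [encodeConstraint] at h
    | cons c' C' =>
      change encodeConstraint c ++ C.flatMap encodeConstraint =
        encodeConstraint c' ++ C'.flatMap encodeConstraint at h
      obtain ⟨h1, h2⟩ := encodeConstraint_append_inj h
      rw [h1, ih h2]

theorem CSPInstance.encode_injective (Γ : ConstraintLanguage) :
    Function.Injective (CSPInstance.encode (Γ := Γ)) := by
  rintro ⟨n, C, hC⟩ ⟨n', C', hC'⟩ h
  obtain ⟨h1, h2⟩ := encodeNum_append_inj h
  change n = n' at h1
  subst h1
  obtain rfl : C = C' := encodeConstraints_inj h2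
  rfl

/-- The problem `#CSP(Γ)`. -/
def numCSP (Γ : ConstraintLanguage) : CountingProblem (Sym Γ) where
  Inst := CSPInstance Γ
  encode := CSPInstance.encode
  encode_injective := CSPInstance.encode_injective Γ
  value := CSPInstance.Z

/-- The problem `#CSP_d(Γ)`: the restriction of `#CSP(Γ)` to instances of degree at most `d`. -/
def numCSPDeg (d : ℕ) (Γ : ConstraintLanguage) : CountingProblem (Sym Γ) where
  Inst := {I : CSPInstance Γ // I.degree ≤ d}
  encode I := I.1.encode
  encode_injective := (CSPInstance.encode_injective Γ).comp Subtype.val_injective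
  value I := I.1.Z

/-! ### Simulating equality -/

/-- `Γ` `d`-simulates the `k`-ary equality relation: some instance over `Γ ∪ {R_zero, R_one}` of
degree at most `d` has exactly `m ≥ 1` satisfying assignments that are constantly 0 on the first `k`
variables, exactly `m` that are constantly 1 there, and no others; each of the first `k` variables
has degree at most `d - 1`. -/
def DSimulatesEqK (d k : ℕ) (Γ : ConstraintLanguage) : Prop :=
  ∃ (I : CSPInstance (Γ ∪ pinLanguage)) (hk : k ≤ I.numVars) (m : ℕ), 1 ≤ m ∧
    Set.ncard {s | I.Satisfies s ∧ ∀ i : Fin k, s (Fin.castLE hk i) = false} = m ∧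
    Set.ncard {s | I.Satisfies s ∧ ∀ i : Fin k, s (Fin.castLE hk i) = true} = m ∧
    (∀ s, I.Satisfies s → (∀ i : Fin k, s (Fin.castLE hk i) = false) ∨
      (∀ i : Fin k, s (Fin.castLE hk i) = true)) ∧
    I.degree ≤ d ∧ ∀ i : Fin k, I.varDegree (Fin.castLE hk i) + 1 ≤ d

def DSimulatesEquality (d : ℕ) (Γ : ConstraintLanguage) : Prop :=
  ∀ k, 2 ≤ k → DSimulatesEqK d k Γ

end BoolCSP

end

/-
The instances that simulate equality may depend on `k` in an arbitrary way, so a machine can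
only use finitely many of them. Two suffice: a gadget `H` for the binary equality relation,
in which variables occur `h` times altogether, and a gadget `G` for the equality relation on
`2 * h + 2` variables, its ports.

Let an instance have `n` variables and `T` occurrences of variables. Take `T + 2` cyclically
arranged layers of `n` cells, one for each variable, where a cell consists of a copy of `G`
for each variable of `H`. A copy of `H` links each cell to the cell of the same variable in
the preceding layer, which provides the second of the two variables that `H` forces to be
equal. Each occurrence of a variable in this copy of `H` is replaced by a port of its own
in the respective copy of `G`; this takes up to `h` ports for each of the two cells that
use a copy of `G`. The `j`-th occurrence of a variable in the given instance is replaced by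
a further port in the cell of this variable in layer `j + 2`. Since a port has degree at
most `d - 1` in `G`, the degree of the resulting instance is at most `d`. In a satisfying
assignment the layers agree, whence the number of satisfying assignments is that of the
given instance times a power of a constant, with an exponent that depends only on `n` and `T`.

A machine writes down this instance, calls the oracle once, with error bound `1 / (8 * N)`,
divides the answer by the power and rounds to the nearest integer.
-/

noncomputable section

namespace BoolCSP

/-! ### Structured stack programs -/

/-- Structured programs over stacks with alphabets `S` and a finite store `σ`. The command
`loop k body` pops symbols `a` from the stack `k` and runs `body a`, until the stack is empty. -/
inductive Prog {K : Type} (S : K → Type) (σ : Type) : Type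
  | push (k : K) (f : σ → S k) : Prog S σ
  | pop (k : K) (f : σ → Option (S k) → σ) : Prog S σ
  | load (f : σ → σ) : Prog S σ
  | seq (p q : Prog S σ) : Prog S σ
  | ite (c : σ → Bool) (p q : Prog S σ) : Prog S σ
  | loop (k : K) (body : S k → Prog S σ) : Prog S σ

namespace Prog

variable {K : Type} {S : K → Type} {σ : Type}

/-- The control points of a program. -/
def Lab : Prog S σ → Type
  | push _ _ => Unit
  | pop _ _ => Unit
  | load _ => Unit
  | seq p q => p.Lab ⊕ q.Lab
  | ite _ p q => Option (p.Lab ⊕ q.Lab)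
  | loop _ body => Option (Σ a, (body a).Lab)

/-- The control point at which a program starts. -/
def entry : (p : Prog S σ) → p.Lab
  | push _ _ => ()
  | pop _ _ => ()
  | load _ => ()
  | seq p _ => .inl p.entry
  | ite _ _ _ => none
  | loop _ _ => none

theorem finite_lab [∀ k, Finite (S k)] (p : Prog S σ) : Finite p.Lab := by
  induction p with
  | push => exact inferInstanceAs (Finite Unit)
  | pop => exact inferInstanceAs (Finite Unit)
  | load => exact inferInstanceAs (Finite Unit)
  | seq p q hp hq => exact inferInstanceAs (Finite (p.Lab ⊕ q.Lab))
  | ite c p q hp hq => exact inferInstanceAs (Finite (Option (p.Lab ⊕ q.Lab)))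
  | loop k body h => exact inferInstanceAs (Finite (Option (Σ a, (body a).Lab)))

/-- Compilation to statements of a multi-stack machine: `emb` places the control points of the
program among the labels of the machine, and `exit` is the label at which the machine continues
afterwards. The second component of the internal state is a register for the target of the jump by
which `loop` enters its body or leaves. -/
def code {Λ : Type} : (p : Prog S σ) → (p.Lab → Λ) → Λ → p.Lab → Turing.TM2.Stmt S Λ (σ × Λ)
  | push k f, _, exit, _ => .push k (fun s => f s.1) (.goto fun _ => exit)
  | pop k f, _, exit, _ => .pop k (fun s o => (f s.1 o, s.2)) (.goto fun _ => exit)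
  | load f, _, exit, _ => .load (fun s => (f s.1, s.2)) (.goto fun _ => exit)
  | seq p q, emb, _, .inl l => p.code (fun l => emb (.inl l)) (emb (.inr q.entry)) l
  | seq _ q, emb, exit, .inr l => q.code (fun l => emb (.inr l)) exit l
  | ite c p q, emb, _, none =>
      .branch (fun s => c s.1) (.goto fun _ => emb (some (.inl p.entry)))
        (.goto fun _ => emb (some (.inr q.entry)))
  | ite _ p _, emb, exit, some (.inl l) => p.code (fun l => emb (some (.inl l))) exit l
  | ite _ _ q, emb, exit, some (.inr l) => q.code (fun l => emb (some (.inr l))) exit l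
  | loop k body, emb, exit, none =>
      .pop k (fun s o => (s.1, o.elim exit fun a => emb (some ⟨a, (body a).entry⟩)))
        (.goto fun s => s.2)
  | loop _ body, emb, _, some ⟨a, l⟩ =>
      (body a).code (fun l => emb (some ⟨a, l⟩)) (emb none) l

/-- The store together with the contents of the stacks. -/
abbrev State (S : K → Type) (σ : Type) : Type := σ × ∀ k, List (S k)

variable [DecidableEq K]

/-- Big-step semantics: `Exec p s t s'` if `p` leads from `s` to `s'` in `t` steps. -/
inductive Exec : Prog S σ → State S σ → ℕ → State S σ → Prop
  | push {k f} {s : State S σ} :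
      Exec (.push k f) s 1 (s.1, Function.update s.2 k (f s.1 :: s.2 k))
  | pop {k f} {s : State S σ} :
      Exec (.pop k f) s 1 (f s.1 (s.2 k).head?, Function.update s.2 k (s.2 k).tail)
  | load {f} {s : State S σ} : Exec (.load f) s 1 (f s.1, s.2)
  | seq {p q s s' s'' t t'} :
      Exec p s t s' → Exec q s' t' s'' → Exec (.seq p q) s (t + t') s''
  | ite_true {c p q} {s : State S σ} {t s'} :
      c s.1 = true → Exec p s t s' → Exec (.ite c p q) s (t + 1) s'
  | ite_false {c p q} {s : State S σ} {t s'} :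
      c s.1 = false → Exec q s t s' → Exec (.ite c p q) s (t + 1) s'
  | loop_nil {k body} {s : State S σ} : s.2 k = [] → Exec (.loop k body) s 1 s
  | loop_cons {k body a l} {s : State S σ} {t s' t' last} :
      s.2 k = a :: l → Exec (body a) (s.1, Function.update s.2 k l) t s' →
      Exec (.loop k body) s' t' last → Exec (.loop k body) s (t + t' + 1) last

/-- `p` leads from `s` to `s'` in at most `B` steps. -/
def Runs (p : Prog S σ) (s : State S σ) (B : ℕ) (s' : State S σ) : Prop :=
  ∃ t ≤ B, Exec p s t s'

end Prog

/-- `t` deterministic steps of a machine with the (partial) program `P`. -/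
inductive DetSteps {K : Type} [DecidableEq K] {S : K → Type} {Λ σ : Type}
    (P : Λ → Option (Turing.TM2.Stmt S Λ σ)) :
    Turing.TM2.Cfg S Λ σ → ℕ → Turing.TM2.Cfg S Λ σ → Prop
  | refl {c} : DetSteps P c 0 c
  | head {q stmt v stk t c} : P q = some stmt →
      DetSteps P (Turing.TM2.stepAux stmt v stk) t c → DetSteps P ⟨some q, v, stk⟩ (t + 1) c

section DetSteps

variable {K : Type} [DecidableEq K] {S : K → Type} {Λ σ : Type}

theorem DetSteps.trans {P : Λ → Option (Turing.TM2.Stmt S Λ σ)} {a b c} {t u : ℕ}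
    (h : DetSteps P a t b) (hbc : DetSteps P b u c) : DetSteps P a (t + u) c := by
  induction h with
  | refl => simpa using hbc
  | head hq _ ih => rw [Nat.add_right_comm]; exact .head hq (ih hbc)

theorem Prog.Exec.detSteps {P : Λ → Option (Turing.TM2.Stmt S Λ (σ × Λ))} {p : Prog S σ}
    {s s' : Prog.State S σ} {t : ℕ} (h : p.Exec s t s') :
    ∀ (emb : p.Lab → Λ) (exit : Λ), (∀ l, P (emb l) = some (p.code emb exit l)) → ∀ b : Λ,
      ∃ b' : Λ, DetSteps P ⟨some (emb p.entry), (s.1, b), s.2⟩ t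
        ⟨some exit, (s'.1, b'), s'.2⟩ := by
  induction h with
  | push => exact fun emb exit hP b => ⟨b, .head (hP _) .refl⟩
  | pop => exact fun emb exit hP b => ⟨b, .head (hP _) .refl⟩
  | load => exact fun emb exit hP b => ⟨b, .head (hP _) .refl⟩
  | @seq p q s s' s'' t t' _ _ ih ih' =>
    intro emb exit hP b
    obtain ⟨b₁, h₁⟩ := ih (fun l => emb (.inl l)) (emb (.inr q.entry)) (fun l => hP (.inl l)) b
    obtain ⟨b₂, h₂⟩ := ih' (fun l => emb (.inr l)) exit (fun l => hP (.inr l)) b₁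
    exact ⟨b₂, h₁.trans h₂⟩
  | @ite_true c p q s t s' hc _ ih =>
    intro emb exit hP b
    obtain ⟨b₁, h₁⟩ := ih (fun l => emb (some (.inl l))) exit (fun l => hP (some (.inl l))) b
    refine ⟨b₁, .head (hP none) ?_⟩
    simpa [Prog.code, Turing.TM2.stepAux, hc] using h₁
  | @ite_false c p q s t s' hc _ ih =>
    intro emb exit hP b
    obtain ⟨b₁, h₁⟩ := ih (fun l => emb (some (.inr l))) exit (fun l => hP (some (.inr l))) b
    refine ⟨b₁, .head (hP none) ?_⟩
    simpa [Prog.code, Turing.TM2.stepAux, hc] using h₁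
  | @loop_nil k body s hk =>
    intro emb exit hP b
    refine ⟨exit, .head (hP none) ?_⟩
    have : Function.update s.2 k [] = s.2 := by rw [← hk, Function.update_eq_self]
    simpa [Prog.code, Turing.TM2.stepAux, hk, this] using DetSteps.refl
  | @loop_cons k body a l s t s' t' s'' hk _ _ ih ih' =>
    intro emb exit hP b
    obtain ⟨b₁, h₁⟩ := ih (fun l => emb (some ⟨a, l⟩)) (emb none) (fun l => hP (some ⟨a, l⟩))
      (emb (some ⟨a, (body a).entry⟩))
    obtain ⟨b₂, h₂⟩ := ih' emb exit hP b₁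
    refine ⟨b₂, .head (hP none) ?_⟩
    simpa [Prog.code, Turing.TM2.stepAux, hk] using h₁.trans h₂

end DetSteps

/-! ### Machines with one oracle call -/

namespace OracleMachine

variable {A B : Type}

/-- The program of `M`, restricted to the labels of deterministic instructions. -/
def det (M : OracleMachine A B) (q : M.Λ) : Option (Turing.TM2.Stmt M.Alphabet M.Λ M.σ) :=
  match M.prog q with
  | .run s => some s
  | _ => none

theorem det_eq_some {M : OracleMachine A B} {q : M.Λ} {s} (h : M.det q = some s) :
    M.prog q = .run s := by
  unfold det at h
  split at h
  · simp_all
  · simp at h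

/-- The distribution of the configuration `t` steps after the configuration `c`. -/
def runFrom (M : OracleMachine A B) (O : List B → ℕ → PMF ℕ) (c : M.Cfg) : ℕ → PMF M.Cfg
  | 0 => PMF.pure c
  | t + 1 => (M.step O c).bind fun c' => runFrom M O c' t

theorem runFrom_succ_right (M : OracleMachine A B) (O : List B → ℕ → PMF ℕ) (c : M.Cfg) (t : ℕ) :
    M.runFrom O c (t + 1) = (M.runFrom O c t).bind (M.step O) := by
  induction t generalizing c with
  | zero => simp [runFrom]
  | succ t ih => rw [runFrom, funext ih, ← PMF.bind_bind, ← runFrom]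

theorem run_eq_runFrom (M : OracleMachine A B) (O : List B → ℕ → PMF ℕ) (x : List A) (N t : ℕ) :
    M.run O x N t = M.runFrom O (M.initCfg x N) t := by
  induction t with
  | zero => rfl
  | succ t ih => rw [runFrom_succ_right, ← ih]; rfl

theorem runFrom_halted (M : OracleMachine A B) (O : List B → ℕ → PMF ℕ) {c : M.Cfg}
    (h : c.l = none) (t : ℕ) : M.runFrom O c t = PMF.pure c := by
  induction t with
  | zero => rfl
  | succ t ih => simp [runFrom, step, h, ih]

theorem step_of_det (M : OracleMachine A B) (O : List B → ℕ → PMF ℕ) {q s}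
    (h : M.det q = some s) (v stk) :
    M.step O ⟨some q, v, stk⟩ = PMF.pure (Turing.TM2.stepAux s v stk) := by
  simp [step, det_eq_some h]

theorem runFrom_detSteps {M : OracleMachine A B} (O : List B → ℕ → PMF ℕ) {c c' : M.Cfg} {t : ℕ}
    (h : DetSteps M.det c t c') (u : ℕ) : M.runFrom O c (t + u) = M.runFrom O c' u := by
  induction h with
  | refl => simp
  | head hq _ ih => rw [Nat.add_right_comm, runFrom, step_of_det M O hq, PMF.pure_bind, ih]

theorem exists_mem_support_runFrom_of_isAsking {M : OracleMachine A B} (O : List B → ℕ → PMF ℕ)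
    {c c' : M.Cfg} {t : ℕ} (h : DetSteps M.det c t c') (u : ℕ) (a : M.Cfg)
    (ha : a ∈ (M.runFrom O c u).support) (hask : M.IsAsking a) :
    ∃ u', a ∈ (M.runFrom O c' u').support := by
  induction h generalizing u with
  | refl => exact ⟨u, ha⟩
  | @head q s v stk _ c hq _ ih =>
    cases u with
    | zero =>
      simp only [runFrom, PMF.support_pure, Set.mem_singleton_iff] at ha
      obtain ⟨q₁, q₂, h₁, h₂⟩ := hask
      subst ha
      simp only [Option.some.injEq] at h₁
      subst h₁
      rw [det_eq_some hq] at h₂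
      cases h₂
    | succ u =>
      rw [runFrom, step_of_det M O hq, PMF.pure_bind] at ha
      exact ih u ha

/-- On input `(x, 1 / N)` the machine makes a single oracle call, in the configuration `c`, after
which it continues at the label `q`. If the answer is `Y`, it halts in the configuration `F Y`. At
most `T` steps are made altogether. -/
structure OneCall (M : OracleMachine A B) (x : List A) (N T : ℕ) (c : M.Cfg) (q : M.Λ)
    (F : ℕ → M.Cfg) : Prop where
  ask : ∃ q₀, c.l = some q₀ ∧ M.prog q₀ = .ask q
  halted : ∀ Y, (F Y).l = none
  steps : ∃ t₁ t₂, DetSteps M.det (M.initCfg x N) t₁ c ∧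
    (∀ Y, ∃ t ≤ t₂, DetSteps M.det (M.answerCfg q c Y) t (F Y)) ∧ t₁ + t₂ + 1 ≤ T

namespace OneCall

variable {M : OracleMachine A B} {x : List A} {N T : ℕ} {c : M.Cfg} {q : M.Λ} {F : ℕ → M.Cfg}

theorem mono {T' : ℕ} (h : M.OneCall x N T c q F) (hT : T ≤ T') : M.OneCall x N T' c q F where
  ask := h.ask
  halted := h.halted
  steps := let ⟨t₁, t₂, h₁, h₂, h₃⟩ := h.steps; ⟨t₁, t₂, h₁, h₂, h₃.trans hT⟩

theorem step_eq (h : M.OneCall x N T c q F) (O : List B → ℕ → PMF ℕ) :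
    M.step O c = (O (M.queryWord c) (M.queryErr c)).map (M.answerCfg q c) := by
  obtain ⟨q₀, hl, hq⟩ := h.ask
  simp only [step, hl, hq]

theorem run_eq (h : M.OneCall x N T c q F) (O : List B → ℕ → PMF ℕ) :
    M.run O x N T = (O (M.queryWord c) (M.queryErr c)).map F := by
  obtain ⟨t₁, t₂, h₁, h₂, hT⟩ := h.steps
  obtain ⟨r, rfl⟩ := Nat.exists_eq_add_of_le hT
  rw [run_eq_runFrom, show t₁ + t₂ + 1 + r = t₁ + (t₂ + r + 1) by omega, runFrom_detSteps O h₁,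
    runFrom, h.step_eq, PMF.bind_map, ← PMF.bind_pure_comp]
  congr 1
  funext Y
  obtain ⟨t, ht, h₃⟩ := h₂ Y
  rw [Function.comp_apply, Function.comp_apply, show t₂ + r = t + (t₂ - t + r) by omega,
    runFrom_detSteps O h₃, runFrom_halted M O (h.halted Y)]

theorem eq_of_isAsking (h : M.OneCall x N T c q F) {O : List B → ℕ → PMF ℕ} {t : ℕ} {a : M.Cfg}
    (ha : a ∈ (M.run O x N t).support) (hask : M.IsAsking a) : a = c := by
  obtain ⟨t₁, t₂, h₁, h₂, -⟩ := h.steps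
  rw [run_eq_runFrom] at ha
  obtain ⟨u, hu⟩ := exists_mem_support_runFrom_of_isAsking O h₁ t a ha hask
  cases u with
  | zero => simpa [runFrom] using hu
  | succ u =>
    rw [runFrom, h.step_eq, PMF.bind_map, PMF.mem_support_bind_iff] at hu
    obtain ⟨Y, -, hY⟩ := hu
    obtain ⟨s, -, h₃⟩ := h₂ Y
    obtain ⟨u', hu'⟩ := exists_mem_support_runFrom_of_isAsking O h₃ u a hY hask
    rw [runFrom_halted M O (h.halted Y), PMF.support_pure, Set.mem_singleton_iff] at hu'
    obtain ⟨q₁, q₂, hq₁, -⟩ := hask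
    rw [hu', h.halted Y] at hq₁
    cases hq₁

end OneCall

theorem isAPReduction_of_oneCall {M : OracleMachine A B} {f : CountingProblem A}
    {g : CountingProblem B} {p : Polynomial ℕ}
    (h : ∀ (I : f.Inst) (N : ℕ), 2 ≤ N → ∃ (J : g.Inst) (c : M.Cfg) (q : M.Λ) (F : ℕ → M.Cfg),
      M.OneCall (f.encode I) N (p.eval ((f.encode I).length + N)) c q F ∧
      M.queryWord c = g.encode J ∧ 2 ≤ M.queryErr c ∧
      M.queryErr c ≤ p.eval ((f.encode I).length + N) ∧
      ∀ Y ∈ goodApprox (g.value J) (M.queryErr c),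
        M.outputValue (F Y) ∈ goodApprox (f.value I) N) :
    IsAPReduction M f g p where
  calls O I N hN t a ha hask := by
    obtain ⟨J, c, q, F, hcall, hJ, herr, herr', -⟩ := h I N hN
    rw [hcall.eq_of_isAsking ha hask]
    exact ⟨⟨J, hJ⟩, herr, herr'⟩
  time O I N hN a ha := by
    obtain ⟨J, c, q, F, hcall, -⟩ := h I N hN
    rw [hcall.run_eq, PMF.mem_support_map_iff] at ha
    obtain ⟨Y, -, rfl⟩ := ha
    exact hcall.halted Y
  approx O hO I N hN := by
    obtain ⟨J, c, q, F, hcall, hJ, herr, -, hgood⟩ := h I N hN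
    rw [hcall.run_eq, PMF.map_comp, PMF.toOuterMeasure_map_apply, hJ]
    exact (hO J _ herr).trans ((PMF.toOuterMeasure _).mono hgood)

instance (p : Port) [Finite A] [Finite B] : Finite (Port.Alphabet A B p) := by
  cases p <;> simp only [Port.Alphabet] <;> infer_instance

theorem finite_alphabet [Finite A] [Finite B] {W : Type} {Work : W → Type}
    [∀ w, Finite (Work w)] (k : Port ⊕ W) : Finite (Sum.elim (Port.Alphabet A B) Work k) := by
  cases k <;> simp only [Sum.elim_inl, Sum.elim_inr] <;> infer_instance

variable [Finite A] [Finite B] {W : Type} [DecidableEq W] [Finite W] {Work : W → Type}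
  [∀ w, Finite (Work w)] {σ : Type} [Finite σ]

/-- The machine that runs `p`, calls the oracle and runs `q`. -/
def ofProgs (p q : Prog (Sum.elim (Port.Alphabet A B) Work) σ) (s₀ : σ) : OracleMachine A B where
  W := W
  Work := Work
  Λ := (p.Lab ⊕ q.Lab) ⊕ Bool
  finΛ := by
    have := finite_alphabet (A := A) (B := B) (Work := Work)
    have := p.finite_lab
    have := q.finite_lab
    infer_instance
  σ := σ × ((p.Lab ⊕ q.Lab) ⊕ Bool)
  finσ := by
    have := finite_alphabet (A := A) (B := B) (Work := Work)
    have := p.finite_lab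
    have := q.finite_lab
    infer_instance
  start := .inl (.inl p.entry)
  init := (s₀, .inr false)
  prog
    | .inl (.inl l) => .run (p.code (fun l => .inl (.inl l)) (.inr true) l)
    | .inl (.inr l) => .run (q.code (fun l => .inl (.inr l)) (.inr false) l)
    | .inr true => .ask (.inl (.inr q.entry))
    | .inr false => .run .halt

/-- The stacks of the initial configuration of any machine with work stacks `Work`. -/
def initStk (x : List A) (N : ℕ) : ∀ k, List (Sum.elim (Port.Alphabet A B) Work k)
  | .inl .input => x
  | .inl .inputErr => List.replicate N ()
  | .inl .query => []
  | .inl .queryErr => []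
  | .inl .answer => []
  | .inl .output => []
  | .inr _ => []

/-- The stacks after the oracle has answered `Y`. -/
def answerStk (stk : ∀ k, List (Sum.elim (Port.Alphabet A B) Work k)) (Y : ℕ) :
    ∀ k, List (Sum.elim (Port.Alphabet A B) Work k)
  | .inl .query => []
  | .inl .queryErr => []
  | .inl .answer => Nat.bits Y
  | k => stk k

theorem initCfg_ofProgs (p q : Prog (Sum.elim (Port.Alphabet A B) Work) σ) (s₀ : σ) (x : List A)
    (N : ℕ) : (ofProgs p q s₀).initCfg x N =
      ⟨some (.inl (.inl p.entry)), (s₀, .inr false), initStk x N⟩ := by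
  unfold initCfg
  congr 1
  funext k
  rcases k with k | k
  · cases k <;> rfl
  · rfl

theorem answerCfg_ofProgs (p q : Prog (Sum.elim (Port.Alphabet A B) Work) σ) (s₀ : σ)
    (l : (ofProgs p q s₀).Λ) (c : (ofProgs p q s₀).Cfg) (Y : ℕ) :
    (ofProgs p q s₀).answerCfg l c Y = ⟨some l, c.var, answerStk c.stk Y⟩ := by
  unfold answerCfg
  congr 1
  funext k
  rcases k with k | k
  · cases k <;> rfl
  · rfl

theorem oneCall_ofProgs {p q : Prog (Sum.elim (Port.Alphabet A B) Work) σ} {s₀ : σ} {x : List A}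
    {N B₁ B₂ : ℕ} {s : Prog.State _ σ} {s' : ℕ → Prog.State _ σ}
    (hp : p.Runs (s₀, initStk x N) B₁ s)
    (hq : ∀ Y, q.Runs (s.1, answerStk s.2 Y) B₂ (s' Y)) :
    ∃ (b : (ofProgs p q s₀).Λ) (b' : ℕ → (ofProgs p q s₀).Λ),
      (ofProgs p q s₀).OneCall x N (B₁ + B₂ + 2) ⟨some (.inr true), (s.1, b), s.2⟩
        (.inl (.inr q.entry)) fun Y => ⟨none, ((s' Y).1, b' Y), (s' Y).2⟩ := by
  set M := ofProgs p q s₀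
  obtain ⟨t₁, ht₁, h₁⟩ := hp
  obtain ⟨b, hb⟩ := h₁.detSteps (P := M.det) (fun l => .inl (.inl l)) (.inr true)
    (fun _ => rfl) (.inr false)
  choose t ht h₂ using hq
  choose b' hb' using fun Y => (h₂ Y).detSteps (P := M.det) (fun l => .inl (.inr l)) (.inr false)
    (fun _ => rfl) b
  refine ⟨b, b', ⟨_, rfl, rfl⟩, fun _ => rfl, t₁, B₂ + 1, ?_, fun Y => ⟨t Y + 1, ?_, ?_⟩, ?_⟩
  · rw [initCfg_ofProgs]
    exact hb
  · exact Nat.succ_le_succ (ht Y)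
  · have hhalt : DetSteps M.det ⟨some (.inl (.inr q.entry)), (s.1, b), answerStk s.2 Y⟩ (t Y + 1)
        ⟨none, ((s' Y).1, b' Y), (s' Y).2⟩ :=
      (hb' Y).trans (.head (stmt := .halt) rfl .refl)
    have hcfg := answerCfg_ofProgs p q s₀ (.inl (.inr q.entry))
      ⟨some (.inr true), (s.1, b), s.2⟩ Y
    exact (congrArg (DetSteps M.det · (t Y + 1) _) hcfg).mpr hhalt
  · omega

theorem apReducible_of_progs {f : CountingProblem A} {g : CountingProblem B} (poly : Polynomial ℕ)
    (p q : Prog (Sum.elim (Port.Alphabet A B) Work) σ) (s₀ : σ)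
    (h : ∀ (I : f.Inst) (N : ℕ), 2 ≤ N → ∃ (J : g.Inst) (B₁ B₂ : ℕ) (s : Prog.State _ σ),
      p.Runs (s₀, initStk (f.encode I) N) B₁ s ∧ s.2 (.inl .query) = g.encode J ∧
      2 ≤ (s.2 (.inl .queryErr)).length ∧
      (s.2 (.inl .queryErr)).length ≤ poly.eval ((f.encode I).length + N) ∧
      B₁ + B₂ + 2 ≤ poly.eval ((f.encode I).length + N) ∧
      ∀ Y, ∃ s' : Prog.State _ σ, q.Runs (s.1, answerStk s.2 Y) B₂ s' ∧
        (Y ∈ goodApprox (g.value J) (s.2 (.inl .queryErr)).length →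
          List.foldr Nat.bit 0 (s'.2 (.inl .output) : List Bool) ∈ goodApprox (f.value I) N)) :
    APReducible f g := by
  refine ⟨ofProgs p q s₀, poly, isAPReduction_of_oneCall fun I N hN => ?_⟩
  obtain ⟨J, B₁, B₂, s, hp, hquery, herr, herr', htime, h'⟩ := h I N hN
  choose s' hq hgood using h'
  obtain ⟨b, b', hcall⟩ := oneCall_ofProgs hp hq
  exact ⟨J, _, _, _, hcall.mono htime, hquery, herr, herr', hgood⟩

end OracleMachine

/-! ### Constraints over arbitrary types of variables -/

/-- A constraint whose scope consists of elements of `V`. -/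
abbrev ConstraintOn (Δ : ConstraintLanguage) (V : Type) : Type :=
  Σ R : {R : BoolRel // R ∈ Δ}, (Fin R.1.1 → V)

namespace ConstraintOn

variable {Γ Δ : ConstraintLanguage} {U V V' : Type}

/-- Replace the variables of a constraint. -/
def map (f : V → V') (c : ConstraintOn Δ V) : ConstraintOn Δ V' := ⟨c.1, fun e => f (c.2 e)⟩

/-- Enlarge the constraint language. -/
def lift (h : Γ ⊆ Δ) (c : ConstraintOn Γ V) : ConstraintOn Δ V := ⟨⟨c.1.1, h c.1.2⟩, c.2⟩

/-- The assignment `s` satisfies the constraint. -/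
def Holds (s : V → Bool) (c : ConstraintOn Δ V) : Prop := (fun e => s (c.2 e)) ∈ c.1.1.2

@[simp] theorem map_map (f : V → V') (g : U → V) (c : ConstraintOn Δ U) :
    (c.map g).map f = c.map fun x => f (g x) := rfl

theorem map_congr {f g : V → V'} {c : ConstraintOn Δ V} (h : ∀ e, f (c.2 e) = g (c.2 e)) :
    c.map f = c.map g := by
  unfold ConstraintOn.map
  rw [funext h]

theorem exists_eq_of_map_eq_map {f : U → V'} {g : V → V'} {c : ConstraintOn Δ U}
    {c' : ConstraintOn Δ V} (h : c.map f = c'.map g) :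
    ∃ u, c' = ⟨c.1, u⟩ ∧ ∀ e, f (c.2 e) = g (u e) := by
  obtain ⟨R', u⟩ := c'
  simp only [map, Sigma.mk.injEq] at h
  obtain ⟨rfl, h⟩ := h
  exact ⟨u, rfl, congrFun (eq_of_heq h)⟩

theorem map_injective {f : V → V'} (hf : Function.Injective f) :
    Function.Injective (map (Δ := Δ) f) := by
  intro c c' h
  obtain ⟨u, rfl, hu⟩ := exists_eq_of_map_eq_map h
  exact Sigma.ext rfl (heq_of_eq (funext fun e => hf (hu e)))

theorem lift_injective (h : Γ ⊆ Δ) : Function.Injective (lift (V := V) h) := by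
  rintro ⟨⟨R, hR⟩, u⟩ ⟨⟨R', hR'⟩, u'⟩ h
  simp only [lift, Sigma.mk.injEq, Subtype.mk.injEq] at h
  obtain ⟨rfl, h⟩ := h
  obtain rfl := eq_of_heq h
  rfl

theorem exists_const_notMem {c : ConstraintOn Δ V} (hc : ∀ e e', c.2 e = c.2 e')
    (ht : ∃ s, ¬ c.Holds s) : ∃ b, (fun _ => b) ∉ c.1.1.2 := by
  obtain ⟨s, hs⟩ := ht
  obtain ⟨b, hb⟩ : ∃ b, ∀ e, s (c.2 e) = b := by
    by_cases hr : 0 < c.1.1.1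
    · exact ⟨s (c.2 ⟨0, hr⟩), fun e => congrArg s (hc e _)⟩
    · exact ⟨false, fun e => absurd e.pos hr⟩
  exact ⟨b, by rwa [Holds, funext hb] at hs⟩

end ConstraintOn

section ConstraintList

variable {Γ Δ : ConstraintLanguage} {U V V' : Type}

/-- The list of all occurrences of variables in a list of constraints. -/
def occurrences (cs : List (ConstraintOn Δ V)) : List V := cs.flatMap fun c => List.ofFn c.2

/-- The assignment `s` satisfies all constraints of a list. -/
def AllHold (cs : List (ConstraintOn Δ V)) (s : V → Bool) : Prop := ∀ c ∈ cs, c.Holds s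

/-- Number the occurrences of variables consecutively, starting with `k`. -/
def number : ℕ → List (ConstraintOn Δ V) → List (ConstraintOn Δ (V × ℕ))
  | _, [] => []
  | k, c :: cs => ⟨c.1, fun e => (c.2 e, k + e)⟩ :: number (k + c.1.1.1) cs

theorem mem_occurrences {cs : List (ConstraintOn Δ V)} {c : ConstraintOn Δ V} (hc : c ∈ cs)
    (e : Fin c.1.1.1) : c.2 e ∈ occurrences cs :=
  List.mem_flatMap.2 ⟨c, hc, List.mem_ofFn.2 ⟨e, rfl⟩⟩

theorem occurrences_append (cs cs' : List (ConstraintOn Δ V)) :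
    occurrences (cs ++ cs') = occurrences cs ++ occurrences cs' :=
  List.flatMap_append

theorem occurrences_perm {cs cs' : List (ConstraintOn Δ V)} (h : cs.Perm cs') :
    (occurrences cs).Perm (occurrences cs') :=
  h.flatMap_right _

theorem occurrences_flatMap {α : Type} (l : List α) (f : α → List (ConstraintOn Δ V)) :
    occurrences (l.flatMap f) = l.flatMap fun a => occurrences (f a) :=
  List.flatMap_assoc

theorem occurrences_map (f : V → V') (cs : List (ConstraintOn Δ V)) :
    occurrences (cs.map (ConstraintOn.map f)) = (occurrences cs).map f := by
  simp only [occurrences, List.flatMap_map, List.map_flatMap, List.map_ofFn]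
  rfl

theorem occurrences_lift (h : Γ ⊆ Δ) (cs : List (ConstraintOn Γ V)) :
    occurrences (cs.map (ConstraintOn.lift h)) = occurrences cs := by
  simp only [occurrences, List.flatMap_map]
  rfl

theorem occurrences_number (k : ℕ) (cs : List (ConstraintOn Δ V)) :
    occurrences (number k cs) = (occurrences cs).zipIdx k := by
  induction cs generalizing k with
  | nil => rfl
  | cons c cs ih =>
    have ih' := ih (k + c.1.1.1)
    simp only [occurrences, number, List.flatMap_cons, List.zipIdx_append,
      List.length_ofFn] at ih' ⊢
    rw [ih']
    congr 1
    apply List.ext_getElem <;> simp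

theorem map_fst_number (k : ℕ) (cs : List (ConstraintOn Δ V)) :
    (number k cs).map (ConstraintOn.map Prod.fst) = cs := by
  induction cs generalizing k with
  | nil => rfl
  | cons c cs ih => simp [number, ih, ConstraintOn.map]

theorem map_fst_mem_of_mem_number {k : ℕ} {cs : List (ConstraintOn Δ V)} {c}
    (hc : c ∈ number k cs) : c.map Prod.fst ∈ cs := by
  have := List.mem_map_of_mem (f := ConstraintOn.map Prod.fst) hc
  rwa [map_fst_number] at this

theorem snd_lt_of_mem_number {k : ℕ} {cs : List (ConstraintOn Δ V)} {x : V × ℕ}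
    (h : x ∈ occurrences (number k cs)) : x.2 < (occurrences cs).length + k := by
  rw [occurrences_number] at h
  have := List.snd_lt_add_of_mem_zipIdx h
  omega

theorem nodup_occurrences_number (k : ℕ) (cs : List (ConstraintOn Δ V)) :
    (occurrences (number k cs)).Nodup := by
  rw [occurrences_number]
  apply List.Nodup.of_map Prod.snd
  rw [List.zipIdx_map_snd]
  exact List.nodup_range'

theorem nodup_of_nodup_occurrences {cs : List (ConstraintOn Δ V)} (h : (occurrences cs).Nodup)
    (hpos : ∀ c ∈ cs, 0 < c.1.1.1) : cs.Nodup := by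
  rw [occurrences, List.nodup_flatMap] at h
  refine h.2.imp_of_mem ?_
  rintro c _ hc - hdisj rfl
  have hmem : c.2 ⟨0, hpos c hc⟩ ∈ List.ofFn c.2 := List.mem_ofFn.2 ⟨_, rfl⟩
  exact hdisj hmem hmem

theorem allHold_append (cs cs' : List (ConstraintOn Δ V)) (s : V → Bool) :
    AllHold (cs ++ cs') s ↔ AllHold cs s ∧ AllHold cs' s :=
  List.forall_mem_append

theorem allHold_flatMap {α : Type} (l : List α) (f : α → List (ConstraintOn Δ V)) (s : V → Bool) :
    AllHold (l.flatMap f) s ↔ ∀ a ∈ l, AllHold (f a) s :=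
  List.forall_mem_flatMap

theorem allHold_map (f : V → V') (cs : List (ConstraintOn Δ V)) (s : V' → Bool) :
    AllHold (cs.map (ConstraintOn.map f)) s ↔ AllHold cs fun x => s (f x) :=
  List.forall_mem_map

theorem allHold_lift (h : Γ ⊆ Δ) (cs : List (ConstraintOn Γ V)) (s : V → Bool) :
    AllHold (cs.map (ConstraintOn.lift h)) s ↔ AllHold cs s :=
  List.forall_mem_map

theorem allHold_number {k : ℕ} {cs : List (ConstraintOn Δ V)} {s : V × ℕ → Bool} {a : V → Bool}
    (h : ∀ v j, s (v, j) = a v) : AllHold (number k cs) s ↔ AllHold cs a := by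
  obtain rfl : s = fun x => a x.1 := funext fun ⟨v, j⟩ => h v j
  rw [← allHold_map Prod.fst, map_fst_number]

theorem count_ofFn {α : Type} [DecidableEq α] {n : ℕ} (f : Fin n → α) (a : α) :
    (List.ofFn f).count a = (Finset.univ.filter fun i => f i = a).card := by
  induction n with
  | zero => simp
  | succ n ih =>
    rw [List.ofFn_succ, List.count_cons, ih, Fin.card_filter_univ_succ]
    by_cases h : f 0 = a <;> simp [h]

theorem CSPInstance.varDegree_eq_count (I : CSPInstance Δ) (v : Fin I.numVars) :
    I.varDegree v = (occurrences I.constraints).count v := by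
  rw [varDegree, occurrences, List.count_flatMap]
  congr 2
  funext c
  simp only [Function.comp, count_ofFn]

open Classical in
/-- The constraints of a list that are not satisfied by all assignments. -/
def dropTrivial (cs : List (ConstraintOn Δ V)) : List (ConstraintOn Δ V) :=
  cs.filter fun c => ∃ s, ¬ c.Holds s

theorem mem_dropTrivial {cs : List (ConstraintOn Δ V)} {c : ConstraintOn Δ V} :
    c ∈ dropTrivial cs ↔ c ∈ cs ∧ ∃ s, ¬ c.Holds s := by
  simp [dropTrivial]

theorem dropTrivial_sublist (cs : List (ConstraintOn Δ V)) : (dropTrivial cs).Sublist cs :=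
  List.filter_sublist

theorem allHold_dropTrivial {cs : List (ConstraintOn Δ V)} {s : V → Bool} :
    AllHold (dropTrivial cs) s ↔ AllHold cs s := by
  refine ⟨fun hs c hc => ?_, fun hs c hc => hs c (mem_dropTrivial.1 hc).1⟩
  by_contra hn
  exact hn (hs c (mem_dropTrivial.2 ⟨hc, s, hn⟩))

end ConstraintList

/-! ### Gadgets -/

/-- An instance without trivial constraints that simulates equality of its first `k` variables: its
solutions correspond to pairs of the common value of these variables and an element of
`Fin mult`. -/
structure Gadget (Δ : ConstraintLanguage) (d k : ℕ) where
  numVars : ℕ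
  constraints : List (ConstraintOn Δ (Fin numVars))
  nodup : constraints.Nodup
  nontrivial : ∀ c ∈ constraints, ∃ s, ¬ c.Holds s
  le_numVars : k ≤ numVars
  mult : ℕ
  mult_pos : 0 < mult
  solEquiv : {s // AllHold constraints s} ≃ Bool × Fin mult
  sol_castLE : ∀ (s : {s // AllHold constraints s}) (i : Fin k),
    s.1 (Fin.castLE le_numVars i) = (solEquiv s).1
  count_le : ∀ v, (occurrences constraints).count v ≤ d
  count_castLE_lt : ∀ i : Fin k, (occurrences constraints).count (Fin.castLE le_numVars i) < d

theorem exists_equiv_bool_prod_fin {α : Type} [Finite α] {m : ℕ} (f : α → Bool)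
    (h : ∀ b, Nat.card {a // f a = b} = m) : ∃ e : α ≃ Bool × Fin m, ∀ a, (e a).1 = f a :=
  let fiberEquiv : ∀ b, {a // f a = b} ≃ Fin m := fun b =>
    (Finite.equivFin _).trans (finCongr (h b))
  ⟨(Equiv.sigmaFiberEquiv f).symm.trans ((Equiv.sigmaCongrRight fiberEquiv).trans
    (Equiv.sigmaEquivProd _ _)), fun _ => rfl⟩

theorem exists_gadget {Γ : ConstraintLanguage} {d k : ℕ} (hk : 0 < k) (h : DSimulatesEqK d k Γ) :
    Nonempty (Gadget (Γ ∪ pinLanguage) d k) := by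
  classical
  obtain ⟨I, hkI, m, hm, hfalse, htrue, hall, hd, hport⟩ := h
  let cs : List (ConstraintOn (Γ ∪ pinLanguage) (Fin I.numVars)) := dropTrivial I.constraints
  have hsat : ∀ s, AllHold cs s ↔ I.Satisfies s := fun s => allHold_dropTrivial
  have hcount : ∀ v, (occurrences cs).count v ≤ I.varDegree v := fun v => by
    rw [I.varDegree_eq_count]
    exact ((dropTrivial_sublist _).flatMap _).count_le _
  let value : {s // AllHold cs s} → Bool := fun s => s.1 (Fin.castLE hkI ⟨0, hk⟩)
  have hvalue : ∀ (s : {s // AllHold cs s}) (i : Fin k), s.1 (Fin.castLE hkI i) = value s := by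
    intro s i
    rcases hall s.1 ((hsat _).1 s.2) with h | h <;> rw [h i, ← h ⟨0, hk⟩]
  have hcard : ∀ b, Nat.card {s // value s = b} = m := by
    intro b
    have hfiber : Nat.card {s // value s = b} =
        Set.ncard {s | I.Satisfies s ∧ ∀ i : Fin k, s (Fin.castLE hkI i) = b} := by
      rw [← Nat.card_coe_set_eq]
      exact Nat.card_congr
        ⟨fun s => ⟨s.1.1, (hsat _).1 s.1.2, fun i => (hvalue s.1 i).trans s.2⟩,
          fun s => ⟨⟨s.1, (hsat _).2 s.2.1⟩, s.2.2 _⟩, fun _ => rfl, fun _ => rfl⟩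
    cases b
    · exact hfiber.trans hfalse
    · exact hfiber.trans htrue
  obtain ⟨e, he⟩ := exists_equiv_bool_prod_fin value hcard
  exact ⟨{
    numVars := I.numVars
    constraints := cs
    nodup := I.nodup.sublist (dropTrivial_sublist _)
    nontrivial := fun c hc => (mem_dropTrivial.1 hc).2
    le_numVars := hkI
    mult := m
    mult_pos := hm
    solEquiv := e
    sol_castLE := fun s i => (hvalue s i).trans (he s).symm
    count_le := fun v => (hcount v).trans ((Finset.le_sup (Finset.mem_univ v)).trans hd)
    count_castLE_lt := fun i => (Nat.add_le_add_right (hcount _) 1).trans (hport i) }⟩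

namespace Gadget

variable {Δ : ConstraintLanguage} {d k : ℕ}

/-- The `j`-th of the variables that are forced to be equal; `j` is read modulo their number. -/
def port (G : Gadget Δ d (k + 1)) (j : ℕ) : Fin G.numVars :=
  Fin.castLE G.le_numVars (Fin.ofNat (k + 1) j)

theorem val_port (G : Gadget Δ d (k + 1)) {j : ℕ} (hj : j ≤ k) : (G.port j : ℕ) = j :=
  Nat.mod_eq_of_lt (Nat.lt_succ_of_le hj)

theorem port_inj (G : Gadget Δ d (k + 1)) {i j : ℕ} (hi : i ≤ k) (hj : j ≤ k)
    (h : G.port i = G.port j) : i = j := by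
  rw [← G.val_port hi, h, G.val_port hj]

theorem port_zero_ne_port_one (H : Gadget Δ d 2) : H.port 0 ≠ H.port 1 :=
  fun h => absurd (H.port_inj (by omega) (by omega) h) Nat.zero_ne_one

theorem sol_port (G : Gadget Δ d (k + 1)) (s : {s // AllHold G.constraints s}) (j : ℕ) :
    s.1 (G.port j) = (G.solEquiv s).1 := G.sol_castLE s _

theorem count_port_lt (G : Gadget Δ d (k + 1)) (j : ℕ) :
    (occurrences G.constraints).count (G.port j) < d :=
  G.count_castLE_lt _

theorem exists_sol (G : Gadget Δ d k) (b : Bool) :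
    ∃ s : {s // AllHold G.constraints s}, (G.solEquiv s).1 = b :=
  ⟨G.solEquiv.symm (b, ⟨0, G.mult_pos⟩), by rw [Equiv.apply_symm_apply]⟩

theorem arity_pos (G : Gadget Δ d k) {c} (hc : c ∈ G.constraints) : 0 < c.1.1.1 := by
  by_contra hr
  obtain ⟨s, hs⟩ := G.nontrivial c hc
  obtain ⟨⟨t, ht⟩, -⟩ := G.exists_sol true
  have hst : (fun e => s (c.2 e)) = fun e => t (c.2 e) := funext fun e => absurd e.pos hr
  exact hs (by rw [ConstraintOn.Holds, hst]; exact ht c hc)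

theorem const_mem_of_forall_port (G : Gadget Δ d (k + 1)) {c} (hc : c ∈ G.constraints)
    (h : ∀ e, ∃ j, c.2 e = G.port j) (b : Bool) : (fun _ => b) ∈ c.1.1.2 := by
  obtain ⟨s, hs⟩ := G.exists_sol b
  have hconst : (fun e => s.1 (c.2 e)) = fun _ => b := funext fun e => by
    obtain ⟨j, hj⟩ := h e
    rw [hj, sol_port, hs]
  rw [← hconst]
  exact s.2 c hc

/-- The total number of occurrences of variables. -/
abbrev entries (H : Gadget Δ d k) : ℕ := (occurrences H.constraints).length

end Gadget

/-! ### The instance of bounded degree -/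

/-- A cell consists of a layer and a variable of the given instance. The number of layers is `T + 2`
because, with at least two of them, a cell differs from its predecessor. -/
abbrev Cell (n T : ℕ) : Type := Fin (T + 2) × Fin n

namespace Cell

variable {n T : ℕ}

/-- The cell of the same variable in the (cyclically) preceding layer. -/
def pred (p : Cell n T) : Cell n T := (p.1 - 1, p.2)

theorem pred_ne (p : Cell n T) : p.pred ≠ p := fun h => by
  have hlayer : p.1 - 1 = p.1 := congrArg Prod.fst h
  simp at hlayer

theorem pred_injective : Function.Injective (pred (n := n) (T := T)) := fun p q h => by
  simp only [pred, Prod.mk.injEq, sub_left_inj] at h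
  exact Prod.ext h.1 h.2

end Cell

/-- All cells, ordered by layers. -/
def cells (n T : ℕ) : List (Cell n T) := (List.finRange ((T + 2) * n)).map finProdFinEquiv.symm

theorem mem_cells {n T : ℕ} (p : Cell n T) : p ∈ cells n T :=
  List.mem_map.2 ⟨finProdFinEquiv p, List.mem_finRange _, Equiv.symm_apply_apply _ _⟩

theorem nodup_cells (n T : ℕ) : (cells n T).Nodup :=
  (List.nodup_finRange _).map finProdFinEquiv.symm.injective

section Construction

variable {Γ Δ : ConstraintLanguage} {d : ℕ} (hΓ : Γ ⊆ Δ) (H : Gadget Δ d 2)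
  (G : Gadget Δ d (2 * H.entries + 2)) {n T : ℕ}

/-- The places where a copy of `G` is put: each cell has a block for each variable of `H`. -/
abbrev Block (n T : ℕ) : Type := Cell n T × Fin H.numVars

/-- The variables of the constructed instance. -/
abbrev Var (n T : ℕ) : Type := Block H n T × Fin G.numVars

/-- The variable that replaces an occurrence of a variable of the given instance. The number `x.2`
of the occurrence selects the layer; linking cells does not use the port `2 * H.entries`. -/
def occVar (x : Fin n × ℕ) : Var H G n T :=
  (((Fin.ofNat (T + 2) x.2, x.1), H.port 0), G.port (2 * H.entries))

/-- The variable that replaces an occurrence of a variable of `H` in the copy of `H` that links the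
cell `p` with its predecessor. -/
def linkVar (p : Cell n T) (x : Fin H.numVars × ℕ) : Var H G n T :=
  if x.1 = H.port 1 then ((p.pred, H.port 0), G.port (H.entries + x.2))
  else ((p, x.1), G.port x.2)

/-- The constraints of the given instance, each occurrence of a variable being replaced by a
variable of its own. -/
def occConstraints (T : ℕ) (cs : List (ConstraintOn Γ (Fin n))) :
    List (ConstraintOn Δ (Var H G n T)) :=
  ((number 2 cs).map (ConstraintOn.lift hΓ)).map (ConstraintOn.map (occVar H G))

/-- The copy of `H` that links the cell `p` with its predecessor. -/
def linkConstraints (p : Cell n T) : List (ConstraintOn Δ (Var H G n T)) :=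
  (number 0 H.constraints).map (ConstraintOn.map (linkVar H G p))

/-- The copy of `G` in the block `q`. -/
def blockConstraints (q : Block H n T) : List (ConstraintOn Δ (Var H G n T)) :=
  G.constraints.map (ConstraintOn.map (Prod.mk q))

/-- The constraints of the constructed instance. -/
def boundedConstraints (T : ℕ) (cs : List (ConstraintOn Γ (Fin n))) :
    List (ConstraintOn Δ (Var H G n T)) :=
  occConstraints hΓ H G T cs ++ (cells n T).flatMap fun p =>
    linkConstraints H G p ++ (List.finRange H.numVars).flatMap fun i => blockConstraints H G (p, i)

/-- The list of all blocks. -/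
def blocks (n T : ℕ) : List (Block H n T) := (cells n T).product (List.finRange H.numVars)

theorem nodup_blocks : (blocks H n T).Nodup := (nodup_cells n T).product (List.nodup_finRange _)

theorem boundedConstraints_perm (T : ℕ) (cs : List (ConstraintOn Γ (Fin n))) :
    (boundedConstraints hΓ H G T cs).Perm
      ((occConstraints hΓ H G T cs ++ (cells n T).flatMap (linkConstraints H G)) ++
        (blocks H n T).flatMap (blockConstraints H G)) := by
  have hblocks : (blocks H n T).flatMap (blockConstraints H G) = (cells n T).flatMap fun p =>
      (List.finRange H.numVars).flatMap fun i => blockConstraints H G (p, i) := by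
    simp only [blocks, List.product, List.flatMap_assoc, List.flatMap_map]
  rw [boundedConstraints, List.append_assoc, hblocks]
  exact .append_left _ (List.flatMap_append_perm _ _ _).symm

variable {H G}

theorem linkVar_of_eq {p : Cell n T} {x : Fin H.numVars × ℕ} (h : x.1 = H.port 1) :
    linkVar H G p x = ((p.pred, H.port 0), G.port (H.entries + x.2)) := if_pos h

theorem linkVar_of_ne {p : Cell n T} {x : Fin H.numVars × ℕ} (h : x.1 ≠ H.port 1) :
    linkVar H G p x = ((p, x.1), G.port x.2) := if_neg h

theorem occVar_inj {x x' : Fin n × ℕ} (hx : x.2 < T + 2) (hx' : x'.2 < T + 2)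
    (h : occVar (T := T) H G x = occVar H G x') : x = x' := by
  simp only [occVar, Prod.mk.injEq, and_true] at h
  have hlayer := congrArg Fin.val h.1
  simp only [Fin.val_ofNat, Nat.mod_eq_of_lt hx, Nat.mod_eq_of_lt hx'] at hlayer
  exact Prod.ext h.2 hlayer

theorem linkVar_inj {p p' : Cell n T} {x x' : Fin H.numVars × ℕ} (hx : x.2 < H.entries)
    (hx' : x'.2 < H.entries) (h : linkVar H G p x = linkVar H G p' x') : p = p' ∧ x = x' := by
  unfold linkVar at h
  split_ifs at h with h1 h2 h2 <;> simp only [Prod.mk.injEq] at h <;>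
    have hport := G.port_inj (by omega) (by omega) h.2
  · exact ⟨Cell.pred_injective h.1.1, Prod.ext (h1.trans h2.symm) (by omega)⟩
  · omega
  · omega
  · exact ⟨h.1.1, Prod.ext h.1.2 hport⟩

theorem linkVar_ne_occVar {p : Cell n T} {x : Fin H.numVars × ℕ} (hx : x.2 < H.entries)
    (y : Fin n × ℕ) : linkVar H G p x ≠ occVar H G y := by
  intro h
  unfold linkVar occVar at h
  split_ifs at h <;> simp only [Prod.mk.injEq] at h <;>
    have := G.port_inj (by omega) (by omega) h.2 <;> omega

theorem fst_eq_of_linkVar_fst_eq {p : Cell n T} {x y : Fin H.numVars × ℕ}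
    (h : (linkVar H G p x).1 = (linkVar H G p y).1) : x.1 = y.1 := by
  by_cases hx : x.1 = H.port 1 <;> by_cases hy : y.1 = H.port 1
  · exact hx.trans hy.symm
  · rw [linkVar_of_eq hx, linkVar_of_ne hy] at h
    exact absurd (congrArg Prod.fst h) p.pred_ne
  · rw [linkVar_of_ne hx, linkVar_of_eq hy] at h
    exact absurd (congrArg Prod.fst h).symm p.pred_ne
  · rw [linkVar_of_ne hx, linkVar_of_ne hy] at h
    exact congrArg Prod.snd h

theorem mem_occurrences_occConstraints {cs : List (ConstraintOn Γ (Fin n))} {v : Var H G n T} :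
    v ∈ occurrences (occConstraints hΓ H G T cs) ↔
      ∃ x ∈ occurrences (number 2 cs), occVar H G x = v := by
  simp only [occConstraints, occurrences_map, occurrences_lift, List.mem_map]

theorem mem_occurrences_links {v : Var H G n T} :
    v ∈ occurrences ((cells n T).flatMap (linkConstraints H G)) ↔
      ∃ p, ∃ x ∈ occurrences (number 0 H.constraints), linkVar H G p x = v := by
  simp only [occurrences_flatMap, linkConstraints, occurrences_map, List.mem_flatMap,
    List.mem_map, mem_cells, true_and]

theorem nodup_occurrences_occConstraints {cs : List (ConstraintOn Γ (Fin n))}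
    (hT : (occurrences cs).length = T) : (occurrences (occConstraints hΓ H G T cs)).Nodup := by
  simp only [occConstraints, occurrences_map, occurrences_lift]
  refine (nodup_occurrences_number _ _).map_on fun x hx y hy h => ?_
  have := snd_lt_of_mem_number hx
  have := snd_lt_of_mem_number hy
  exact occVar_inj (by omega) (by omega) h

theorem nodup_occurrences_links :
    (occurrences ((cells n T).flatMap (linkConstraints H G))).Nodup := by
  simp only [occurrences_flatMap, linkConstraints, occurrences_map]
  refine List.nodup_flatMap.2 ⟨fun p _ => ?_, (nodup_cells n T).imp ?_⟩
  · exact (nodup_occurrences_number _ _).map_on fun x hx y hy h =>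
      (linkVar_inj (snd_lt_of_mem_number hx) (snd_lt_of_mem_number hy) h).2
  · intro p p' hp v hv hv'
    obtain ⟨x, hx, rfl⟩ := List.mem_map.1 hv
    obtain ⟨y, hy, h⟩ := List.mem_map.1 hv'
    exact hp (linkVar_inj (snd_lt_of_mem_number hx) (snd_lt_of_mem_number hy) h.symm).1

theorem disjoint_occurrences_occConstraints_links {cs : List (ConstraintOn Γ (Fin n))} :
    (occurrences (occConstraints hΓ H G T cs)).Disjoint
      (occurrences ((cells n T).flatMap (linkConstraints H G))) := by
  intro v hv hv'
  obtain ⟨p, x, hx, rfl⟩ := mem_occurrences_links.1 hv'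
  obtain ⟨y, -, hy⟩ := (mem_occurrences_occConstraints hΓ).1 hv
  exact linkVar_ne_occVar (snd_lt_of_mem_number hx) y hy.symm

theorem nodup_occurrences_append {cs : List (ConstraintOn Γ (Fin n))}
    (hT : (occurrences cs).length = T) :
    (occurrences (occConstraints hΓ H G T cs ++
      (cells n T).flatMap (linkConstraints H G))).Nodup := by
  rw [occurrences_append]
  exact (nodup_occurrences_occConstraints hΓ hT).append nodup_occurrences_links
    (disjoint_occurrences_occConstraints_links hΓ)

theorem exists_port_of_mem_occurrences {cs : List (ConstraintOn Γ (Fin n))} {v : Var H G n T}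
    (h : v ∈ occurrences (occConstraints hΓ H G T cs ++
      (cells n T).flatMap (linkConstraints H G))) : ∃ j, v.2 = G.port j := by
  rw [occurrences_append, List.mem_append, mem_occurrences_occConstraints,
    mem_occurrences_links] at h
  rcases h with ⟨x, -, rfl⟩ | ⟨p, x, -, rfl⟩
  · exact ⟨_, rfl⟩
  · unfold linkVar
    split_ifs <;> exact ⟨_, rfl⟩

theorem nodup_occConstraints {cs : List (ConstraintOn Γ (Fin n))} (hcs : cs.Nodup) :
    (occConstraints hΓ H G T cs).Nodup := by
  apply List.Nodup.of_map (ConstraintOn.map fun v : Var H G n T => v.1.1.2)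
  have hmap : (occConstraints hΓ H G T cs).map (ConstraintOn.map fun v => v.1.1.2) =
      cs.map (ConstraintOn.lift hΓ) := by
    conv_rhs => rw [← map_fst_number 2 cs]
    simp only [occConstraints, List.map_map]
    rfl
  rw [hmap]
  exact hcs.map (ConstraintOn.lift_injective hΓ)

theorem arity_pos_of_mem_links {c} (hc : c ∈ (cells n T).flatMap (linkConstraints H G)) :
    0 < c.1.1.1 := by
  obtain ⟨p, -, hp⟩ := List.mem_flatMap.1 hc
  obtain ⟨c₁, hc₁, rfl⟩ := List.mem_map.1 hp
  exact H.arity_pos (map_fst_mem_of_mem_number hc₁)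

theorem disjoint_occConstraints_links {cs : List (ConstraintOn Γ (Fin n))} :
    (occConstraints hΓ H G T cs).Disjoint ((cells n T).flatMap (linkConstraints H G)) := by
  intro c hc hc'
  have hpos := arity_pos_of_mem_links hc'
  exact disjoint_occurrences_occConstraints_links hΓ (mem_occurrences hc ⟨0, hpos⟩)
    (mem_occurrences hc' ⟨0, hpos⟩)

theorem nodup_flatMap_blockConstraints :
    ((blocks H n T).flatMap (blockConstraints H G)).Nodup := by
  refine List.nodup_flatMap.2 ⟨fun q _ => ?_, (nodup_blocks H).imp ?_⟩
  · exact G.nodup.map (ConstraintOn.map_injective (Prod.mk_right_injective q))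
  · intro q q' hq c hc hc'
    obtain ⟨c, hc₁, rfl⟩ := List.mem_map.1 hc
    obtain ⟨c', -, h⟩ := List.mem_map.1 hc'
    obtain ⟨u, rfl, hu⟩ := ConstraintOn.exists_eq_of_map_eq_map h.symm
    exact hq (congrArg Prod.fst (hu ⟨0, G.arity_pos hc₁⟩))

-- A constraint of a block all of whose variables are ports is satisfied by the constant tuples,
-- whereas a nontrivial constraint with only one variable is violated by one of them. Hence no
-- constraint of a block is repeated outside of the blocks.
theorem disjoint_occConstraints_blocks {cs : List (ConstraintOn Γ (Fin n))} :
    (occConstraints hΓ H G T cs).Disjoint ((blocks H n T).flatMap (blockConstraints H G)) := by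
  intro c hc hc'
  obtain ⟨q, -, hq⟩ := List.mem_flatMap.1 hc'
  obtain ⟨c, hcG, rfl⟩ := List.mem_map.1 hq
  have hport : ∀ e, c.2 e = G.port (2 * H.entries) := fun e => by
    obtain ⟨x, -, hx⟩ := (mem_occurrences_occConstraints hΓ).1 (mem_occurrences hc e)
    exact (congrArg Prod.snd hx).symm
  obtain ⟨b, hb⟩ := ConstraintOn.exists_const_notMem
    (fun e e' => (hport e).trans (hport e').symm) (G.nontrivial c hcG)
  exact hb (G.const_mem_of_forall_port hcG (fun e => ⟨_, hport e⟩) b)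

theorem disjoint_links_blocks : ((cells n T).flatMap (linkConstraints H G)).Disjoint
    ((blocks H n T).flatMap (blockConstraints H G)) := by
  intro c hc hc'
  obtain ⟨q, -, hq⟩ := List.mem_flatMap.1 hc'
  obtain ⟨c, hcG, rfl⟩ := List.mem_map.1 hq
  obtain ⟨p, -, hp⟩ := List.mem_flatMap.1 hc
  obtain ⟨c', hcH, h⟩ := List.mem_map.1 hp
  obtain ⟨u, rfl, hu⟩ := ConstraintOn.exists_eq_of_map_eq_map h.symm
  have hone : ∀ e e', (u e).1 = (u e').1 := fun e e' =>
    fst_eq_of_linkVar_fst_eq (G := G) (p := p) (by rw [← hu e, ← hu e'])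
  obtain ⟨b, hb⟩ := ConstraintOn.exists_const_notMem hone
    (H.nontrivial _ (map_fst_mem_of_mem_number hcH))
  refine hb (G.const_mem_of_forall_port hcG (fun e => ?_) b)
  exact exists_port_of_mem_occurrences (subset_refl Δ) (cs := [])
    (mem_occurrences (List.mem_append_right _ hc) e)

theorem nodup_boundedConstraints {cs : List (ConstraintOn Γ (Fin n))} (hcs : cs.Nodup) :
    (boundedConstraints hΓ H G T cs).Nodup := by
  rw [(boundedConstraints_perm hΓ H G T cs).nodup_iff]
  have hlinks : ((cells n T).flatMap (linkConstraints H G)).Nodup :=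
    nodup_of_nodup_occurrences nodup_occurrences_links fun c hc => arity_pos_of_mem_links hc
  exact ((nodup_occConstraints hΓ hcs).append hlinks (disjoint_occConstraints_links hΓ)).append
    nodup_flatMap_blockConstraints
    (List.disjoint_append_left.2 ⟨disjoint_occConstraints_blocks hΓ, disjoint_links_blocks⟩)

theorem count_occurrences_blocks (v : Var H G n T) :
    (occurrences ((blocks H n T).flatMap (blockConstraints H G))).count v ≤
      (occurrences G.constraints).count v.2 := by
  classical
  obtain ⟨q, x⟩ := v
  have hblock : ∀ q', (occurrences (blockConstraints H G q')).count (q, x) =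
      if q' = q then (occurrences G.constraints).count x else 0 := by
    intro q'
    rw [blockConstraints, occurrences_map]
    split_ifs with hq
    · subst hq
      exact List.count_map_of_injective _ _ (Prod.mk_right_injective q') x
    · refine List.count_eq_zero.2 fun hmem => ?_
      obtain ⟨y, -, h⟩ := List.mem_map.1 hmem
      exact hq (congrArg Prod.fst h)
  rw [occurrences_flatMap, List.count_flatMap]
  simp only [Function.comp_def, hblock]
  rw [← List.sum_toFinset _ (nodup_blocks H), Finset.sum_ite_eq']
  split_ifs <;> simp

theorem count_boundedConstraints {cs : List (ConstraintOn Γ (Fin n))}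
    (hT : (occurrences cs).length = T) (v : Var H G n T) :
    (occurrences (boundedConstraints hΓ H G T cs)).count v ≤ d := by
  rw [(occurrences_perm (boundedConstraints_perm hΓ H G T cs)).count_eq, occurrences_append,
    List.count_append]
  have hports := List.nodup_iff_count_le_one.1
    (nodup_occurrences_append (H := H) (G := G) hΓ hT) v
  have hblocks := count_occurrences_blocks v
  by_cases hv : v ∈ occurrences (occConstraints hΓ H G T cs ++
      (cells n T).flatMap (linkConstraints H G))
  · obtain ⟨j, hj⟩ := exists_port_of_mem_occurrences hΓ hv
    have := G.count_port_lt j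
    rw [hj] at hblocks
    omega
  · have := G.count_le v.2
    rw [List.count_eq_zero.2 hv]
    omega

end Construction

section Counting

variable {Γ Δ : ConstraintLanguage} {d : ℕ} (hΓ : Γ ⊆ Δ) {H : Gadget Δ d 2}
  {G : Gadget Δ d (2 * H.entries + 2)} {n T : ℕ}

/-- The assignment to the copy of `H` that links the cell `p` with its predecessor. -/
def linkAssignment (H : Gadget Δ d 2) (b : Block H n T → Bool) (p : Cell n T)
    (i : Fin H.numVars) : Bool :=
  if i = H.port 1 then b (p.pred, H.port 0) else b (p, i)

theorem linkAssignment_port_one (b : Block H n T → Bool) (p : Cell n T) :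
    linkAssignment H b p (H.port 1) = b (p.pred, H.port 0) := if_pos rfl

theorem linkAssignment_port_zero (b : Block H n T → Bool) (p : Cell n T) :
    linkAssignment H b p (H.port 0) = b (p, H.port 0) := if_neg H.port_zero_ne_port_one

/-- Assigning the value `b q` to all ports of each block `q` satisfies all links and the given
instance. -/
def BlockSat (H : Gadget Δ d 2) (T : ℕ) (cs : List (ConstraintOn Γ (Fin n)))
    (b : Block H n T → Bool) : Prop :=
  (∀ p, AllHold H.constraints (linkAssignment H b p)) ∧ AllHold cs fun v => b ((0, v), H.port 0)

theorem eq_of_links {b : Block H n T → Bool}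
    (h : ∀ p, AllHold H.constraints (linkAssignment H b p)) (p : Cell n T) :
    b (p, H.port 0) = b ((0, p.2), H.port 0) := by
  have hpred : ∀ p : Cell n T, b (p, H.port 0) = b (p.pred, H.port 0) := fun p => by
    rw [← linkAssignment_port_zero b p, ← linkAssignment_port_one b p]
    exact (H.sol_port ⟨_, h p⟩ 0).trans (H.sol_port ⟨_, h p⟩ 1).symm
  obtain ⟨j, v⟩ := p
  induction j using Fin.induction with
  | zero => rfl
  | succ j ih =>
    have hj : Cell.pred (j.succ, v) = (j.castSucc, v) := by
      simp only [Cell.pred, ← Fin.coeSucc_eq_succ, add_sub_cancel_right]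
    rw [hpred, hj]
    exact ih

theorem allHold_boundedConstraints (cs : List (ConstraintOn Γ (Fin n))) (s : Var H G n T → Bool) :
    AllHold (boundedConstraints hΓ H G T cs) s ↔
      AllHold (number 2 cs) (fun x => s (occVar H G x)) ∧
      (∀ p, AllHold (number 0 H.constraints) fun x => s (linkVar H G p x)) ∧
      ∀ q, AllHold G.constraints fun x => s (q, x) := by
  simp only [boundedConstraints, allHold_append, allHold_flatMap, occConstraints, linkConstraints,
    blockConstraints, allHold_map, allHold_lift, mem_cells, true_imp_iff, List.mem_finRange,
    forall_and, Prod.forall]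

theorem allHold_boundedConstraints_iff (cs : List (ConstraintOn Γ (Fin n)))
    {s : Var H G n T → Bool} {b : Block H n T → Bool} (hb : ∀ q j, s (q, G.port j) = b q) :
    AllHold (boundedConstraints hΓ H G T cs) s ↔
      BlockSat H T cs b ∧ ∀ q, AllHold G.constraints fun x => s (q, x) := by
  have hlink : ∀ p, (AllHold (number 0 H.constraints) fun x => s (linkVar H G p x)) ↔
      AllHold H.constraints (linkAssignment H b p) := fun p => allHold_number fun i j => by
    simp only [linkVar, linkAssignment]
    split_ifs <;> exact hb _ _
  have hocc (h : ∀ p, AllHold H.constraints (linkAssignment H b p)) :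
      (AllHold (number 2 cs) fun x => s (occVar H G x)) ↔
        AllHold cs fun v => b ((0, v), H.port 0) :=
    allHold_number fun v j => by rw [occVar, hb, eq_of_links h]
  rw [allHold_boundedConstraints, BlockSat]
  simp only [hlink]
  exact ⟨fun h => ⟨⟨h.2.1, (hocc h.2.1).1 h.1⟩, h.2.2⟩,
    fun h => ⟨(hocc h.1.1).2 h.1.2, h.1.1, h.2⟩⟩

/-- The solution of the copy of `G` in the block `q` that is part of a solution of the constructed
instance. -/
def blockSol {cs : List (ConstraintOn Γ (Fin n))}
    (s : {s : Var H G n T → Bool // AllHold (boundedConstraints hΓ H G T cs) s})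
    (q : Block H n T) : {s // AllHold G.constraints s} :=
  ⟨fun x => s.1 (q, x), ((allHold_boundedConstraints hΓ cs s.1).1 s.2).2.2 q⟩

/-- A solution of the constructed instance is determined by the values of the ports of each block
and the choice of a solution of `G` with these values. -/
def boundedEquiv (cs : List (ConstraintOn Γ (Fin n))) :
    {s : Var H G n T → Bool // AllHold (boundedConstraints hΓ H G T cs) s} ≃
      {b : Block H n T → Bool // BlockSat H T cs b} × (Block H n T → Fin G.mult) where
  toFun s := (⟨fun q => (G.solEquiv (blockSol hΓ s q)).1,
      ((allHold_boundedConstraints_iff hΓ cs fun q j =>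
        G.sol_port (blockSol hΓ s q) j).1 s.2).1⟩,
    fun q => (G.solEquiv (blockSol hΓ s q)).2)
  invFun t := ⟨fun v => (G.solEquiv.symm (t.1.1 v.1, t.2 v.1)).1 v.2,
    (allHold_boundedConstraints_iff hΓ cs fun q j => by
      rw [G.sol_port, Equiv.apply_symm_apply]).2
      ⟨t.1.2, fun q => (G.solEquiv.symm (t.1.1 q, t.2 q)).2⟩⟩
  left_inv s := by
    ext v
    simp [blockSol]
  right_inv t := by
    ext q <;> simp [blockSol]

/-- The values of the blocks determined by an assignment `a` of the given instance and the choice,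
for each link, of a solution of `H` and a value of the block for the second port of `H`, which the
link does not use. -/
def blockAssignment (H : Gadget Δ d 2) (a : Fin n → Bool) (t : Cell n T → Fin H.mult × Bool)
    (q : Block H n T) : Bool :=
  if q.2 = H.port 1 then (t q.1).2 else (H.solEquiv.symm (a q.1.2, (t q.1).1)).1 q.2

theorem blockAssignment_port_one (a : Fin n → Bool) (t : Cell n T → Fin H.mult × Bool)
    (p : Cell n T) : blockAssignment H a t (p, H.port 1) = (t p).2 := if_pos rfl

theorem blockAssignment_port_zero (a : Fin n → Bool) (t : Cell n T → Fin H.mult × Bool)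
    (p : Cell n T) : blockAssignment H a t (p, H.port 0) = a p.2 := by
  rw [blockAssignment, if_neg H.port_zero_ne_port_one, H.sol_port, Equiv.apply_symm_apply]

theorem linkAssignment_blockAssignment (a : Fin n → Bool) (t : Cell n T → Fin H.mult × Bool)
    (p : Cell n T) :
    linkAssignment H (blockAssignment H a t) p = (H.solEquiv.symm (a p.2, (t p).1)).1 := by
  funext i
  rw [linkAssignment]
  split_ifs with h
  · rw [blockAssignment_port_zero, h, H.sol_port, Equiv.apply_symm_apply]
    rfl
  · rw [blockAssignment, if_neg h]

theorem blockSat_blockAssignment {cs : List (ConstraintOn Γ (Fin n))} {a : Fin n → Bool}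
    (ha : AllHold cs a) (t : Cell n T → Fin H.mult × Bool) :
    BlockSat H T cs (blockAssignment H a t) := by
  refine ⟨fun p => ?_, ?_⟩
  · rw [linkAssignment_blockAssignment]
    exact (H.solEquiv.symm _).2
  · simpa only [blockAssignment_port_zero] using ha

/-- The values of the blocks in solutions of the constructed instance are parametrized by the
solutions of the given instance and choices for each link. -/
def blockEquiv (H : Gadget Δ d 2) (T : ℕ) (cs : List (ConstraintOn Γ (Fin n))) :
    {b : Block H n T → Bool // BlockSat H T cs b} ≃
      {a : Fin n → Bool // AllHold cs a} × (Cell n T → Fin H.mult × Bool) where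
  toFun b := (⟨_, b.2.2⟩, fun p => ((H.solEquiv ⟨_, b.2.1 p⟩).2, b.1 (p, H.port 1)))
  invFun t := ⟨_, blockSat_blockAssignment t.1.2 t.2⟩
  left_inv b := by
    ext ⟨p, i⟩
    have hvalue : b.1 ((0, p.2), H.port 0) = (H.solEquiv ⟨_, b.2.1 p⟩).1 := by
      rw [← eq_of_links b.2.1 p, ← linkAssignment_port_zero b.1 p]
      exact H.sol_port ⟨_, b.2.1 p⟩ 0
    simp only [blockAssignment]
    split_ifs with h
    · rw [h]
    · rw [hvalue]
      simp [linkAssignment, h]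
  right_inv t := by
    obtain ⟨a, t⟩ := t
    refine Prod.ext (Subtype.ext (funext fun v => blockAssignment_port_zero a.1 t (0, v)))
      (funext fun p => Prod.ext ?_ (blockAssignment_port_one a.1 t p))
    have hsol : (⟨_, (blockSat_blockAssignment a.2 t).1 p⟩ : {s // AllHold H.constraints s}) =
        H.solEquiv.symm (a.1 p.2, (t p).1) :=
      Subtype.ext (linkAssignment_blockAssignment a.1 t p)
    simp only [hsol, Equiv.apply_symm_apply]

theorem card_allHold_boundedConstraints (cs : List (ConstraintOn Γ (Fin n))) :
    Nat.card {s : Var H G n T → Bool // AllHold (boundedConstraints hΓ H G T cs) s} =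
      Nat.card {a : Fin n → Bool // AllHold cs a} *
        (2 * H.mult * G.mult ^ H.numVars) ^ ((T + 2) * n) := by
  rw [Nat.card_congr (boundedEquiv hΓ cs), Nat.card_prod, Nat.card_congr (blockEquiv H T cs),
    Nat.card_prod, mul_assoc]
  simp only [Nat.card_eq_fintype_card, Fintype.card_fun, Fintype.card_prod, Fintype.card_fin,
    Fintype.card_bool]
  ring

end Counting

section Encoding

variable {Γ Δ : ConstraintLanguage} {d : ℕ} (hΓ : Γ ⊆ Δ) (H : Gadget Δ d 2)
  (G : Gadget Δ d (2 * H.entries + 2))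

/-- Numbering of the variables of the constructed instance. -/
def varEquiv (n T : ℕ) : Var H G n T ≃ Fin ((T + 2) * n * H.numVars * G.numVars) :=
  (((finProdFinEquiv.prodCongr (Equiv.refl _)).trans finProdFinEquiv).prodCongr
    (Equiv.refl _)).trans finProdFinEquiv

theorem val_varEquiv {n T : ℕ} (v : Var H G n T) : (varEquiv H G n T v : ℕ) =
    (v.1.1.1 * n + v.1.1.2) * (H.numVars * G.numVars) + (v.1.2 * G.numVars + v.2) := by
  simp only [varEquiv, Equiv.trans_apply, Equiv.prodCongr_apply, Prod.map, Equiv.refl_apply,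
    finProdFinEquiv_apply_val]
  ring

/-- The number of cells used for an instance: one for each of its variables in each layer, with two
layers more than there are occurrences of variables. -/
def numCells (I : CSPInstance Γ) : ℕ := ((occurrences I.constraints).length + 2) * I.numVars

/-- The constructed instance of bounded degree. -/
def boundedInstance (I : CSPInstance Γ) : CSPInstance Δ where
  numVars := numCells I * H.numVars * G.numVars
  constraints := (boundedConstraints hΓ H G (occurrences I.constraints).length I.constraints).map
    (ConstraintOn.map (varEquiv H G _ _))
  nodup := (nodup_boundedConstraints hΓ I.nodup).map
    (ConstraintOn.map_injective (Equiv.injective _))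

theorem CSPInstance.Z_eq_card (I : CSPInstance Γ) :
    I.Z = Nat.card {a : Fin I.numVars → Bool // AllHold I.constraints a} := by
  rw [CSPInstance.Z, ← Nat.card_coe_set_eq]
  rfl

theorem boundedInstance_Z (I : CSPInstance Γ) : (boundedInstance hΓ H G I).Z =
    I.Z * (2 * H.mult * G.mult ^ H.numVars) ^ numCells I := by
  rw [numCells, CSPInstance.Z_eq_card, I.Z_eq_card, ← card_allHold_boundedConstraints hΓ (G := G)]
  exact Nat.card_congr (((varEquiv H G _ _).arrowCongr (Equiv.refl Bool)).symm.subtypeEquiv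
    fun s => allHold_map _ _ _)

theorem boundedInstance_degree (I : CSPInstance Γ) : (boundedInstance hΓ H G I).degree ≤ d := by
  refine Finset.sup_le fun v _ => ?_
  rw [CSPInstance.varDegree_eq_count]
  obtain ⟨v, rfl⟩ := (varEquiv H G _ _).surjective v
  have hcount := List.count_map_of_injective (occurrences (boundedConstraints hΓ H G _
    I.constraints)) (varEquiv H G _ _) (Equiv.injective _) v
  rw [← occurrences_map] at hcount
  exact hcount.trans_le (count_boundedConstraints hΓ rfl v)

/-- Code of a constraint whose variables are natural numbers. -/
def encodeNatConstraint (c : ConstraintOn Δ ℕ) : List (Sym Δ) :=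
  .inr c.1 :: (List.ofFn c.2).flatMap (encodeNum Δ)

theorem encodeConstraint_eq {n : ℕ} (c : Constraint Δ n) :
    encodeConstraint c = encodeNatConstraint (ConstraintOn.map Fin.val c) := by
  have hmap : List.ofFn (ConstraintOn.map Fin.val c).2 = (List.ofFn c.2).map Fin.val := by
    rw [List.map_ofFn]
    rfl
  -- The coercion in `encodeConstraint` is elaborated as a monadic lift of the scope.
  have hbind : (do let a ← List.ofFn c.2; pure (a : ℕ)) = (List.ofFn c.2).map Fin.val := by
    simp [List.map_eq_flatMap]
  rw [encodeNatConstraint, hmap, encodeConstraint, hbind]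
  rfl

/-- Code of the scope `vs` whose entries are the occurrences with the numbers `k`, `k + 1`, …; the
one with number `j` of the variable `v` becomes the variable with number `o` among the `L` variables
of the cell `j * n + v`. -/
def scopeCode (Δ : ConstraintLanguage) (L o k : ℕ) {n : ℕ} (vs : List (Fin n)) : List (Sym Δ) :=
  (vs.zipIdx k).flatMap fun x => encodeNum Δ ((x.2 * n + x.1) * L + o)

/-- Code of constraints in which the occurrences of variables, numbered from `k` on, have been
replaced as in `scopeCode`. -/
def occCode (L o k : ℕ) {n : ℕ} (cs : List (ConstraintOn Γ (Fin n))) : List (Sym Δ) :=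
  (number k cs).flatMap fun c =>
    encodeNatConstraint ((c.lift hΓ).map fun x => (x.2 * n + x.1) * L + o)

theorem scopeCode_cons (L o k : ℕ) {n : ℕ} (v : Fin n) (vs : List (Fin n)) :
    scopeCode Δ L o k (v :: vs) =
      encodeNum Δ ((k * n + v) * L + o) ++ scopeCode Δ L o (k + 1) vs := by
  rw [scopeCode, List.zipIdx_cons, List.flatMap_cons, scopeCode]

theorem occCode_cons (L o k : ℕ) {n : ℕ} (c : ConstraintOn Γ (Fin n))
    (cs : List (ConstraintOn Γ (Fin n))) :
    occCode hΓ L o k (c :: cs) = .inr ⟨c.1.1, hΓ c.1.2⟩ :: scopeCode Δ L o k (List.ofFn c.2) ++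
      occCode hΓ L o (k + c.1.1.1) cs := by
  have hzip : (List.ofFn c.2).zipIdx k = List.ofFn fun e => (c.2 e, k + (e : ℕ)) := by
    apply List.ext_getElem <;> simp
  rw [occCode, number, List.flatMap_cons, scopeCode, hzip,
    ← List.flatMap_map (fun x : Fin n × ℕ => (x.2 * n + x.1) * L + o), List.map_ofFn]
  rfl

/-- The constraints of a cell and the link with its predecessor. Variables are given by the cell
(`true` for the predecessor) and the number of the variable in its cell. -/
def template : List (ConstraintOn Δ (Bool × ℕ)) :=
  (number 0 H.constraints).map (ConstraintOn.map fun x =>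
    if x.1 = H.port 1 then (true, H.entries + x.2) else (false, x.1 * G.numVars + x.2)) ++
  (List.finRange H.numVars).flatMap fun i : Fin H.numVars =>
    G.constraints.map (ConstraintOn.map fun x : Fin G.numVars =>
      (false, (i : ℕ) * G.numVars + (x : ℕ)))

/-- Code of the constraints given by a template, for cells with `L` variables. -/
def cellCode (L : ℕ) (τ : List (ConstraintOn Δ (Bool × ℕ))) (own pred : ℕ) : List (Sym Δ) :=
  τ.flatMap fun c => encodeNatConstraint (c.map fun y => cond y.1 pred own * L + y.2)

theorem encode_cell {n T : ℕ} (p : Cell n T) :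
    (linkConstraints H G p ++ (List.finRange H.numVars).flatMap fun i =>
      blockConstraints H G (p, i)).flatMap
        (fun c => encodeNatConstraint (c.map fun v => (varEquiv H G n T v : ℕ))) =
    cellCode (H.numVars * G.numVars) (template H G) (p.1 * n + p.2)
      (p.pred.1 * n + p.pred.2) := by
  rw [cellCode, template, List.flatMap_append, List.flatMap_append]
  congr 1
  · rw [linkConstraints, List.flatMap_map, List.flatMap_map]
    refine List.flatMap_congr fun c hc => ?_
    rw [ConstraintOn.map_map, ConstraintOn.map_map]
    refine congrArg _ (ConstraintOn.map_congr fun e => ?_)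
    have he : (c.2 e).2 < H.entries := snd_lt_of_mem_number (mem_occurrences hc e)
    rw [val_varEquiv, linkVar]
    split_ifs with h
    · rw [G.val_port (by omega), H.val_port (by omega)]
      simp
    · rw [G.val_port (by omega)]
      simp
  · rw [List.flatMap_assoc, List.flatMap_assoc]
    refine List.flatMap_congr fun i _ => ?_
    rw [blockConstraints, List.flatMap_map, List.flatMap_map]
    refine List.flatMap_congr fun c _ => ?_
    rw [ConstraintOn.map_map, ConstraintOn.map_map]
    refine congrArg _ (ConstraintOn.map_congr fun e => ?_)
    rw [val_varEquiv]
    simp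

theorem encode_occConstraints {n T : ℕ} {cs : List (ConstraintOn Γ (Fin n))}
    (hT : (occurrences cs).length = T) :
    (occConstraints hΓ H G T cs).flatMap
        (fun c => encodeNatConstraint (c.map fun v => (varEquiv H G n T v : ℕ))) =
      occCode hΓ (H.numVars * G.numVars) (2 * H.entries) 2 cs := by
  rw [occConstraints, occCode, List.flatMap_map, List.flatMap_map]
  refine List.flatMap_congr fun c hc => ?_
  rw [ConstraintOn.map_map]
  refine congrArg _ (ConstraintOn.map_congr fun e => ?_)
  have he : (c.2 e).2 < (occurrences cs).length + 2 :=
    snd_lt_of_mem_number (mem_occurrences hc e)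
  change (varEquiv H G _ _ (occVar H G (c.2 e)) : ℕ) = _
  rw [val_varEquiv, occVar, G.val_port (by omega), H.val_port (by omega), Fin.val_ofNat,
    Nat.mod_eq_of_lt (by omega)]
  simp [ConstraintOn.lift]

theorem pred_index {n T : ℕ} (p : Cell n T) :
    (p.pred.1 * n + p.pred.2 : ℕ) =
      if (finProdFinEquiv p : ℕ) < n then (finProdFinEquiv p : ℕ) + (T + 1) * n
      else (finProdFinEquiv p : ℕ) - n := by
  obtain ⟨j, v⟩ := p
  have := v.2
  rw [Cell.pred, finProdFinEquiv_apply_val, Fin.coe_sub_one]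
  obtain rfl | hj := eq_or_ne j 0
  · simp [add_comm]
  · obtain ⟨i, hi⟩ : ∃ i : ℕ, (j : ℕ) = i + 1 :=
      Nat.exists_eq_succ_of_ne_zero fun h => hj (Fin.ext h)
    rw [if_neg hj, hi, if_neg (by rw [mul_add]; omega), mul_add, mul_comm n i]
    simp only [Nat.add_sub_cancel]
    omega

theorem flatMap_cells {α : Type} (n T : ℕ) (F : ℕ → ℕ → List α) :
    (cells n T).flatMap (fun p => F (p.1 * n + p.2) (p.pred.1 * n + p.pred.2)) =
      (List.range n).flatMap (fun p => F p (p + (T + 1) * n)) ++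
        (List.range ((T + 1) * n)).flatMap (fun p => F (n + p) p) := by
  let F' : ℕ → List α := fun p => F p (if p < n then p + (T + 1) * n else p - n)
  have hcell (p : Cell n T) : F (p.1 * n + p.2) (p.pred.1 * n + p.pred.2) =
      F' (finProdFinEquiv p : ℕ) := by
    rw [pred_index, show (p.1 * n + p.2 : ℕ) = finProdFinEquiv p by
      rw [finProdFinEquiv_apply_val]; ring]
  calc (cells n T).flatMap _
      = (List.range (n + (T + 1) * n)).flatMap F' := by
        rw [show n + (T + 1) * n = (T + 2) * n by ring, ← List.map_coe_finRange_eq_range,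
          List.flatMap_map, cells, List.flatMap_map]
        simp only [hcell, Equiv.apply_symm_apply]
    _ = _ := by
        rw [List.range_add, List.flatMap_append, List.flatMap_map]
        congr 1
        · exact List.flatMap_congr fun p hp => by simp only [F', if_pos (List.mem_range.1 hp)]
        · simp [F']

theorem boundedInstance_encode (I : CSPInstance Γ) : (boundedInstance hΓ H G I).encode =
    encodeNum Δ (numCells I * (H.numVars * G.numVars)) ++
    (occCode hΓ (H.numVars * G.numVars) (2 * H.entries) 2 I.constraints ++
      ((List.range I.numVars).flatMap (fun p => cellCode (H.numVars * G.numVars) (template H G) p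
          (p + ((occurrences I.constraints).length + 1) * I.numVars)) ++
        (List.range (((occurrences I.constraints).length + 1) * I.numVars)).flatMap
          (fun p => cellCode (H.numVars * G.numVars) (template H G) (I.numVars + p) p))) := by
  rw [← flatMap_cells _ _ (cellCode (H.numVars * G.numVars) (template H G)),
    ← encode_occConstraints hΓ H G rfl, CSPInstance.encode, boundedInstance]
  refine congrArg₂ _ (congrArg (encodeNum Δ) (mul_assoc _ H.numVars _)) ?_
  simp only [List.flatMap_map, encodeConstraint_eq]
  rw [boundedConstraints, List.flatMap_append, List.flatMap_assoc]
  exact congrArg₂ _ rfl (List.flatMap_congr fun p _ => encode_cell H G p)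

end Encoding

/-! ### Programs on named stacks -/

namespace Prog

variable {K : Type} [DecidableEq K] {S : K → Type} {σ : Type}

theorem Runs.mono {p : Prog S σ} {s s' : State S σ} {B B' : ℕ} (h : p.Runs s B s')
    (hB : B ≤ B') : p.Runs s B' s' :=
  let ⟨t, ht, h⟩ := h
  ⟨t, ht.trans hB, h⟩

theorem Runs.seq {p q : Prog S σ} {s s' s'' : State S σ} {B B' : ℕ} (h : p.Runs s B s')
    (h' : q.Runs s' B' s'') : (Prog.seq p q).Runs s (B + B') s'' :=
  let ⟨_, ht, h⟩ := h
  let ⟨_, ht', h'⟩ := h'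
  ⟨_, Nat.add_le_add ht ht', .seq h h'⟩

theorem Runs.ite_true {c : σ → Bool} {p q : Prog S σ} {s s' : State S σ} {B : ℕ}
    (hc : c s.1 = true) (h : p.Runs s B s') : (Prog.ite c p q).Runs s (B + 1) s' :=
  let ⟨_, ht, h⟩ := h
  ⟨_, Nat.succ_le_succ ht, .ite_true hc h⟩

theorem Runs.ite_false {c : σ → Bool} {p q : Prog S σ} {s s' : State S σ} {B : ℕ}
    (hc : c s.1 = false) (h : q.Runs s B s') : (Prog.ite c p q).Runs s (B + 1) s' :=
  let ⟨_, ht, h⟩ := h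
  ⟨_, Nat.succ_le_succ ht, .ite_false hc h⟩

theorem runs_push {k : K} {f : σ → S k} {s : State S σ} :
    (Prog.push k f).Runs s 1 (s.1, Function.update s.2 k (f s.1 :: s.2 k)) :=
  ⟨1, le_rfl, .push⟩

theorem runs_pop {k : K} {f : σ → Option (S k) → σ} {s : State S σ} :
    (Prog.pop k f).Runs s 1 (f s.1 (s.2 k).head?, Function.update s.2 k (s.2 k).tail) :=
  ⟨1, le_rfl, .pop⟩

theorem runs_load {f : σ → σ} {s : State S σ} : (Prog.load f).Runs s 1 (f s.1, s.2) :=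
  ⟨1, le_rfl, .load⟩

theorem Runs.loop_nil {k : K} {body : S k → Prog S σ} {s : State S σ} (h : s.2 k = []) :
    (Prog.loop k body).Runs s 1 s :=
  ⟨1, le_rfl, .loop_nil h⟩

theorem Runs.loop_cons {k : K} {body : S k → Prog S σ} {s s' s'' : State S σ} {a : S k}
    {l : List (S k)} {B B' : ℕ} (hk : s.2 k = a :: l)
    (h : (body a).Runs (s.1, Function.update s.2 k l) B s')
    (h' : (Prog.loop k body).Runs s' B' s'') : (Prog.loop k body).Runs s (B + B' + 1) s'' :=
  let ⟨_, ht, h⟩ := h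
  let ⟨_, ht', h'⟩ := h'
  ⟨_, by omega, .loop_cons hk h h'⟩

/-- The program that changes nothing. -/
def skip : Prog S σ := .load id

/-- Push the elements of a list, one after the other. -/
def pushes (k : K) : List (S k) → Prog S σ
  | [] => skip
  | a :: l => .seq (.push k fun _ => a) (pushes k l)

theorem runs_pushes (k : K) (l : List (S k)) (s : State S σ) :
    (pushes k l).Runs s (l.length + 1) (s.1, Function.update s.2 k (l.reverse ++ s.2 k)) := by
  induction l generalizing s with
  | nil => simpa [pushes, skip] using runs_load (f := id) (s := s)
  | cons a l ih =>
    have h := (runs_push (f := fun _ => a)).seq (ih (s.1, Function.update s.2 k (a :: s.2 k)))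
    rw [List.length_cons, Nat.add_comm]
    simpa [pushes] using h

/-- Run a program `n` times. -/
def iter (p : Prog S σ) : ℕ → Prog S σ
  | 0 => skip
  | n + 1 => .seq p (iter p n)

theorem runs_iter {p : Prog S σ} (st : ℕ → State S σ) {n B : ℕ}
    (h : ∀ i < n, p.Runs (st i) B (st (i + 1))) : (iter p n).Runs (st 0) (n * B + 1) (st n) := by
  induction n generalizing st with
  | zero => simpa [iter, skip] using runs_load (f := id) (s := st 0)
  | succ n ih =>
    have htail := ih (fun i => st (i + 1)) fun i hi => h (i + 1) (by omega)
    refine ((h 0 (by omega)).seq htail).mono ?_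
    rw [Nat.succ_mul]
    omega

theorem Exec.length_le {p : Prog S σ} {s s' : State S σ} {t : ℕ} (h : p.Exec s t s') (k : K) :
    (s'.2 k).length ≤ (s.2 k).length + t := by
  have hpop (f : ∀ k, List (S k)) {j : K} {l : List (S j)} (hl : l.length ≤ (f j).length) :
      (Function.update f j l k).length ≤ (f k).length := by
    by_cases hj : k = j
    · subst hj
      simpa using hl
    · simp [hj]
  induction h with
  | @push j f s =>
    by_cases hj : k = j
    · subst hj
      simp
    · simp [hj]
  | @pop j _ s => exact (hpop s.2 (by simp)).trans (Nat.le_add_right _ _)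
  | load | loop_nil => simp
  | seq _ _ h h' => omega
  | ite_true _ _ h | ite_false _ _ h => omega
  | @loop_cons j _ a l s t s' t' s'' hk _ _ h h' =>
    have := hpop s.2 (j := j) (l := l) (by simp [hk])
    simp only at h
    omega

end Prog

/-- The unary counters of the reduction: the number of variables of the given instance, the number
of the first cell of the current layer, the numbers of the current cell and of its predecessor, the
variable that is being read, a temporary one, and the number of cells. -/
inductive Ctr
  | n | base | pred | own | var | tmp | cells
deriving DecidableEq

instance : Finite Ctr :=
  Finite.of_surjective (fun i : Fin 7 => (![.n, .base, .pred, .own, .var, .tmp, .cells] i : Ctr))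
    fun c => by
      cases c
      exacts [⟨0, rfl⟩, ⟨1, rfl⟩, ⟨2, rfl⟩, ⟨3, rfl⟩, ⟨4, rfl⟩, ⟨5, rfl⟩, ⟨6, rfl⟩]

/-- The work stacks of the reduction: the counters, the reversed query, and two binary numbers. -/
inductive WStack
  | ctr (c : Ctr)
  | word
  | bits (b : Bool)
deriving DecidableEq

instance : Finite WStack :=
  Finite.of_surjective (Sum.elim .ctr (Option.elim · .word .bits) : Ctr ⊕ Option Bool → WStack)
    fun w => by
      cases w with
      | ctr c => exact ⟨.inl c, rfl⟩
      | word => exact ⟨.inr none, rfl⟩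
      | bits b => exact ⟨.inr (some b), rfl⟩

/-- Alphabets of the work stacks. -/
abbrev WStack.Alphabet (B : Type) : WStack → Type
  | .ctr _ => Unit
  | .word => B
  | .bits _ => Bool

/-- Alphabets of all stacks. -/
abbrev Alph (A B : Type) : Port ⊕ WStack → Type :=
  Sum.elim (Port.Alphabet A B) (WStack.Alphabet B)

instance {B : Type} [Finite B] (w : WStack) : Finite (WStack.Alphabet B w) := by
  cases w <;> simp only [WStack.Alphabet] <;> infer_instance

/-- Contents of all stacks; a stack over a one-letter alphabet is given by its height. -/
structure Mem (A B : Type) where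
  input : List A := []
  inputErr : ℕ := 0
  query : List B := []
  queryErr : ℕ := 0
  answer : List Bool := []
  output : List Bool := []
  word : List B := []
  bits : Bool → List Bool := fun _ => []
  ctr : Ctr → ℕ := fun _ => 0

namespace Mem

variable {A B : Type}

/-- The stacks with the given contents. -/
def stk (m : Mem A B) : ∀ k, List (Alph A B k)
  | .inl .input => m.input
  | .inl .inputErr => List.replicate m.inputErr ()
  | .inl .query => m.query
  | .inl .queryErr => List.replicate m.queryErr ()
  | .inl .answer => m.answer
  | .inl .output => m.output
  | .inr (.ctr c) => List.replicate (m.ctr c) ()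
  | .inr .word => m.word
  | .inr (.bits b) => m.bits b

/-- Set a counter. -/
def setCtr (m : Mem A B) (c : Ctr) (x : ℕ) : Mem A B := { m with ctr := Function.update m.ctr c x }

/-- Set one of the binary numbers. -/
def setBits (m : Mem A B) (b : Bool) (l : List Bool) : Mem A B :=
  { m with bits := Function.update m.bits b l }

theorem update_input (m : Mem A B) (l : List A) :
    Function.update m.stk (.inl .input) l = stk { m with input := l } := by
  funext k
  rcases k with k | k <;> cases k <;> rfl

theorem update_inputErr (m : Mem A B) (x : ℕ) :
    Function.update m.stk (.inl .inputErr) (List.replicate x ()) =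
      stk { m with inputErr := x } := by
  funext k
  rcases k with k | k <;> cases k <;> rfl

theorem update_query (m : Mem A B) (l : List B) :
    Function.update m.stk (.inl .query) l = stk { m with query := l } := by
  funext k
  rcases k with k | k <;> cases k <;> rfl

theorem update_queryErr (m : Mem A B) (x : ℕ) :
    Function.update m.stk (.inl .queryErr) (List.replicate x ()) =
      stk { m with queryErr := x } := by
  funext k
  rcases k with k | k <;> cases k <;> rfl

theorem update_answer (m : Mem A B) (l : List Bool) :
    Function.update m.stk (.inl .answer) l = stk { m with answer := l } := by
  funext k
  rcases k with k | k <;> cases k <;> rfl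

theorem update_output (m : Mem A B) (l : List Bool) :
    Function.update m.stk (.inl .output) l = stk { m with output := l } := by
  funext k
  rcases k with k | k <;> cases k <;> rfl

theorem update_word (m : Mem A B) (l : List B) :
    Function.update m.stk (.inr .word) l = stk { m with word := l } := by
  funext k
  rcases k with k | k <;> cases k <;> rfl

theorem update_ctr (m : Mem A B) (c : Ctr) (x : ℕ) :
    Function.update m.stk (.inr (.ctr c)) (List.replicate x ()) = stk (m.setCtr c x) := by
  refine Function.update_eq_iff.mpr ⟨by simp [stk, setCtr], ?_⟩
  rintro (k | c' | _ | b) hk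
  · cases k <;> rfl
  · have hc : c' ≠ c := fun h => hk (h ▸ rfl)
    simp [stk, setCtr, hc]
  all_goals rfl

theorem update_bits (m : Mem A B) (b : Bool) (l : List Bool) :
    Function.update m.stk (.inr (.bits b)) l = stk (m.setBits b l) := by
  refine Function.update_eq_iff.mpr ⟨by simp [stk, setBits], ?_⟩
  rintro (k | c | _ | b') hk
  · cases k <;> rfl
  · rfl
  · rfl
  · have hb : b' ≠ b := fun h => hk (h ▸ rfl)
    simp [stk, setBits, hb]

@[simp] theorem setCtr_setCtr (m : Mem A B) (c : Ctr) (x y : ℕ) :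
    (m.setCtr c x).setCtr c y = m.setCtr c y := by simp [setCtr]

theorem setCtr_comm (m : Mem A B) {c c' : Ctr} (h : c ≠ c') (x y : ℕ) :
    (m.setCtr c x).setCtr c' y = (m.setCtr c' y).setCtr c x := by
  simp [setCtr, Function.update_comm h]

@[simp] theorem ctr_setCtr (m : Mem A B) (c : Ctr) (x : ℕ) : (m.setCtr c x).ctr c = x := by
  simp [setCtr]

theorem ctr_setCtr_of_ne (m : Mem A B) {c c' : Ctr} (h : c' ≠ c) (x : ℕ) :
    (m.setCtr c x).ctr c' = m.ctr c' := by
  simp [setCtr, h]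

theorem setCtr_eq_self {m : Mem A B} {c : Ctr} {x : ℕ} (h : m.ctr c = x) : m.setCtr c x = m := by
  simp [setCtr, ← h]

/-- Push the elements of `l.reverse` on the stack `word`. -/
def addWord (m : Mem A B) (l : List B) : Mem A B := { m with word := l ++ m.word }

theorem addWord_setCtr (m : Mem A B) (c : Ctr) (x : ℕ) (l : List B) :
    (m.setCtr c x).addWord l = (m.addWord l).setCtr c x := rfl

theorem addWord_addWord (m : Mem A B) (l l' : List B) :
    (m.addWord l).addWord l' = m.addWord (l' ++ l) := by simp [addWord]

theorem addWord_nil (m : Mem A B) : m.addWord [] = m := rfl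

end Mem

/-- `p` leads from the store `s` and memory `m` to `s'` and `m'` in at most `t` steps. -/
def MRuns {A B σ : Type} (p : Prog (Alph A B) σ) (s : σ) (m : Mem A B) (t : ℕ) (s' : σ)
    (m' : Mem A B) : Prop :=
  p.Runs (s, m.stk) t (s', m'.stk)

namespace MRuns

variable {A B σ : Type} {p q : Prog (Alph A B) σ} {s s' s'' : σ} {m m' m'' : Mem A B} {t t' : ℕ}

theorem mono (h : MRuns p s m t s' m') (ht : t ≤ t') : MRuns p s m t' s' m' := Prog.Runs.mono h ht

theorem seq (h : MRuns p s m t s' m') (h' : MRuns q s' m' t' s'' m'') :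
    MRuns (.seq p q) s m (t + t') s'' m'' := Prog.Runs.seq h h'

theorem conv (h : MRuns p s m t s' m') (ht : t ≤ t') (hm : m' = m'') : MRuns p s m t' s' m'' :=
  hm ▸ h.mono ht

theorem ite_true {c : σ → Bool} (hc : c s = true) (h : MRuns p s m t s' m') :
    MRuns (.ite c p q) s m (t + 1) s' m' := Prog.Runs.ite_true hc h

theorem ite_false {c : σ → Bool} (hc : c s = false) (h : MRuns q s m t s' m') :
    MRuns (.ite c p q) s m (t + 1) s' m' := Prog.Runs.ite_false hc h

theorem load {f : σ → σ} : MRuns (.load f) s m 1 (f s) m := Prog.runs_load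

theorem skip : MRuns (Prog.skip : Prog (Alph A B) σ) s m 1 s m := load

theorem of_push {k : Port ⊕ WStack} {f : σ → Alph A B k}
    (h : Function.update m.stk k (f s :: m.stk k) = m'.stk) : MRuns (.push k f) s m 1 s m' := by
  rw [MRuns, ← h]
  exact Prog.runs_push (s := (s, m.stk))

theorem of_pop {k : Port ⊕ WStack} {f : σ → Option (Alph A B k) → σ}
    (h : Function.update m.stk k (m.stk k).tail = m'.stk) :
    MRuns (.pop k f) s m 1 (f s (m.stk k).head?) m' := by
  rw [MRuns, ← h]
  exact Prog.runs_pop (s := (s, m.stk))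

theorem of_pushes {k : Port ⊕ WStack} {l : List (Alph A B k)}
    (h : Function.update m.stk k (l.reverse ++ m.stk k) = m'.stk) :
    MRuns (Prog.pushes k l) s m (l.length + 1) s m' := by
  rw [MRuns, ← h]
  exact Prog.runs_pushes k l (s, m.stk)

theorem loop_nil {k : Port ⊕ WStack} {body : Alph A B k → Prog (Alph A B) σ} (h : m.stk k = []) :
    MRuns (.loop k body) s m 1 s m := Prog.Runs.loop_nil h

theorem loop_cons {k : Port ⊕ WStack} {body : Alph A B k → Prog (Alph A B) σ} {a : Alph A B k}
    {l : List (Alph A B k)} {m₁ : Mem A B} (hk : m.stk k = a :: l)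
    (hl : Function.update m.stk k l = m₁.stk) (h : MRuns (body a) s m₁ t s' m')
    (h' : MRuns (.loop k body) s' m' t' s'' m'') :
    MRuns (.loop k body) s m (t + t' + 1) s'' m'' := by
  rw [MRuns, ← hl] at h
  exact Prog.Runs.loop_cons (s := (s, m.stk)) hk h h'

theorem pushBits {b : Bool} {f : σ → Bool} : MRuns (.push (.inr (.bits b)) f) s m 1 s
    (m.setBits b (f s :: m.bits b)) :=
  of_push (Mem.update_bits m b _)

theorem pushQuery {f : σ → B} : MRuns (.push (.inl .query) f) s m 1 s
    { m with query := f s :: m.query } :=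
  of_push (Mem.update_query m _)

theorem pushOutput {f : σ → Bool} : MRuns (.push (.inl .output) f) s m 1 s
    { m with output := f s :: m.output } :=
  of_push (Mem.update_output m _)

theorem popOutput {f : σ → Option Bool → σ} : MRuns (.pop (.inl .output) f) s m 1
    (f s m.output.head?) { m with output := m.output.tail } :=
  of_pop (Mem.update_output m _)

theorem popAnswer {f : σ → Option Bool → σ} : MRuns (.pop (.inl .answer) f) s m 1
    (f s m.answer.head?) { m with answer := m.answer.tail } :=
  of_pop (Mem.update_answer m _)

theorem pushWord {f : σ → B} : MRuns (.push (.inr .word) f) s m 1 s (m.addWord [f s]) :=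
  of_push (Mem.update_word m _)

theorem pushesWord {l : List B} : MRuns (Prog.pushes (.inr .word) l) s m (l.length + 1) s
    (m.addWord l.reverse) :=
  of_pushes (Mem.update_word m _)

theorem pushesQuery {l : List B} : MRuns (Prog.pushes (.inl .query) l) s m (l.length + 1) s
    { m with query := l.reverse ++ m.query } :=
  of_pushes (Mem.update_query m _)

theorem pushesQueryErr {k : ℕ} : MRuns (Prog.pushes (.inl .queryErr) (List.replicate k ())) s m
    (k + 1) s { m with queryErr := k + m.queryErr } := by
  have hstk : (List.replicate k ()).reverse ++ List.replicate m.queryErr () =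
      List.replicate (k + m.queryErr) () := by
    rw [List.reverse_replicate, List.replicate_add]
  exact (of_pushes ((congrArg (Function.update m.stk (.inl .queryErr)) hstk).trans
    (Mem.update_queryErr m _))).mono (congrArg (· + 1) (List.length_replicate (a := ()))).le

/-- A loop over a counter that the body does not change; `F i` is the memory after `i` rounds, up to
this counter. -/
theorem loopCtr {c : Ctr} {body : Unit → Prog (Alph A B) σ} (F : ℕ → Mem A B) {k : ℕ}
    (h : ∀ i < k, ∀ r, MRuns (body ()) s ((F i).setCtr c r) t s ((F (i + 1)).setCtr c r)) :
    MRuns (.loop (.inr (.ctr c)) body) s ((F 0).setCtr c k) (k * (t + 1) + 1) s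
      ((F k).setCtr c 0) := by
  induction k generalizing F with
  | zero => exact (loop_nil (by simp [Mem.stk, Mem.setCtr])).mono (by omega)
  | succ k ih =>
    have htail := ih (fun i => F (i + 1)) fun i hi => h (i + 1) (by omega)
    refine (loop_cons (k := .inr (.ctr c)) (a := ()) (l := List.replicate k ()) ?_ ?_
      (h 0 (by omega) k) htail).mono ?_
    · simp [Mem.stk, Mem.setCtr, List.replicate_succ]
    · rw [Mem.update_ctr, Mem.setCtr_setCtr]
    · rw [Nat.succ_mul]
      omega

theorem length_word_le (h : MRuns p s m t s' m') : m'.word.length ≤ m.word.length + t := by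
  obtain ⟨u, hu, h⟩ := h
  exact (h.length_le (.inr .word)).trans (Nat.add_le_add_left hu _)

end MRuns

section Counters

/-- Increment a counter. -/
def incr {A B σ : Type} (c : Ctr) : Prog (Alph A B) σ := .push (.inr (.ctr c)) fun _ => ()

theorem mRuns_incr {A B σ : Type} {c : Ctr} {s : σ} {m : Mem A B} :
    MRuns (incr c) s m 1 s (m.setCtr c (m.ctr c + 1)) :=
  MRuns.of_push (Mem.update_ctr m c (m.ctr c + 1))

/-- Values of the counters. -/
def ctrs (n base pred own var tmp cells : ℕ) : Ctr → ℕ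
  | .n => n
  | .base => base
  | .pred => pred
  | .own => own
  | .var => var
  | .tmp => tmp
  | .cells => cells

variable (n base pred own var tmp cells x : ℕ)

@[simp] theorem update_ctrs_n : Function.update (ctrs n base pred own var tmp cells) .n x =
    ctrs x base pred own var tmp cells := by
  funext c; cases c <;> rfl

@[simp] theorem update_ctrs_base : Function.update (ctrs n base pred own var tmp cells) .base x =
    ctrs n x pred own var tmp cells := by
  funext c; cases c <;> rfl

@[simp] theorem update_ctrs_pred : Function.update (ctrs n base pred own var tmp cells) .pred x =
    ctrs n base x own var tmp cells := by
  funext c; cases c <;> rfl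

@[simp] theorem update_ctrs_own : Function.update (ctrs n base pred own var tmp cells) .own x =
    ctrs n base pred x var tmp cells := by
  funext c; cases c <;> rfl

@[simp] theorem update_ctrs_var : Function.update (ctrs n base pred own var tmp cells) .var x =
    ctrs n base pred own x tmp cells := by
  funext c; cases c <;> rfl

@[simp] theorem update_ctrs_tmp : Function.update (ctrs n base pred own var tmp cells) .tmp x =
    ctrs n base pred own var x cells := by
  funext c; cases c <;> rfl

@[simp] theorem update_ctrs_cells : Function.update (ctrs n base pred own var tmp cells) .cells x =
    ctrs n base pred own var tmp x := by
  funext c; cases c <;> rfl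

end Counters

/-! ### Writing the query -/

section Emit

variable {A σ : Type} {Δ : ConstraintLanguage} (L : ℕ) {s : σ} {m : Mem A (Sym Δ)}

/-- Write `k` ticks. -/
def ticks (k : ℕ) : Prog (Alph A (Sym Δ)) σ :=
  Prog.pushes (.inr .word) (List.replicate k (.inl true))

theorem mRuns_ticks {k : ℕ} :
    MRuns (ticks k) s m (k + 1) s (m.addWord (List.replicate k (.inl true))) := by
  have h := MRuns.pushesWord (s := s) (m := m) (l := List.replicate k (.inl true : Sym Δ))
  rwa [List.reverse_replicate, List.length_replicate] at h

/-- Write `L` ticks for each unit of the counter `c`. The counter `tmp` serves to restore `c`. -/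
def dump (c : Ctr) : Prog (Alph A (Sym Δ)) σ :=
  .seq (.loop (.inr (.ctr c)) fun _ => .seq (incr .tmp) (ticks L))
    (.loop (.inr (.ctr .tmp)) fun _ => incr c)

theorem mRuns_dump {c : Ctr} (hc : c ≠ .tmp) (hm : m.ctr .tmp = 0) :
    MRuns (dump L c) s m (m.ctr c * (L + 5) + 2) s
      (m.addWord (List.replicate (m.ctr c * L) (.inl true))) := by
  have hwrite := MRuns.loopCtr (s := s) (c := c) (t := 1 + (L + 1)) (k := m.ctr c)
    (body := fun _ => .seq (incr .tmp) (ticks L))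
    (fun i => (m.addWord (List.replicate (i * L) (.inl true))).setCtr .tmp i) fun i _ r => by
      refine (mRuns_incr.seq mRuns_ticks).conv le_rfl ?_
      rw [Mem.ctr_setCtr_of_ne _ hc.symm, Mem.ctr_setCtr, Mem.addWord_setCtr, Mem.addWord_setCtr,
        Mem.addWord_setCtr, Mem.addWord_addWord, ← List.replicate_add, Mem.setCtr_comm _ hc,
        Mem.setCtr_setCtr, Nat.succ_mul, Nat.add_comm L]
  have hrestore := MRuns.loopCtr (s := s) (c := .tmp) (t := 1) (k := m.ctr c)
    (body := fun _ => (incr c : Prog (Alph A (Sym Δ)) σ))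
    (fun i => (m.addWord (List.replicate (m.ctr c * L) (.inl true))).setCtr c i) fun i _ r => by
      refine mRuns_incr.conv le_rfl ?_
      rw [Mem.ctr_setCtr_of_ne _ hc, Mem.ctr_setCtr, Mem.setCtr_comm _ hc.symm, Mem.setCtr_setCtr]
  rw [Nat.zero_mul, List.replicate_zero, Mem.addWord_nil, Mem.setCtr_eq_self hm,
    Mem.setCtr_eq_self rfl, Mem.setCtr_comm _ hc.symm] at hwrite
  refine (hwrite.seq hrestore).conv (by apply le_of_eq; ring) ?_
  rw [Mem.setCtr_eq_self (c := c) (x := m.ctr c) (by rfl)]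
  exact Mem.setCtr_eq_self hm

/-- Write the code of `x * L + off`, where `x` is the value of the counter `c`. -/
def emit (c : Ctr) (off : ℕ) : Prog (Alph A (Sym Δ)) σ :=
  .seq (dump L c) (Prog.pushes (.inr .word) (encodeNum Δ off))

theorem length_encodeNum (Γ : ConstraintLanguage) (k : ℕ) : (encodeNum Γ k).length = k + 1 := by
  simp [encodeNum]

theorem reverse_encodeNum_append (a b : ℕ) :
    (encodeNum Δ b).reverse ++ List.replicate a (.inl true) = (encodeNum Δ (a + b)).reverse := by
  simp only [encodeNum, List.reverse_append, List.reverse_replicate, List.append_assoc,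
    ← List.replicate_add, Nat.add_comm]

theorem mRuns_emit {c : Ctr} (hc : c ≠ .tmp) {off : ℕ} (hm : m.ctr .tmp = 0) :
    MRuns (emit L c off) s m (m.ctr c * (L + 5) + off + 4) s
      (m.addWord (encodeNum Δ (m.ctr c * L + off)).reverse) := by
  refine ((mRuns_dump L hc hm).seq MRuns.pushesWord).conv ?_ ?_
  · rw [length_encodeNum]
    omega
  · rw [Mem.addWord_addWord, reverse_encodeNum_append]

/-- Write the code of the scope of a constraint of a template. -/
def emitScope : List (Bool × ℕ) → Prog (Alph A (Sym Δ)) σ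
  | [] => Prog.skip
  | y :: l => .seq (emit L (cond y.1 .pred .own) y.2) (emitScope l)

theorem mRuns_emitScope (l : List (Bool × ℕ)) : ∃ K : ℕ, ∀ (s : σ) (m : Mem A (Sym Δ)) (M : ℕ),
    m.ctr .tmp = 0 → m.ctr .own ≤ M → m.ctr .pred ≤ M →
    MRuns (emitScope L l) s m (K * (M + 1)) s (m.addWord (l.flatMap fun y =>
      encodeNum Δ (cond y.1 (m.ctr .pred) (m.ctr .own) * L + y.2)).reverse) := by
  induction l with
  | nil => exact ⟨1, fun s m M _ _ _ => MRuns.skip.mono (by omega)⟩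
  | cons y l ih =>
    obtain ⟨K, hK⟩ := ih
    refine ⟨L + 5 + y.2 + 4 + K, fun s m M htmp hown hpred => ?_⟩
    have hc : (cond y.1 .pred .own : Ctr) ≠ .tmp := by cases y.1 <;> simp
    have hM : m.ctr (cond y.1 .pred .own) ≤ M := by cases y.1 <;> assumption
    refine ((mRuns_emit L hc htmp).seq (hK s _ M htmp hown hpred)).conv ?_ ?_
    · calc _ ≤ M * (L + 5) + y.2 + 4 + K * (M + 1) := by gcongr
        _ ≤ _ := by nlinarith
    · rw [Mem.addWord_addWord, ← List.reverse_append, List.flatMap_cons]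
      cases y.1 <;> rfl

/-- Write the code of a constraint of a template. -/
def emitConstraint (c : ConstraintOn Δ (Bool × ℕ)) : Prog (Alph A (Sym Δ)) σ :=
  .seq (.push (.inr .word) fun _ => .inr c.1) (emitScope L (List.ofFn c.2))

/-- Write the code of the constraints given by a template, for the cell `own` with predecessor
`pred`. -/
def emitCell : List (ConstraintOn Δ (Bool × ℕ)) → Prog (Alph A (Sym Δ)) σ
  | [] => Prog.skip
  | c :: τ => .seq (emitConstraint L c) (emitCell τ)

theorem mRuns_emitConstraint (c : ConstraintOn Δ (Bool × ℕ)) : ∃ K : ℕ, ∀ (s : σ)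
    (m : Mem A (Sym Δ)) (M : ℕ), m.ctr .tmp = 0 → m.ctr .own ≤ M → m.ctr .pred ≤ M →
    MRuns (emitConstraint L c) s m (K * (M + 1)) s (m.addWord (encodeNatConstraint (c.map fun y =>
      cond y.1 (m.ctr .pred) (m.ctr .own) * L + y.2)).reverse) := by
  obtain ⟨K, hK⟩ := mRuns_emitScope (A := A) (σ := σ) (Δ := Δ) L (List.ofFn c.2)
  refine ⟨K + 1, fun s m M htmp hown hpred => ?_⟩
  refine (MRuns.pushWord.seq (hK s (m.addWord [.inr c.1]) M htmp hown hpred)).conv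
    (by nlinarith) ?_
  have hscope : List.ofFn (c.map fun y => cond y.1 (m.ctr .pred) (m.ctr .own) * L + y.2).2 =
      (List.ofFn c.2).map fun y => cond y.1 (m.ctr .pred) (m.ctr .own) * L + y.2 := by
    rw [List.map_ofFn]
    rfl
  rw [Mem.addWord_addWord, encodeNatConstraint, hscope, List.flatMap_map, List.reverse_cons]
  rfl

theorem mRuns_emitCell (τ : List (ConstraintOn Δ (Bool × ℕ))) : ∃ K : ℕ, ∀ (s : σ)
    (m : Mem A (Sym Δ)) (M : ℕ), m.ctr .tmp = 0 → m.ctr .own ≤ M → m.ctr .pred ≤ M →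
    MRuns (emitCell L τ) s m (K * (M + 1)) s
      (m.addWord (cellCode L τ (m.ctr .own) (m.ctr .pred)).reverse) := by
  induction τ with
  | nil => exact ⟨1, fun s m M _ _ _ => MRuns.skip.mono (by omega)⟩
  | cons c τ ih =>
    obtain ⟨K, hK⟩ := ih
    obtain ⟨K', hK'⟩ := mRuns_emitConstraint (A := A) (σ := σ) L c
    refine ⟨K' + K, fun s m M htmp hown hpred => ?_⟩
    have h := (hK' s m M htmp hown hpred).seq (hK s _ M htmp hown hpred)
    rw [← Nat.add_mul, Mem.addWord_addWord, ← List.reverse_append] at h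
    exact h

end Emit

/-! ### Reading the given instance -/

section Scan

variable {Γ Δ : ConstraintLanguage} (hΓ : Γ ⊆ Δ) (L o : ℕ)

/-- Contents of the stacks while the query is prepared. -/
def prepMem (inp : List (Sym Γ)) (N : ℕ) (wd : List (Sym Δ)) (c : Ctr → ℕ) :
    Mem (Sym Γ) (Sym Δ) where
  input := inp
  inputErr := N
  word := wd
  ctr := c

@[simp] theorem setCtr_prepMem (inp : List (Sym Γ)) (N : ℕ) (wd : List (Sym Δ)) (c : Ctr → ℕ)
    (k : Ctr) (x : ℕ) :
    (prepMem inp N wd c).setCtr k x = prepMem inp N wd (Function.update c k x) := rfl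

@[simp] theorem ctr_prepMem (inp : List (Sym Γ)) (N : ℕ) (wd : List (Sym Δ)) (c : Ctr → ℕ) :
    (prepMem inp N wd c).ctr = c := rfl

@[simp] theorem addWord_prepMem (inp : List (Sym Γ)) (N : ℕ) (wd l : List (Sym Δ)) (c : Ctr → ℕ) :
    (prepMem inp N wd c).addWord l = prepMem inp N (l ++ wd) c := rfl

section Occurrences

variable {σ : Type} (s : σ) (inp : List (Sym Γ)) (N : ℕ) (wd : List (Sym Δ)) (n b v : ℕ)

/-- Increase the number of the first cell of the current layer by `n`. The copy of this number in
the counter `pred` is not changed by `dump`. -/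
def nextLayer : Prog (Alph (Sym Γ) (Sym Δ)) σ :=
  .seq (.loop (.inr (.ctr .n)) fun _ => .seq (incr .tmp) (.seq (incr .base) (incr .pred)))
    (.loop (.inr (.ctr .tmp)) fun _ => incr .n)

theorem mRuns_nextLayer :
    MRuns nextLayer s (prepMem inp N wd (ctrs n b b 0 v 0 0)) (6 * n + 2) s
      (prepMem inp N wd (ctrs n (b + n) (b + n) 0 v 0 0)) := by
  have hadd := MRuns.loopCtr (s := s) (c := .n) (t := 3) (k := n)
    (body := fun _ => .seq (incr .tmp) (.seq (incr .base) (incr .pred)))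
    (fun i => prepMem inp N wd (ctrs n (b + i) (b + i) 0 v i 0)) fun i _ r => by
      refine (mRuns_incr.seq (mRuns_incr.seq mRuns_incr)).conv le_rfl ?_
      simp [ctrs, Nat.add_assoc]
  have hrestore := MRuns.loopCtr (s := s) (c := .tmp) (t := 1) (k := n) (body := fun _ => incr .n)
    (fun i => prepMem inp N wd (ctrs i (b + n) (b + n) 0 v n 0)) fun i _ r => by
      refine mRuns_incr.conv le_rfl ?_
      simp [ctrs]
  simp only [setCtr_prepMem, update_ctrs_n, update_ctrs_tmp, Nat.add_zero] at hadd hrestore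
  exact (hadd.seq hrestore).mono (by omega)

/-- Write the variable that replaces an occurrence of the variable `var` in the current layer. -/
def writeOccurrence : Prog (Alph (Sym Γ) (Sym Δ)) σ :=
  .seq (dump L .base)
    (.seq (.loop (.inr (.ctr .var)) fun _ => ticks L)
      (Prog.pushes (.inr .word) (encodeNum Δ o)))

theorem mRuns_writeOccurrence :
    MRuns (writeOccurrence L o) s (prepMem inp N wd (ctrs n b b 0 v 0 0))
      ((b + v) * (L + 5) + o + 5) s
      (prepMem inp N ((encodeNum Δ ((b + v) * L + o)).reverse ++ wd) (ctrs n b b 0 0 0 0)) := by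
  have hbase := mRuns_dump (s := s) L (c := .base) (by simp)
    (m := prepMem inp N wd (ctrs n b b 0 v 0 0)) rfl
  have hvar := MRuns.loopCtr (s := s) (c := .var) (t := L + 1) (k := v) (body := fun _ => ticks L)
    (fun i => prepMem inp N (List.replicate (i * L) (.inl true) ++
      (List.replicate (b * L) (.inl true) ++ wd)) (ctrs n b b 0 v 0 0)) fun i _ r => by
      refine mRuns_ticks.conv le_rfl ?_
      rw [setCtr_prepMem, setCtr_prepMem, addWord_prepMem, ← List.append_assoc,
        ← List.replicate_add, Nat.succ_mul, Nat.add_comm L]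
  simp only [setCtr_prepMem, update_ctrs_var, addWord_prepMem, ctr_prepMem, Nat.zero_mul,
    List.replicate_zero, List.nil_append] at hbase hvar
  refine (hbase.seq (hvar.seq MRuns.pushesWord)).conv ?_ ?_
  · rw [length_encodeNum]
    simp only [ctrs]
    nlinarith
  · rw [addWord_prepMem, ← List.append_assoc (List.replicate _ _), ← List.replicate_add,
      ← List.append_assoc, reverse_encodeNum_append, ← Nat.add_mul, Nat.add_comm v]

end Occurrences

/-- Process a symbol of the given instance. The first component of the store is `true` while the
number of variables is being read. -/
def scanSymbol {σ : Type} (a : Sym Γ) : Prog (Alph (Sym Γ) (Sym Δ)) (Bool × σ) :=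
  match a with
  | .inl true => .ite Prod.fst (.seq (incr .n) (.seq (incr .base) (incr .pred))) (incr .var)
  | .inl false => .ite Prod.fst (.load fun s => (false, s.2)) (.seq nextLayer (writeOccurrence L o))
  | .inr R => .push (.inr .word) fun _ => .inr ⟨R.1, hΓ R.2⟩

/-- Read the given instance and write the constraints with the replaced occurrences. -/
def scan {σ : Type} : Prog (Alph (Sym Γ) (Sym Δ)) (Bool × σ) :=
  .loop (.inl .input) (scanSymbol hΓ L o)

variable {σ : Type} {r : σ} {N : ℕ} {s' : Bool × σ} {m' : Mem (Sym Γ) (Sym Δ)}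
  {inp : List (Sym Γ)} {t D M n : ℕ}

theorem mRuns_scan_cons {s s₁ : Bool × σ} {a : Sym Γ} {wd : List (Sym Δ)} {c : Ctr → ℕ}
    {m₁ : Mem (Sym Γ) (Sym Δ)} {t' : ℕ}
    (h : MRuns (scanSymbol hΓ L o a) s (prepMem inp N wd c) t s₁ m₁)
    (h' : MRuns (scan hΓ L o) s₁ m₁ t' s' m') (ht : t + 1 ≤ D) :
    MRuns (scan hΓ L o) s (prepMem (a :: inp) N wd c) (D + t') s' m' :=
  (MRuns.loop_cons (k := .inl .input) (a := a) rfl (Mem.update_input _ _) h h').mono (by omega)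

theorem mRuns_scan_header {wd : List (Sym Δ)} (hD : 5 ≤ D) (n k : ℕ)
    (h : MRuns (scan hΓ L o) (false, r) (prepMem inp N wd (ctrs (k + n) (k + n) (k + n) 0 0 0 0)) t
      s' m') :
    MRuns (scan hΓ L o) (true, r) (prepMem (encodeNum Γ n ++ inp) N wd (ctrs k k k 0 0 0 0))
      ((n + 1) * D + t) s' m' := by
  induction n generalizing k with
  | zero =>
    exact (mRuns_scan_cons (D := D) (a := .inl false) hΓ L o (MRuns.ite_true rfl MRuns.load) h
      (by omega)).mono (by omega)
  | succ n ih =>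
    have hrest := ih (k + 1) (by rwa [Nat.add_assoc, Nat.add_comm 1 n])
    have htick : MRuns (scanSymbol hΓ L o (.inl true)) (true, r)
        (prepMem (encodeNum Γ n ++ inp) N wd (ctrs k k k 0 0 0 0)) 4 (true, r)
        (prepMem (encodeNum Γ n ++ inp) N wd (ctrs (k + 1) (k + 1) (k + 1) 0 0 0 0)) := by
      refine MRuns.ite_true rfl ((mRuns_incr.seq (mRuns_incr.seq mRuns_incr)).conv le_rfl ?_)
      simp [ctrs]
    refine (mRuns_scan_cons hΓ L o htick hrest hD).mono ?_
    rw [Nat.add_mul (n + 1)]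
    omega

theorem mRuns_scan_num {wd : List (Sym Δ)} {b : ℕ} (v k : ℕ) (hM : b + n + (k + v) ≤ M)
    (hD : M * (L + 11) + o + 9 ≤ D)
    (h : MRuns (scan hΓ L o) (false, r) (prepMem inp N
      ((encodeNum Δ ((b + n + (k + v)) * L + o)).reverse ++ wd)
        (ctrs n (b + n) (b + n) 0 0 0 0)) t s' m') :
    MRuns (scan hΓ L o) (false, r) (prepMem (encodeNum Γ v ++ inp) N wd (ctrs n b b 0 k 0 0))
      ((v + 1) * D + t) s' m' := by
  induction v generalizing k with
  | zero =>
    have hocc := MRuns.ite_false (c := Prod.fst) (p := .load fun s => (false, s.2)) rfl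
      ((mRuns_nextLayer ((false, r) : Bool × σ) inp N wd n b k).seq
        (mRuns_writeOccurrence L o _ inp N wd n (b + n) k))
    refine (mRuns_scan_cons (D := D) (a := .inl false) hΓ L o hocc h ?_).mono (by omega)
    nlinarith
  | succ v ih =>
    have hrest := ih (k + 1) (by omega) (by rwa [Nat.add_assoc k 1, Nat.add_comm 1 v])
    have htick : MRuns (scanSymbol hΓ L o (.inl true)) (false, r)
        (prepMem (encodeNum Γ v ++ inp) N wd (ctrs n b b 0 k 0 0)) 2 (false, r)
        (prepMem (encodeNum Γ v ++ inp) N wd (ctrs n b b 0 (k + 1) 0 0)) := by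
      refine MRuns.ite_false rfl (mRuns_incr.conv le_rfl ?_)
      simp [ctrs]
    refine (mRuns_scan_cons (D := D) hΓ L o htick hrest (by omega)).mono ?_
    rw [Nat.add_mul (v + 1)]
    omega

theorem mRuns_scan_scope (hD : M * (L + 11) + o + 9 ≤ D) (vs : List (Fin n)) (k : ℕ)
    (wd : List (Sym Δ)) (hM : (k + vs.length + 1) * n ≤ M)
    (h : MRuns (scan hΓ L o) (false, r) (prepMem inp N ((scopeCode Δ L o (k + 1) vs).reverse ++ wd)
        (ctrs n ((k + vs.length) * n) ((k + vs.length) * n) 0 0 0 0)) t s' m') :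
    MRuns (scan hΓ L o) (false, r)
      (prepMem ((vs.flatMap fun v : Fin n => encodeNum Γ (v : ℕ)) ++ inp) N wd
        (ctrs n (k * n) (k * n) 0 0 0 0))
      ((vs.flatMap fun v : Fin n => encodeNum Γ (v : ℕ)).length * D + t) s' m' := by
  induction vs generalizing k wd with
  | nil => simpa [scopeCode] using h
  | cons v vs ih =>
    have hlen : k + (v :: vs).length = k + 1 + vs.length := by
      rw [List.length_cons]
      omega
    rw [hlen] at h hM
    have hlt : k * n + n + (0 + v) ≤ M := by
      have hv := v.2
      have : (k + 2) * n ≤ M := le_trans (Nat.mul_le_mul_right n (by omega)) hM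
      nlinarith
    have hrest := ih (k + 1) ((encodeNum Δ ((k * n + n + (0 + v)) * L + o)).reverse ++ wd) hM (by
      rwa [scopeCode_cons, List.reverse_append, List.append_assoc, Nat.succ_mul,
        ← Nat.zero_add (v : ℕ)] at h)
    rw [Nat.succ_mul] at hrest
    rw [List.flatMap_cons, List.append_assoc]
    refine (mRuns_scan_num hΓ L o (v : ℕ) 0 hlt hD hrest).mono (le_of_eq ?_)
    rw [List.length_append, length_encodeNum]
    ring

theorem mRuns_scan_constraints (hD : M * (L + 11) + o + 9 ≤ D) (cs : List (Constraint Γ n))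
    (k : ℕ) (wd : List (Sym Δ)) (hM : (k + (occurrences cs).length + 1) * n ≤ M)
    (h : MRuns (scan hΓ L o) (false, r) (prepMem [] N ((occCode hΓ L o (k + 1) cs).reverse ++ wd)
        (ctrs n ((k + (occurrences cs).length) * n) ((k + (occurrences cs).length) * n) 0 0 0 0)) t
      s' m') :
    MRuns (scan hΓ L o) (false, r)
      (prepMem (cs.flatMap encodeConstraint) N wd (ctrs n (k * n) (k * n) 0 0 0 0))
      ((cs.flatMap encodeConstraint).length * D + t) s' m' := by
  induction cs generalizing k wd with
  | nil => simpa [occCode, number, occurrences] using h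
  | cons c cs ih =>
    have hlen : k + (occurrences (c :: cs)).length =
        k + (List.ofFn c.2).length + (occurrences cs).length := by
      simp [occurrences, Nat.add_assoc]
    rw [hlen] at h hM
    have hrest := ih (k + (List.ofFn c.2).length)
      ((scopeCode Δ L o (k + 1) (List.ofFn c.2)).reverse ++ (.inr ⟨c.1.1, hΓ c.1.2⟩ :: wd)) hM (by
        rw [occCode_cons, List.cons_append, List.reverse_cons, List.reverse_append] at h
        simpa [Nat.add_right_comm] using h)
    have hscope := mRuns_scan_scope hΓ L o hD (List.ofFn c.2) k (.inr ⟨c.1.1, hΓ c.1.2⟩ :: wd)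
      (le_trans (Nat.mul_le_mul_right n (by omega)) hM) hrest
    have hcode : encodeConstraint c =
        .inr c.1 :: (List.ofFn c.2).flatMap fun v : Fin n => encodeNum Γ (v : ℕ) := by
      rw [encodeConstraint_eq, encodeNatConstraint, ← List.flatMap_map (f := Fin.val)
        (g := encodeNum Γ), List.map_ofFn]
      rfl
    rw [List.flatMap_cons, hcode, List.cons_append]
    refine (mRuns_scan_cons (D := D) hΓ L o (a := .inr c.1) MRuns.pushWord hscope (by omega)).mono
      (le_of_eq ?_)
    simp only [List.length_append, List.length_cons]
    ring

theorem mRuns_scan (I : CSPInstance Γ)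
    (hD : numCells I * (L + 11) + o + 9 ≤ D) :
    MRuns (scan hΓ L o) (true, r) (prepMem I.encode N [] (ctrs 0 0 0 0 0 0 0))
      (I.encode.length * D + 1) (false, r) (prepMem [] N (occCode hΓ L o 2 I.constraints).reverse
        (ctrs I.numVars (((occurrences I.constraints).length + 1) * I.numVars)
          (((occurrences I.constraints).length + 1) * I.numVars) 0 0 0 0)) := by
  have hend : MRuns (scan hΓ L o) (false, r)
      (prepMem [] N ((occCode hΓ L o 2 I.constraints).reverse ++ [])
        (ctrs I.numVars ((1 + (occurrences I.constraints).length) * I.numVars)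
          ((1 + (occurrences I.constraints).length) * I.numVars) 0 0 0 0)) 1 _ _ :=
    MRuns.loop_nil rfl
  have hconstraints := mRuns_scan_constraints hΓ L o hD I.constraints 1 []
    (Nat.mul_le_mul_right _ (by omega)) hend
  rw [List.append_nil, Nat.one_mul, Nat.add_comm 1 (occurrences _).length] at hconstraints
  refine (mRuns_scan_header (D := D) hΓ L o (by omega) I.numVars 0
    (by rwa [Nat.zero_add])).mono (le_of_eq ?_)
  rw [CSPInstance.encode, List.length_append, length_encodeNum]
  ring

end Scan

/-! ### The computation before the oracle call -/

section Cells

variable {Γ Δ : ConstraintLanguage} {σ : Type} (L : ℕ) (τ : List (ConstraintOn Δ (Bool × ℕ)))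

/-- Write the constraints of one cell and go to the next one. -/
def nextCell : Prog (Alph (Sym Γ) (Sym Δ)) σ :=
  .seq (emitCell L τ) (.seq (incr .own) (incr .pred))

/-- Write the constraints of all cells. The predecessors of the cells of the first layer lie in the
last one, hence the two loops. -/
def emitCells : Prog (Alph (Sym Γ) (Sym Δ)) σ :=
  .seq (.loop (.inr (.ctr .n)) fun _ => nextCell L τ)
    (.seq (.loop (.inr (.ctr .pred)) fun _ => Prog.skip)
      (.loop (.inr (.ctr .base)) fun _ => nextCell L τ))

theorem mRuns_nextCell : ∃ K : ℕ, ∀ (s : σ) (N : ℕ) (wd : List (Sym Δ)) (n b own pred M : ℕ),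
    own ≤ M → pred ≤ M →
    MRuns (nextCell (Γ := Γ) L τ) s (prepMem [] N wd (ctrs n b pred own 0 0 0)) (K * (M + 1) + 2) s
      (prepMem [] N ((cellCode L τ own pred).reverse ++ wd)
        (ctrs n b (pred + 1) (own + 1) 0 0 0)) := by
  obtain ⟨K, hK⟩ := mRuns_emitCell (A := Sym Γ) (σ := σ) L τ
  refine ⟨K, fun s N wd n b own pred M hown hpred => ?_⟩
  refine ((hK s (prepMem [] N wd (ctrs n b pred own 0 0 0)) M rfl hown hpred).seq
    (mRuns_incr.seq mRuns_incr)).conv le_rfl ?_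
  simp [ctrs]

theorem mRuns_emitCells : ∃ K : ℕ, ∀ (s : σ) (N : ℕ) (wd : List (Sym Δ)) (n b : ℕ),
    MRuns (emitCells (Γ := Γ) L τ) s (prepMem [] N wd (ctrs n b b 0 0 0 0))
      ((n + b) * (K * (n + b + 1) + 5) + 3) s
      (prepMem [] N (((List.range n).flatMap (fun p => cellCode L τ p (p + b)) ++
        (List.range b).flatMap (fun p => cellCode L τ (n + p) p)).reverse ++ wd)
        (ctrs 0 0 b (n + b) 0 0 0)) := by
  obtain ⟨K, hK⟩ := mRuns_nextCell (Γ := Γ) (σ := σ) L τ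
  refine ⟨K, fun s N wd n b => ?_⟩
  let code₁ (i : ℕ) := (List.range i).flatMap fun p => cellCode L τ p (p + b)
  let code₂ (i : ℕ) := (List.range i).flatMap fun p => cellCode L τ (n + p) p
  have hfirst := MRuns.loopCtr (s := s) (c := .n) (t := K * (n + b + 1) + 2) (k := n)
    (body := fun _ => nextCell L τ)
    (fun i => prepMem (Γ := Γ) [] N ((code₁ i).reverse ++ wd) (ctrs n b (i + b) i 0 0 0))
    fun i hi r => by
      simp only [setCtr_prepMem, update_ctrs_n]
      refine (hK s N _ r b i (i + b) (n + b) (by omega) (by omega)).conv le_rfl ?_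
      simp [code₁, List.range_succ, Nat.add_right_comm]
  have hclear := MRuns.loopCtr (s := s) (c := .pred) (t := 1) (k := n + b)
    (body := fun _ => Prog.skip)
    (fun _ => prepMem (Γ := Γ) [] N ((code₁ n).reverse ++ wd) (ctrs 0 b (n + b) n 0 0 0))
    fun _ _ _ => MRuns.skip
  have hrest := MRuns.loopCtr (s := s) (c := .base) (t := K * (n + b + 1) + 2) (k := b)
    (body := fun _ => nextCell L τ)
    (fun i => prepMem (Γ := Γ) [] N ((code₂ i).reverse ++ ((code₁ n).reverse ++ wd))
      (ctrs 0 b i (n + i) 0 0 0)) fun i hi r => by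
      simp only [setCtr_prepMem, update_ctrs_base]
      refine (hK s N _ 0 r (n + i) i (n + b) (by omega) (by omega)).conv le_rfl ?_
      simp [code₂, List.range_succ, ← Nat.add_assoc]
  simp only [setCtr_prepMem, update_ctrs_n, update_ctrs_pred, update_ctrs_base, code₁, code₂,
    List.range_zero, List.flatMap_nil, List.reverse_nil, List.nil_append, Nat.add_zero,
    Nat.zero_add] at hfirst hclear hrest
  refine (hfirst.seq (hclear.seq hrest)).conv (by nlinarith) ?_
  rw [List.reverse_append, List.append_assoc]

end Cells

section FinishQuery

variable {Γ Δ : ConstraintLanguage} {σ : Type} (L : ℕ)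

/-- Move the content of the stack `word` to the query. -/
def moveWord {A B σ : Type} : Prog (Alph A B) σ :=
  .loop (.inr .word) fun a => .push (.inl .query) fun _ => a

theorem mRuns_moveWord {A B σ : Type} {s : σ} {m : Mem A B} :
    MRuns moveWord s m (2 * m.word.length + 1) s
      { m with word := [], query := m.word.reverse ++ m.query } := by
  obtain ⟨l, hl⟩ : ∃ l, m.word = l := ⟨_, rfl⟩
  induction l generalizing m with
  | nil =>
    refine (MRuns.loop_nil (k := .inr .word) hl).conv (by omega) ?_
    cases m
    simp_all
  | cons a l ih =>
    refine (MRuns.loop_cons (k := .inr .word) (a := a) (l := l) hl (Mem.update_word _ _)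
      MRuns.pushQuery (ih (m := { m with word := l, query := a :: m.query }) rfl)).conv ?_ ?_
    · simp only [hl, List.length_cons]
      omega
    · simp [hl]

/-- Multiply the reciprocal of the error bound by `8`. -/
def scaleErr {A B σ : Type} : Prog (Alph A B) σ :=
  .loop (.inl .inputErr) fun _ => Prog.pushes (.inl .queryErr) (List.replicate 8 ())

theorem mRuns_scaleErr {A B σ : Type} {s : σ} {m : Mem A B} :
    MRuns scaleErr s m (10 * m.inputErr + 1) s
      { m with inputErr := 0, queryErr := 8 * m.inputErr + m.queryErr } := by
  obtain ⟨k, hk⟩ : ∃ k, m.inputErr = k := ⟨_, rfl⟩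
  induction k generalizing m with
  | zero =>
    refine (MRuns.loop_nil (k := .inl .inputErr) (by simp [Mem.stk, hk])).conv (by omega) ?_
    cases m
    simp_all
  | succ k ih =>
    refine (MRuns.loop_cons (k := .inl .inputErr) (a := ()) (l := List.replicate k ())
      (by simp [Mem.stk, hk, List.replicate_succ]) (Mem.update_inputErr _ _) MRuns.pushesQueryErr
      (ih (m := { m with inputErr := k, queryErr := 8 + m.queryErr }) rfl)).conv ?_ ?_
    · simp only [hk]
      omega
    · simp only [hk, Mem.mk.injEq, true_and, and_true]
      omega

/-- Contents of the stacks while the query is completed. -/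
def queryMem (N : ℕ) (q : List (Sym Δ)) (e : ℕ) (c : Ctr → ℕ) : Mem (Sym Γ) (Sym Δ) where
  inputErr := N
  query := q
  queryErr := e
  ctr := c

theorem setCtr_queryMem (N : ℕ) (q : List (Sym Δ)) (e : ℕ) (c : Ctr → ℕ) (k : Ctr) (x : ℕ) :
    (queryMem (Γ := Γ) N q e c).setCtr k x = queryMem N q e (Function.update c k x) := rfl

/-- Prepend the code of the number of variables, `L` for each cell, to the query. The number of
cells is kept in the counters `tmp` and `cells`. -/
def writeNumVars : Prog (Alph (Sym Γ) (Sym Δ)) σ :=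
  .seq (.push (.inl .query) fun _ => .inl false)
    (.loop (.inr (.ctr .own)) fun _ => .seq (incr .tmp) (.seq (incr .cells)
      (Prog.pushes (.inl .query) (List.replicate L (.inl true)))))

theorem mRuns_writeNumVars (s : σ) (N : ℕ) (q : List (Sym Δ)) (b P : ℕ) :
    MRuns (writeNumVars (Γ := Γ) L) s (queryMem N q 0 (ctrs 0 0 b P 0 0 0)) (P * (L + 4) + 2) s
      (queryMem N (encodeNum Δ (P * L) ++ q) 0 (ctrs 0 0 b 0 0 P P)) := by
  have hloop := MRuns.loopCtr (s := s) (c := .own) (t := 1 + (1 + (L + 1))) (k := P)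
    (body := fun _ => .seq (incr .tmp) (.seq (incr .cells)
      (Prog.pushes (.inl .query) (List.replicate L (.inl true)))))
    (fun i => queryMem (Γ := Γ) N (List.replicate (i * L) (.inl true) ++ .inl false :: q) 0
      (ctrs 0 0 b P 0 i i)) fun i _ r => by
      refine (mRuns_incr.seq (mRuns_incr.seq MRuns.pushesQuery)).conv (by simp) ?_
      rw [Nat.succ_mul, Nat.add_comm (i * L), List.replicate_add, List.append_assoc]
      simp [queryMem, Mem.setCtr, ctrs]
  simp only [setCtr_queryMem, update_ctrs_own, Nat.zero_mul, List.replicate_zero,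
    List.nil_append] at hloop
  refine (MRuns.pushQuery.seq hloop).conv (by apply le_of_eq; ring) ?_
  rw [encodeNum, List.append_assoc, List.singleton_append]

/-- Complete the query by the number of variables and the error bound. -/
def finishQuery : Prog (Alph (Sym Γ) (Sym Δ)) σ := .seq moveWord (.seq (writeNumVars L) scaleErr)

theorem mRuns_finishQuery (s : σ) (N : ℕ) (wd : List (Sym Δ)) (b P : ℕ) :
    MRuns (finishQuery (Γ := Γ) L) s (prepMem [] N wd (ctrs 0 0 b P 0 0 0))
      (2 * wd.length + P * (L + 4) + 10 * N + 4) s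
      (queryMem 0 (encodeNum Δ (P * L) ++ wd.reverse) (8 * N) (ctrs 0 0 b 0 0 P P)) := by
  have hmove := mRuns_moveWord (s := s) (m := prepMem (Γ := Γ) [] N wd (ctrs 0 0 b P 0 0 0))
  simp only [prepMem, List.append_nil] at hmove
  refine (hmove.seq ((mRuns_writeNumVars L s N wd.reverse b P).seq mRuns_scaleErr)).mono ?_
  simp only [queryMem]
  omega

end FinishQuery

section Prepare

variable {Γ Δ : ConstraintLanguage} {d : ℕ} {σ : Type} (hΓ : Γ ⊆ Δ) (H : Gadget Δ d 2)
  (G : Gadget Δ d (2 * H.entries + 2))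

/-- Write the query for the given instance. -/
def prepare : Prog (Alph (Sym Γ) (Sym Δ)) (Bool × σ) :=
  .seq (.seq (scan hΓ (H.numVars * G.numVars) (2 * H.entries))
    (emitCells (H.numVars * G.numVars) (template H G))) (finishQuery (H.numVars * G.numVars))

/-- A bound for the run-time of `prepare` on an input of length `ℓ` with `P` cells; every cell has
`L` variables, the offset of the ports that replace occurrences is `o`, and `K` accounts for the
constraints of a cell. -/
def prepareTime (L o K ℓ P N : ℕ) : ℕ :=
  3 * (ℓ * (P * (L + 11) + o + 9) + P * (K * (P + 1) + 5) + 4) + P * (L + 4) + 10 * N + 4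

theorem mRuns_prepare : ∃ K : ℕ, ∀ (I : CSPInstance Γ) (N : ℕ) (r : σ), ∃ b : ℕ,
    MRuns (prepare hΓ H G) (true, r) (prepMem I.encode N [] (ctrs 0 0 0 0 0 0 0))
      (prepareTime (H.numVars * G.numVars) (2 * H.entries) K I.encode.length (numCells I) N)
      (false, r) (queryMem 0 (boundedInstance hΓ H G I).encode (8 * N)
        (ctrs 0 0 b 0 0 (numCells I) (numCells I))) := by
  obtain ⟨K, hK⟩ := mRuns_emitCells (Γ := Γ) (σ := Bool × σ) (H.numVars * G.numVars) (template H G)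
  refine ⟨K, fun I N r => ⟨((occurrences I.constraints).length + 1) * I.numVars, ?_⟩⟩
  have hcells : I.numVars + ((occurrences I.constraints).length + 1) * I.numVars = numCells I := by
    rw [numCells]
    ring
  have hwrite := (mRuns_scan (r := r) (N := N) hΓ (H.numVars * G.numVars) (2 * H.entries) I
    le_rfl).seq (hK (false, r) N _ _ _)
  have hword := hwrite.length_word_le
  rw [hcells] at hwrite hword
  refine (hwrite.seq (mRuns_finishQuery _ _ _ _ _ _)).conv ?_ ?_
  · simp only [prepMem, List.length_nil] at hword
    rw [prepareTime]
    omega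
  · rw [boundedInstance_encode, List.reverse_append, List.reverse_reverse, List.reverse_reverse]

end Prepare

/-! ### Binary arithmetic on stacks -/

section Digits

/-- The number with the given binary digits, the least significant one first. -/
def ofBits (l : List Bool) : ℕ := List.foldr Nat.bit 0 l

theorem ofBits_cons (b : Bool) (l : List Bool) : ofBits (b :: l) = 2 * ofBits l + b.toNat :=
  Nat.bit_val b _

theorem ofBits_append (l l' : List Bool) :
    ofBits (l ++ l') = ofBits l + 2 ^ l.length * ofBits l' := by
  induction l with
  | nil => simp [ofBits]
  | cons b l ih =>
    rw [List.cons_append, ofBits_cons, ofBits_cons, ih, List.length_cons]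
    ring

theorem ofBits_tail (l : List Bool) : ofBits l.tail = ofBits l / 2 := by
  cases l with
  | nil => rfl
  | cons b l =>
    rw [List.tail_cons, ofBits_cons]
    have := b.toNat_le
    omega

theorem ofBits_bits (Y : ℕ) : ofBits (Nat.bits Y) = Y := by
  induction Y using Nat.binaryRec' with
  | zero => rfl
  | bit b n h ih => rw [Nat.bits_append_bit n b h, ofBits_cons, ih, Nat.bit_val]

/-- The first `k` elements of a list of digits, padded with zeros. -/
def firstDigits (l : List Bool) (k : ℕ) : List Bool := (List.range k).map fun i => l.getD i false

theorem length_firstDigits (l : List Bool) (k : ℕ) : (firstDigits l k).length = k := by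
  simp [firstDigits]

theorem reverse_firstDigits_succ (l : List Bool) (k : ℕ) :
    (firstDigits l (k + 1)).reverse = l.getD k false :: (firstDigits l k).reverse := by
  simp [firstDigits, List.range_succ]

theorem ofBits_firstDigits {k : ℕ} {l : List Bool} (h : l.length ≤ k) :
    ofBits (firstDigits l k) = ofBits l := by
  induction k generalizing l with
  | zero =>
    rw [List.length_eq_zero_iff.mp (Nat.le_zero.mp h)]
    rfl
  | succ k ih =>
    rw [firstDigits, List.range_succ_eq_map, List.map_cons, List.map_map, ofBits_cons]
    cases l with
    | nil => simpa [firstDigits, Function.comp_def, ofBits] using ih (l := []) (by simp)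
    | cons b l =>
      rw [ofBits_cons, ← ih (l := l) (by simpa using h)]
      rfl

end Digits

section Answer

variable {A B : Type}

/-- Contents of the stacks after the oracle call. The most significant digit of the number `bt` and
the least significant digit of the number `bf` are at the top. -/
def ansMem (a out bt bf : List Bool) (c : Ctr → ℕ) : Mem A B where
  answer := a
  output := out
  bits b := cond b bt bf
  ctr := c

variable {a out bt bf l : List Bool} {c : Ctr → ℕ} {σ : Type} {s : σ}

theorem setCtr_ansMem (k : Ctr) (x : ℕ) : (ansMem a out bt bf c : Mem A B).setCtr k x =
    ansMem a out bt bf (Function.update c k x) := rfl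

theorem setBits_true_ansMem : (ansMem a out bt bf c : Mem A B).setBits true l =
    ansMem a out l bf c := by
  simp only [ansMem, Mem.setBits, Mem.mk.injEq, true_and, and_true]
  funext b
  cases b <;> simp

theorem setBits_false_ansMem : (ansMem a out bt bf c : Mem A B).setBits false l =
    ansMem a out bt l c := by
  simp only [ansMem, Mem.setBits, Mem.mk.injEq, true_and, and_true]
  funext b
  cases b <;> simp

theorem mRuns_pushTrue {f : σ → Bool} : MRuns (.push (.inr (.bits true)) f) s
    (ansMem a out bt bf c : Mem A B) 1 s (ansMem a out (f s :: bt) bf c) :=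
  MRuns.pushBits.conv le_rfl setBits_true_ansMem

theorem mRuns_pushFalse {f : σ → Bool} : MRuns (.push (.inr (.bits false)) f) s
    (ansMem a out bt bf c : Mem A B) 1 s (ansMem a out bt (f s :: bf) c) :=
  MRuns.pushBits.conv le_rfl setBits_false_ansMem

variable {body : Bool → Prog (Alph A B) σ} {b : Bool} {s₁ s₂ : σ} {m₁ m₂ : Mem A B} {t t' : ℕ}

theorem mRuns_loopTrue_cons (h : MRuns (body b) s (ansMem a out bt bf c) t s₁ m₁)
    (h' : MRuns (.loop (.inr (.bits true)) body) s₁ m₁ t' s₂ m₂) :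
    MRuns (.loop (.inr (.bits true)) body) s (ansMem a out (b :: bt) bf c) (t + t' + 1) s₂ m₂ :=
  MRuns.loop_cons (k := .inr (.bits true)) rfl
    ((Mem.update_bits _ _ _).trans (congrArg Mem.stk setBits_true_ansMem)) h h'

theorem mRuns_loopFalse_cons (h : MRuns (body b) s (ansMem a out bt bf c) t s₁ m₁)
    (h' : MRuns (.loop (.inr (.bits false)) body) s₁ m₁ t' s₂ m₂) :
    MRuns (.loop (.inr (.bits false)) body) s (ansMem a out bt (b :: bf) c) (t + t' + 1) s₂ m₂ :=
  MRuns.loop_cons (k := .inr (.bits false)) rfl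
    ((Mem.update_bits _ _ _).trans (congrArg Mem.stk setBits_false_ansMem)) h h'

end Answer

section Transfer

variable {A B σ : Type} {s : σ} {a out bt bf : List Bool} {c : Ctr → ℕ}

/-- Move the digits of the first number on the stack of the second one. -/
def moveToFalse : Prog (Alph A B) σ :=
  .loop (.inr (.bits true)) fun b => .push (.inr (.bits false)) fun _ => b

theorem mRuns_moveToFalse : MRuns moveToFalse s (ansMem a out bt bf c : Mem A B)
    (2 * bt.length + 1) s (ansMem a out [] (bt.reverse ++ bf) c) := by
  induction bt generalizing bf with
  | nil => exact MRuns.loop_nil rfl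
  | cons b bt ih =>
    exact (mRuns_loopTrue_cons mRuns_pushFalse ih).conv (by grind) (by simp)

/-- Move the digits of the second number on the stack of the first one. -/
def moveToTrue : Prog (Alph A B) σ :=
  .loop (.inr (.bits false)) fun b => .push (.inr (.bits true)) fun _ => b

theorem mRuns_moveToTrue : MRuns moveToTrue s (ansMem a out bt bf c : Mem A B)
    (2 * bf.length + 1) s (ansMem a out (bf.reverse ++ bt) [] c) := by
  induction bf generalizing bt with
  | nil => exact MRuns.loop_nil rfl
  | cons b bf ih =>
    exact (mRuns_loopFalse_cons mRuns_pushTrue ih).conv (by grind) (by simp)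

/-- Move the digits of the first number to the output. -/
def moveToOutput : Prog (Alph A B) σ :=
  .loop (.inr (.bits true)) fun b => .push (.inl .output) fun _ => b

theorem mRuns_moveToOutput : MRuns moveToOutput s (ansMem a out bt bf c : Mem A B)
    (2 * bt.length + 1) s (ansMem a (bt.reverse ++ out) [] bf c) := by
  induction bt generalizing out with
  | nil => exact MRuns.loop_nil rfl
  | cons b bt ih =>
    exact (mRuns_loopTrue_cons (m₁ := ansMem a (b :: out) bt bf c) MRuns.pushOutput ih).conv
      (by grind) (by simp)

end Transfer

section ReadAnswer

variable {A B σ : Type} {r : σ} {out bt bf y : List Bool} {c : Ctr → ℕ}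

/-- Read one digit of the answer. -/
def readBit : Prog (Alph A B) (Bool × σ) :=
  .seq (.pop (.inl .answer) fun s o => (o.getD false, s.2))
    (.seq (.push (.inr (.bits true)) Prod.fst) (.load fun s => (false, s.2)))

theorem mRuns_readBit (i : ℕ) :
    MRuns readBit (false, r)
      (ansMem (y.drop i) out ((firstDigits y i).reverse ++ bt) bf c : Mem A B) 3 (false, r)
      (ansMem (y.drop (i + 1)) out ((firstDigits y (i + 1)).reverse ++ bt) bf c) := by
  refine (MRuns.popAnswer.seq ((mRuns_pushTrue (a := (y.drop i).tail) (f := Prod.fst)).seq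
    MRuns.load)).conv le_rfl ?_
  rw [List.tail_drop, reverse_firstDigits_succ]
  simp [ansMem]

/-- Read `P * L + 1` digits of the answer, where `P` is the value of the counter `tmp`. -/
def readAnswer (L : ℕ) : Prog (Alph A B) (Bool × σ) :=
  .seq (.push (.inr (.bits true)) fun _ => false)
    (.seq (.loop (.inr (.ctr .tmp)) fun _ => Prog.iter readBit L) readBit)

theorem mRuns_readAnswer (L b P : ℕ) :
    MRuns (readAnswer L) (false, r) (ansMem y [] [] [] (ctrs 0 0 b 0 0 P P) : Mem A B)
      (P * (L * 3 + 2) + 5) (false, r)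
      (ansMem (y.drop (P * L + 1)) [] ((firstDigits y (P * L + 1)).reverse ++ [false]) []
        (ctrs 0 0 b 0 0 0 P)) := by
  let mem (i x : ℕ) : Mem A B :=
    ansMem (y.drop i) [] ((firstDigits y i).reverse ++ [false]) [] (ctrs 0 0 b 0 0 x P)
  have hloop := MRuns.loopCtr (s := ((false, r) : Bool × σ)) (c := .tmp) (t := L * 3 + 1) (k := P)
    (body := fun _ => Prog.iter readBit L) (fun i => mem (i * L) P) fun i _ x => by
      have hround := Prog.runs_iter (p := readBit) (n := L) (B := 3)
        (fun j => (((false, r) : Bool × σ), (mem (i * L + j) x).stk))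
        fun j _ => mRuns_readBit (i * L + j)
      simp only [mem, setCtr_ansMem, update_ctrs_tmp, Nat.succ_mul]
      exact hround
  simp only [mem, setCtr_ansMem, update_ctrs_tmp, Nat.zero_mul] at hloop
  refine (mRuns_pushTrue.seq (hloop.seq (mRuns_readBit (P * L)))).mono ?_
  nlinarith

end ReadAnswer

section Division

variable {A B : Type} {w : ℕ} [NeZero w] {a out bt : List Bool}

/-- Divide the first number by `w`, from the most significant digit on. The second component of the
store is the remainder. -/
def divideDigits : Prog (Alph A B) (Bool × Fin w) :=
  .loop (.inr (.bits true)) fun b =>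
    .seq (.push (.inr (.bits false)) fun s => decide (w ≤ 2 * s.2.val + b.toNat))
      (.load fun s => (s.1, Fin.ofNat w (2 * s.2.val + b.toNat)))

theorem decide_mul_add_mod {w x : ℕ} (hx : x < 2 * w) :
    (decide (w ≤ x)).toNat * w + x % w = x := by
  by_cases hw : w ≤ x
  · rw [decide_eq_true hw, Nat.mod_eq_sub_mod hw, Nat.mod_eq_of_lt (by omega), Bool.toNat_true]
    omega
  · rw [decide_eq_false hw, Nat.mod_eq_of_lt (by omega), Bool.toNat_false, Nat.zero_mul,
      Nat.zero_add]

theorem mRuns_divideDigits (bt : List Bool) (r : Fin w) (bf : List Bool) :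
    ∃ (bf' : List Bool) (r' : Fin w), bf'.length = bf.length + bt.length ∧
      ofBits bf' * w + r' = (ofBits bf * w + r) * 2 ^ bt.length + ofBits bt.reverse ∧
      ∀ (f : Bool) (c : Ctr → ℕ), MRuns divideDigits (f, r) (ansMem a out bt bf c : Mem A B)
        (3 * bt.length + 1) (f, r') (ansMem a out [] bf' c) := by
  induction bt generalizing r bf with
  | nil => exact ⟨bf, r, rfl, by simp [ofBits], fun f c => MRuns.loop_nil rfl⟩
  | cons b bt ih =>
    obtain ⟨bf', r', hlen, hval, hrun⟩ := ih (Fin.ofNat w (2 * r.val + b.toNat))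
      (decide (w ≤ 2 * r.val + b.toNat) :: bf)
    refine ⟨bf', r', by rw [hlen, List.length_cons, List.length_cons]; omega, ?_, fun f c => ?_⟩
    · have hdigit := decide_mul_add_mod (w := w) (x := 2 * r.val + b.toNat) (by
        have := r.2
        have := b.toNat_le
        omega)
      rw [hval, ofBits_cons, List.reverse_cons, ofBits_append, List.length_reverse,
        List.length_cons, Fin.val_ofNat, Nat.add_mul (2 * ofBits bf), Nat.add_assoc (_ * w), hdigit,
        ofBits_cons]
      simp only [ofBits, List.foldr_nil]
      ring
    · refine (mRuns_loopTrue_cons (mRuns_pushFalse.seq MRuns.load) (hrun f c)).mono ?_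
      rw [List.length_cons]
      omega

/-- Replace the first number by its quotient by `w`. -/
def divide : Prog (Alph A B) (Bool × Fin w) :=
  .seq divideDigits (.seq moveToTrue (.load fun s => (s.1, 0)))

theorem mRuns_divide (bt : List Bool) : ∃ bt' : List Bool, bt'.length = bt.length ∧
    ofBits bt'.reverse = ofBits bt.reverse / w ∧ ∀ (f : Bool) (c : Ctr → ℕ),
      MRuns divide ((f, 0) : Bool × Fin w) (ansMem a out bt [] c : Mem A B)
        (5 * bt.length + 3) (f, 0) (ansMem a out bt' [] c) := by
  obtain ⟨bf, r, hlen, hval, hrun⟩ :=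
    mRuns_divideDigits (A := A) (B := B) (a := a) (out := out) bt (0 : Fin w) []
  rw [List.length_nil, Nat.zero_add] at hlen
  refine ⟨bf.reverse, by rw [List.length_reverse, hlen], ?_, fun f c => ?_⟩
  · have hquot : ofBits bf * w + r = ofBits bt.reverse := by
      simpa [ofBits] using hval
    rw [List.reverse_reverse, ← hquot, Nat.add_comm,
      Nat.add_mul_div_right _ _ (Nat.pos_of_neZero w), Nat.div_eq_of_lt r.2, Nat.zero_add]
  · refine ((hrun f c).seq (mRuns_moveToTrue.seq MRuns.load)).conv (by omega) ?_
    rw [List.append_nil]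

theorem mRuns_divide_pow (bt : List Bool) (b P : ℕ) : ∃ bt' : List Bool,
    bt'.length = bt.length ∧ ofBits bt'.reverse = ofBits bt.reverse / w ^ P ∧
      MRuns (.loop (.inr (.ctr .cells)) fun _ => divide) ((false, 0) : Bool × Fin w)
        (ansMem a out bt [] (ctrs 0 0 b 0 0 0 P) : Mem A B) (P * (5 * bt.length + 4) + 1) (false, 0)
        (ansMem a out bt' [] (ctrs 0 0 b 0 0 0 0)) := by
  choose g hlen hval hrun using mRuns_divide (A := A) (B := B) (w := w) (a := a) (out := out)
  have hlen_iterate (i : ℕ) : (g^[i] bt).length = bt.length := by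
    induction i with
    | zero => rfl
    | succ i ih => rw [Function.iterate_succ_apply', hlen, ih]
  have hval_iterate (i : ℕ) : ofBits (g^[i] bt).reverse = ofBits bt.reverse / w ^ i := by
    induction i with
    | zero => simp
    | succ i ih => rw [Function.iterate_succ_apply', hval, ih, Nat.div_div_eq_div_mul, pow_succ]
  refine ⟨g^[P] bt, hlen_iterate P, hval_iterate P, ?_⟩
  have hloop := MRuns.loopCtr (A := A) (B := B) (s := ((false, 0) : Bool × Fin w)) (c := .cells)
    (t := 5 * bt.length + 3) (k := P) (body := fun _ => divide)
    (fun i => ansMem a out (g^[i] bt) [] (ctrs 0 0 b 0 0 0 P)) fun i _ x => by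
      have hround := hrun (g^[i] bt) false (ctrs 0 0 b 0 0 0 x)
      rw [hlen_iterate, ← Function.iterate_succ_apply' g] at hround
      simpa only [setCtr_ansMem, update_ctrs_cells] using hround
  simp only [setCtr_ansMem, update_ctrs_cells] at hloop
  exact hloop

end Division

section Halving

variable {A B σ : Type} {a out : List Bool} {c : Ctr → ℕ}

/-- Add the first component of the store to the second number, and move it to the first stack. -/
def addCarry : Prog (Alph A B) (Bool × σ) :=
  .loop (.inr (.bits false)) fun b =>
    .seq (.push (.inr (.bits true)) fun s => xor b s.1) (.load fun s => (b && s.1, s.2))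

theorem mRuns_addCarry (bf : List Bool) (f : Bool) (bt : List Bool) (r : σ) :
    ∃ (l : List Bool) (f' : Bool), l.length = bf.length ∧
      ofBits l + f'.toNat * 2 ^ bf.length = ofBits bf + f.toNat ∧
      MRuns addCarry (f, r) (ansMem a out bt bf c : Mem A B) (3 * bf.length + 1) (f', r)
        (ansMem a out (l.reverse ++ bt) [] c) := by
  induction bf generalizing f bt with
  | nil => exact ⟨[], f, rfl, by simp, MRuns.loop_nil rfl⟩
  | cons b bf ih =>
    obtain ⟨l, f', hlen, hval, hrun⟩ := ih (b && f) (xor b f :: bt)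
    refine ⟨xor b f :: l, f', by rw [List.length_cons, hlen, List.length_cons], ?_, ?_⟩
    · rw [ofBits_cons, ofBits_cons, List.length_cons, pow_succ]
      have hdigit : (xor b f).toNat + 2 * (b && f).toNat = b.toNat + f.toNat := by
        cases b <;> cases f <;> rfl
      nlinarith
    · refine (mRuns_loopFalse_cons (mRuns_pushTrue.seq MRuns.load) hrun).conv ?_ (by simp)
      rw [List.length_cons]
      omega

/-- Output `(V + 1) / 2` for the first number `V`. -/
def halveUp : Prog (Alph A B) (Bool × σ) :=
  .seq moveToFalse (.seq (.load fun s => (true, s.2)) (.seq addCarry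
    (.seq (.push (.inr (.bits true)) Prod.fst)
      (.seq moveToOutput (.pop (.inl .output) fun s _ => s)))))

theorem mRuns_halveUp (bt : List Bool) (f : Bool) (r : σ) : ∃ (s : Bool × σ) (out : List Bool),
    ofBits out = (ofBits bt.reverse + 1) / 2 ∧
    MRuns halveUp (f, r) (ansMem a [] bt [] c : Mem A B) (7 * bt.length + 8) s
      (ansMem a out [] [] c) := by
  obtain ⟨l, f', hlen, hval, hcarry⟩ :=
    mRuns_addCarry (A := A) (B := B) (a := a) (out := []) (c := c) (bt.reverse ++ []) true [] r
  have hpop := MRuns.popOutput (s := (f', r)) (f := fun s _ => s)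
    (m := (ansMem a ((f' :: (l.reverse ++ [])).reverse ++ []) [] [] c : Mem A B))
  refine ⟨(f', r), (l ++ [f']).tail, ?_, (mRuns_moveToFalse.seq (MRuns.load.seq (hcarry.seq
    (mRuns_pushTrue.seq (mRuns_moveToOutput.seq hpop))))).conv ?_ (by simp [ansMem])⟩
  · have hsum : ofBits (l ++ [f']) = ofBits bt.reverse + 1 := by
      rw [← hlen, List.append_nil, Bool.toNat_true] at hval
      rw [ofBits_append, ofBits_cons, ← hval]
      simp only [ofBits, List.foldr_nil]
      ring
    rw [ofBits_tail, hsum]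
  · simp only [List.append_nil, List.length_reverse, List.length_cons] at hlen ⊢
    omega

end Halving

section Postprocess

variable {A B : Type} {w : ℕ} [NeZero w]

/-- The computation after the oracle call. -/
def postprocess (L : ℕ) : Prog (Alph A B) (Bool × Fin w) :=
  .seq (readAnswer L) (.seq (.loop (.inr (.ctr .cells)) fun _ => divide) halveUp)

/-- A bound for the run-time of `postprocess` with `P` cells of `L` variables each. -/
def postprocessTime (L P : ℕ) : ℕ :=
  P * (L * 3 + 2) + P * (5 * (P * L + 2) + 4) + 7 * (P * L + 2) + 14

theorem mRuns_postprocess (L b P Y : ℕ) : ∃ (s : Bool × Fin w) (m : Mem A B),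
    (Y < 2 ^ (P * L + 1) → ofBits m.output = (2 * Y / w ^ P + 1) / 2) ∧
    MRuns (postprocess L) ((false, 0) : Bool × Fin w)
      (ansMem (Nat.bits Y) [] [] [] (ctrs 0 0 b 0 0 P P)) (postprocessTime L P) s m := by
  let y := (firstDigits (Nat.bits Y) (P * L + 1)).reverse ++ [false]
  have hy : y.length = P * L + 2 := by simp [y, length_firstDigits]
  obtain ⟨bt, hlen, hval, hdivide⟩ := mRuns_divide_pow (A := A) (B := B) (w := w)
    (a := (Nat.bits Y).drop (P * L + 1)) (out := []) y b P
  obtain ⟨s, out, hout, hhalve⟩ := mRuns_halveUp (A := A) (B := B)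
    (a := (Nat.bits Y).drop (P * L + 1)) (c := ctrs 0 0 b 0 0 0 0) bt false (0 : Fin w)
  refine ⟨s, _, fun hY => ?_, ((mRuns_readAnswer L b P).seq (hdivide.seq hhalve)).mono ?_⟩
  · have hdouble : ofBits y.reverse = 2 * Y := by
      rw [List.reverse_append, List.reverse_reverse, List.reverse_singleton,
        List.singleton_append, ofBits_cons, ofBits_firstDigits, ofBits_bits, Bool.toNat_false,
        Nat.add_zero]
      rw [Nat.size_eq_bits_len]
      exact Nat.size_le.mpr hY
    exact hout.trans (by rw [hval, hdouble])
  · rw [hlen, hy, postprocessTime]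
    omega

end Postprocess

/-! ### Rounding -/

section Rounding

theorem abs_sub_le_of_mem_goodApprox {v N Y : ℕ} (hN : 1 ≤ N) (hY : Y ∈ goodApprox v N) :
    |(Y : ℝ) - v| ≤ 2 * (1 / N) * v := by
  obtain ⟨hlower, hupper⟩ := hY
  have hε₀ : (0 : ℝ) ≤ 1 / N := by positivity
  have hε₁ : (1 : ℝ) / N ≤ 1 := div_le_one_of_le₀ (by exact_mod_cast hN) (Nat.cast_nonneg N)
  have hexp := Real.abs_exp_sub_one_le (x := 1 / N) (by rwa [abs_of_nonneg hε₀])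
  have hexp_neg := Real.abs_exp_sub_one_le (x := -(1 / N)) (by rwa [abs_neg, abs_of_nonneg hε₀])
  rw [abs_of_nonneg hε₀, abs_le] at hexp
  rw [abs_neg, abs_of_nonneg hε₀, abs_le] at hexp_neg
  rw [abs_le]
  constructor <;> nlinarith

theorem exp_neg_le_one_sub_half {x : ℝ} (h₀ : 0 ≤ x) (h₁ : x ≤ 1) :
    Real.exp (-x) ≤ 1 - x / 2 := by
  have hx : 0 < x + 1 := by linarith
  rw [Real.exp_neg]
  refine (inv_anti₀ hx (Real.add_one_le_exp x)).trans ?_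
  rw [inv_le_iff_one_le_mul₀ hx]
  nlinarith

theorem mem_goodApprox_of_abs_sub_le {v N R : ℕ} (hN : 1 ≤ N)
    (hR : |(R : ℝ) - v| ≤ 1 / N / 2 * v) : R ∈ goodApprox v N := by
  have hε₀ : (0 : ℝ) ≤ 1 / N := by positivity
  have hε₁ : (1 : ℝ) / N ≤ 1 := div_le_one_of_le₀ (by exact_mod_cast hN) (Nat.cast_nonneg N)
  have hexp := Real.add_one_le_exp (1 / (N : ℝ))
  have hexp_neg := exp_neg_le_one_sub_half hε₀ hε₁
  have hv : (0 : ℝ) ≤ v := Nat.cast_nonneg v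
  rw [abs_le] at hR
  constructor <;> nlinarith

theorem abs_half_up_sub_div_le {W : ℕ} (hW : 0 < W) (Y : ℕ) :
    |(((2 * Y / W + 1) / 2 : ℕ) : ℝ) - Y / W| ≤ 1 / 2 := by
  have hfloor : (2 * Y / W + 1) / 2 = (2 * Y + W) / (W * 2) := by
    rw [← Nat.add_div_right _ hW, Nat.div_div_eq_div_mul]
  rw [hfloor]
  set R := (2 * Y + W) / (W * 2)
  have hlower : (R * (W * 2) : ℝ) ≤ 2 * Y + W := by
    exact_mod_cast Nat.div_mul_le_self (2 * Y + W) (W * 2)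
  have hupper : (2 * Y + W : ℝ) < R * (W * 2) + W * 2 := by
    exact_mod_cast Nat.lt_div_mul_add (a := 2 * Y + W) (b := W * 2) (by omega)
  have hW' : (0 : ℝ) < W := by exact_mod_cast hW
  rw [sub_div' hW'.ne', abs_div, abs_of_pos hW', div_le_iff₀ hW', abs_le]
  constructor <;> linarith

theorem abs_sub_le_of_abs_sub_le_half {R Z : ℕ} {y δ : ℝ} (hy : |y - Z| ≤ δ)
    (hR : |(R : ℝ) - y| ≤ 1 / 2) : |(R : ℝ) - Z| ≤ 2 * δ := by
  have htriangle : |(R : ℝ) - Z| ≤ 1 / 2 + δ :=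
    (abs_sub_le _ y _).trans (add_le_add hR hy)
  rcases lt_or_ge δ (1 / 2) with hδ | hδ
  · have hlt : |((R : ℤ) - Z : ℤ)| < 1 := by
      have : |(R : ℝ) - Z| < 1 := by linarith
      exact_mod_cast this
    have hRZ : (R : ℝ) - Z = 0 := by exact_mod_cast Int.abs_lt_one_iff.mp hlt
    rw [hRZ, abs_zero]
    linarith [abs_nonneg (y - Z)]
  · linarith

theorem half_up_mem_goodApprox {Z W Y N : ℕ} (hW : 0 < W) (hN : 1 ≤ N)
    (hY : Y ∈ goodApprox (Z * W) (8 * N)) : (2 * Y / W + 1) / 2 ∈ goodApprox Z N := by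
  have hW' : (0 : ℝ) < W := by exact_mod_cast hW
  have hquot : |(Y : ℝ) / W - Z| ≤ 1 / N / 4 * Z := by
    have hsub := abs_sub_le_of_mem_goodApprox (by omega) hY
    push_cast at hsub
    rw [div_sub' hW'.ne', abs_div, abs_of_pos hW', div_le_iff₀ hW', mul_comm (W : ℝ)]
    exact hsub.trans_eq (by ring)
  apply mem_goodApprox_of_abs_sub_le hN
  exact (abs_sub_le_of_abs_sub_le_half hquot (abs_half_up_sub_div_le hW Y)).trans_eq (by ring)

theorem lt_two_pow_of_mem_goodApprox {v N Y k : ℕ} (hN : 3 ≤ N) (hv : v ≤ 2 ^ k)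
    (hY : Y ∈ goodApprox v N) : Y < 2 ^ (k + 1) := by
  have hsub := (abs_le.mp (abs_sub_le_of_mem_goodApprox (by omega) hY)).2
  have hε : 1 / (N : ℝ) ≤ 1 / 3 :=
    one_div_le_one_div_of_le (by norm_num) (by exact_mod_cast hN)
  have hv' : (v : ℝ) ≤ 2 ^ k := by exact_mod_cast hv
  have hpow : (0 : ℝ) < 2 ^ k := by positivity
  have hY' : (Y : ℝ) < 2 ^ (k + 1) := by
    rw [pow_succ]
    nlinarith [Nat.cast_nonneg (α := ℝ) v]
  exact_mod_cast hY'

end Rounding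

/-! ### The reduction -/

section Reduction

variable {Γ Δ : ConstraintLanguage}

theorem CSPInstance.Z_le (I : CSPInstance Γ) : I.Z ≤ 2 ^ I.numVars := by
  have hcard := Set.ncard_le_ncard (Set.subset_univ {s : Fin I.numVars → Bool | I.Satisfies s})
  rwa [Set.ncard_univ, Nat.card_eq_fintype_card, Fintype.card_fun, Fintype.card_bool,
    Fintype.card_fin] at hcard

theorem CSPInstance.numVars_le (I : CSPInstance Γ) : I.numVars ≤ I.encode.length := by
  rw [CSPInstance.encode, encodeNum]
  simp only [List.length_append, List.length_replicate]
  omega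

theorem length_le_length_flatMap_encodeNum (l : List ℕ) :
    l.length ≤ (l.flatMap (encodeNum Γ)).length := by
  induction l with
  | nil => rfl
  | cons v l ih =>
    simp only [List.flatMap_cons, List.length_append, List.length_cons, encodeNum,
      List.length_replicate]
    omega

theorem length_occurrences_le {n : ℕ} (cs : List (Constraint Γ n)) :
    (occurrences cs).length ≤ (cs.flatMap encodeConstraint).length := by
  induction cs with
  | nil => rfl
  | cons c cs ih =>
    have hscope := length_le_length_flatMap_encodeNum (Γ := Γ) (List.ofFn fun i => (c.2 i : ℕ))
    have hhead : (List.ofFn c.2).length ≤ (encodeConstraint c).length := by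
      rw [encodeConstraint_eq, encodeNatConstraint, List.length_cons, List.length_ofFn]
      rw [List.length_ofFn] at hscope
      exact hscope.trans (Nat.le_succ _)
    rw [List.flatMap_cons, List.length_append]
    exact List.length_append.trans_le (add_le_add hhead ih)

theorem numCells_le (I : CSPInstance Γ) :
    numCells I ≤ (I.encode.length + 2) * I.encode.length := by
  have hocc : (occurrences I.constraints).length ≤ I.encode.length := by
    rw [CSPInstance.encode, List.length_append]
    exact (length_occurrences_le I.constraints).trans (Nat.le_add_left _ _)
  exact Nat.mul_le_mul (Nat.add_le_add_right hocc 2) I.numVars_le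

theorem exists_polynomial_eval_eq (L o K : ℕ) : ∃ p : Polynomial ℕ, ∀ x, p.eval x =
    prepareTime L o K x ((x + 2) * x) x + postprocessTime L ((x + 2) * x) + 2 := by
  let X : Polynomial ℕ := Polynomial.X
  let P : Polynomial ℕ := (X + 2) * X
  let l : Polynomial ℕ := Polynomial.C L
  refine ⟨(3 * (X * (P * (l + 11) + Polynomial.C o + 9) + P * (Polynomial.C K * (P + 1) + 5) + 4) +
    P * (l + 4) + 10 * X + 4) + (P * (l * 3 + 2) + P * (5 * (P * l + 2) + 4) + 7 * (P * l + 2) + 14)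
    + 2, fun x => ?_⟩
  simp only [X, P, l, prepareTime, postprocessTime, Polynomial.eval_add, Polynomial.eval_mul,
    Polynomial.eval_X, Polynomial.eval_C, Polynomial.eval_ofNat, Polynomial.eval_one]

theorem exists_polynomial_bound (Γ : ConstraintLanguage) (L o K : ℕ) :
    ∃ p : Polynomial ℕ, ∀ (I : CSPInstance Γ) (N : ℕ),
      prepareTime L o K I.encode.length (numCells I) N + postprocessTime L (numCells I) + 2 ≤
        p.eval (I.encode.length + N) := by
  obtain ⟨p, hp⟩ := exists_polynomial_eval_eq L o K
  refine ⟨p, fun I N => ?_⟩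
  have hinput : I.encode.length ≤ I.encode.length + N := Nat.le_add_right _ _
  have herror : N ≤ I.encode.length + N := Nat.le_add_left _ _
  have hcells : numCells I ≤ (I.encode.length + N + 2) * (I.encode.length + N) :=
    (numCells_le I).trans (by gcongr)
  rw [hp]
  simp only [prepareTime, postprocessTime]
  gcongr

theorem initStk_eq (x : List (Sym Γ)) (N : ℕ) :
    (OracleMachine.initStk x N : ∀ k, List (Alph (Sym Γ) (Sym Δ) k)) =
      (prepMem x N [] (ctrs 0 0 0 0 0 0 0)).stk := by
  funext k
  rcases k with k | c | _ | _
  · cases k <;> rfl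
  · cases c <;> rfl
  · rfl
  · rfl

theorem answerStk_eq (q : List (Sym Δ)) (e : ℕ) (c : Ctr → ℕ) (Y : ℕ) :
    OracleMachine.answerStk (queryMem (Γ := Γ) 0 q e c).stk Y =
      (ansMem (Nat.bits Y) [] [] [] c : Mem (Sym Γ) (Sym Δ)).stk := by
  funext k
  rcases k with k | _ | _ | b
  · cases k <;> rfl
  · rfl
  · rfl
  · cases b <;> rfl

variable {d : ℕ} (hΓ : Γ ⊆ Δ) (H : Gadget Δ d 2) (G : Gadget Δ d (2 * H.entries + 2))

/-- The factor that a cell contributes to the number of satisfying assignments of the instance of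
bounded degree. -/
def cellFactor : ℕ := 2 * H.mult * G.mult ^ H.numVars

instance : NeZero (cellFactor H G) :=
  ⟨(Nat.mul_pos (Nat.mul_pos two_pos H.mult_pos) (Nat.pow_pos G.mult_pos)).ne'⟩

theorem lt_two_pow_of_mem_goodApprox_boundedInstance {I : CSPInstance Γ} {N Y : ℕ} (hN : 3 ≤ N)
    (hY : Y ∈ goodApprox (boundedInstance hΓ H G I).Z N) :
    Y < 2 ^ (numCells I * (H.numVars * G.numVars) + 1) := by
  rw [← Nat.mul_assoc]
  exact lt_two_pow_of_mem_goodApprox hN (boundedInstance hΓ H G I).Z_le hY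

theorem mRuns_postprocess_boundedInstance {I : CSPInstance Γ} {N : ℕ} (hN : 1 ≤ N) (b Y : ℕ) :
    ∃ (s : Bool × Fin (cellFactor H G)) (m : Mem (Sym Γ) (Sym Δ)),
      MRuns (postprocess (H.numVars * G.numVars)) (false, 0)
        (ansMem (Nat.bits Y) [] [] [] (ctrs 0 0 b 0 0 (numCells I) (numCells I)))
        (postprocessTime (H.numVars * G.numVars) (numCells I)) s m ∧
      (Y ∈ goodApprox (boundedInstance hΓ H G I).Z (8 * N) →
        ofBits m.output ∈ goodApprox I.Z N) := by
  obtain ⟨s, m, hout, hrun⟩ := mRuns_postprocess (A := Sym Γ) (B := Sym Δ)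
    (w := cellFactor H G) (H.numVars * G.numVars) b (numCells I) Y
  refine ⟨s, m, hrun, fun hY => ?_⟩
  rw [hout (lt_two_pow_of_mem_goodApprox_boundedInstance hΓ H G (by omega) hY)]
  rw [boundedInstance_Z] at hY
  exact half_up_mem_goodApprox (Nat.pow_pos (Nat.pos_of_neZero (cellFactor H G))) hN hY

include hΓ G in
theorem apReducible_of_gadgets : APReducible (numCSP Γ) (numCSPDeg d Δ) := by
  obtain ⟨K, hprepare⟩ := mRuns_prepare (σ := Fin (cellFactor H G)) hΓ H G
  obtain ⟨p, hp⟩ := exists_polynomial_bound Γ (H.numVars * G.numVars) (2 * H.entries) K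
  refine OracleMachine.apReducible_of_progs p (prepare hΓ H G)
    (postprocess (H.numVars * G.numVars)) (true, (0 : Fin (cellFactor H G))) fun I N hN => ?_
  change CSPInstance Γ at I
  obtain ⟨b, hrun⟩ := hprepare I N 0
  let J := boundedInstance hΓ H G I
  let m : Mem (Sym Γ) (Sym Δ) :=
    queryMem 0 J.encode (8 * N) (ctrs 0 0 b 0 0 (numCells I) (numCells I))
  have herr : (m.stk (.inl .queryErr)).length = 8 * N := List.length_replicate
  refine ⟨⟨J, boundedInstance_degree hΓ H G I⟩, _, _, ((false, 0), m.stk), ?_, rfl, ?_, ?_, hp I N,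
    fun Y => ?_⟩
  · change Prog.Runs _ (_, OracleMachine.initStk I.encode N) _ _
    rw [initStk_eq]
    exact hrun
  · exact (show 2 ≤ 8 * N by omega).trans_eq herr.symm
  · refine herr.trans_le (le_trans ?_ (hp I N))
    rw [prepareTime]
    omega
  · obtain ⟨s, m', hrun', hgood⟩ :=
      mRuns_postprocess_boundedInstance hΓ H G (I := I) (N := N) (by omega) b Y
    refine ⟨(s, m'.stk), ?_, fun hY => hgood ?_⟩
    · rw [answerStk_eq]
      exact hrun'
    · rw [← herr]
      exact hY

end Reduction

end BoolCSP

end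

theorem proposition4p1 (Γ : BoolCSP.ConstraintLanguage) (d : ℕ)
    (h : BoolCSP.DSimulatesEquality d Γ) :
    BoolCSP.APReducible (BoolCSP.numCSP Γ)
      (BoolCSP.numCSPDeg d (Γ ∪ BoolCSP.pinLanguage)) := by
  obtain ⟨H⟩ := BoolCSP.exists_gadget (by omega) (h 2 le_rfl)
  obtain ⟨G⟩ := BoolCSP.exists_gadget (by omega) (h (2 * H.entries + 2) (by omega))
  exact BoolCSP.apReducible_of_gadgets Finset.subset_union_left H G
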